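/- Let $G=(V,E)$ be a finite connected graph (loops and parallel edges allowed) with $m=|E|$ edges, drawn in the plane without crossings: vertices are distinct points, each edge $e$ is a simple continuous curve between its endvertices (closed if $e$ is a loop), and the interior of each such curve is disjoint from all other curves. The faces of the drawing are the connected components of the complement of the union of all curves. Let $G^\dagger$ be the dual graph: its vertices are the faces, and each edge $e$ of $G$ has one dual edge joining the faces on the two sides of $e$ (a loop if both sides belong to the same face). Let $p\in(0,1)$, let $q\ge 1$ be an integer, and let $p^*=\frac{q(1-p)}{p+q(1-p)}$. For a graph $H=(V_H,E_H)$ and parameters $p,q$, the following are Markov chains on the subsets of $E_H$. * Swendsen–Wang dynamics $\mathrm{SW}$: from $A\subseteq E_H$, give each connected component of $(V_H,A)$ an independent uniform color from $\{1,\dots,q\}$; then keep each edge of $H$ whose endvertices have the same color independently with probability $p$, and delete all other edges. * Single-bond dynamics $\mathrm{SB}$: from $A\subseteq E_H$, choose $e\in E_H$ uniformly at random; if the endvertices of $e$ are connected in $(V_H,A)$, move to $A\cup\{e\}$ with probability $p$ and to $A\setminus\{e\}$ with probability $1-p$; otherwise move to $A\cup\{e\}$ with probability $p/q$ and to $A\setminus\{e\}$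 with probability $1-p/q$. For a transition matrix $P$ let $\lambda(P)=1-\max\{|\xi| : \xi \text{ an eigenvalue of } P,\ \xi\ne 1\}$ (with $\max\varnothing=0$). Write $\mathrm{SW},\mathrm{SB}$ for the dynamics on $G$ with parameters $p,q$, and $\mathrm{SW}^\dagger,\mathrm{SB}^\dagger$ for those on $G^\dagger$ with parameters $p^*,q$. Then $$\lambda(\mathrm{SB})\le q\,\lambda(\mathrm{SB}^\dagger),$$ and, if $m\ge 2$, $$\lambda(\mathrm{SW})\le 8q\,m\log m\;\lambda(\mathrm{SW}^\dagger).$$ -/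

import Mathlib

open scoped Graph

/-! ## Spectral gap -/

/-- The absolute spectral gap `1 - max {|ξ| : ξ eigenvalue of P, ξ ≠ 1}` of a transition matrix `P`
on a finite state space, acting on functions by `(P f)(x) = ∑ y, P x y * f y`. (The maximum over an
empty set, which occurs only on a one-point state space, is read as `0`.) -/
noncomputable def spectralGap {Ω : Type*} [Finite Ω] (P : Matrix Ω Ω ℝ) : ℝ :=
  letI : Fintype Ω := Fintype.ofFinite Ω
  1 - sSup {r : ℝ | ∃ ξ : ℝ, Module.End.HasEigenvalue P.mulVecLin ξ ∧ ξ ≠ 1 ∧ r = |ξ|}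

namespace RandomCluster

/-! ## Connectivity in spanning subgraphs of a multigraph

Graphs are Mathlib's multigraphs `Graph α β` (loops and parallel edges allowed). A random-cluster
configuration is a set `A : Set E(G)` of edges. -/

section Graphs

variable {α β : Type*}

/-- `u` and `v` are connected in `(V, A)`: there is a path from `u` to `v` all of whose steps run
along edges of `A`. -/
def Reach (G : Graph α β) (A : Set E(G)) : V(G) → V(G) → Prop :=
  Relation.ReflTransGen fun u v => ∃ e ∈ A, G.IsLink e u v

theorem reach_equivalence (G : Graph α β) (A : Set E(G)) : Equivalence (Reach G A) where
  refl _ := Relation.ReflTransGen.refl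
  symm h := by
    induction h with
    | refl => exact Relation.ReflTransGen.refl
    | tail _ hl ih =>
      obtain ⟨e, he, hl⟩ := hl
      exact Relation.ReflTransGen.head ⟨e, he, hl.symm⟩ ih
  trans h h' := Relation.ReflTransGen.trans h h'

/-- `c(A)`: the number of connected components of `(V, A)`. -/
noncomputable def numComponents (G : Graph α β) (A : Set E(G)) : ℕ :=
  Nat.card (Quotient (Setoid.mk (Reach G A) (reach_equivalence G A)))

/-- The whole graph has exactly one connected component. -/
def IsConnectedGraph (G : Graph α β) : Prop :=
  V(G).Nonempty ∧ ∀ u v : V(G), Reach G Set.univ u v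

/-- The endvertices of the edge `e` are connected in `(V, A)`. -/
def EndsConnected (G : Graph α β) (A : Set E(G)) (e : E(G)) : Prop :=
  ∀ u v : V(G), G.IsLink e u v → Reach G A u v

/-- `E(σ)`: the edges whose endvertices have the same color under `σ`. -/
def monoEdges (G : Graph α β) {q : ℕ} (σ : V(G) → Fin q) : Set E(G) :=
  {e | ∀ u v : V(G), G.IsLink e u v → σ u = σ v}

/-! ## The two dynamics for the random-cluster model with parameters `p`, `q` -/

open scoped Classical in
/-- `ν(σ | A) = q^{-c(A)} 1(A ⊆ E(σ))`: the conditional law of the coloring given the edge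
configuration, i.e. every component of `(V, A)` gets an independent uniform color. -/
noncomputable def colorGivenEdges (G : Graph α β) (q : ℕ) (A : Set E(G)) (σ : V(G) → Fin q) : ℝ :=
  if A ⊆ monoEdges G σ then ((q : ℝ) ^ numComponents G A)⁻¹ else 0

open scoped Classical in
/-- `ν(B | σ) = p^{|B|} (1-p)^{|E(σ)| - |B|} 1(B ⊆ E(σ))`: the conditional law of the edge
configuration given the coloring, i.e. each edge of `E(σ)` is kept independently with
probability `p`. -/
noncomputable def edgesGivenColor (G : Graph α β) (p : ℝ) {q : ℕ} (σ : V(G) → Fin q)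
    (B : Set E(G)) : ℝ :=
  if B ⊆ monoEdges G σ then
    p ^ B.ncard * (1 - p) ^ ((monoEdges G σ).ncard - B.ncard) else 0

/-- Transition matrix of the Swendsen--Wang dynamics for the random-cluster model:
`P(A, B) = ∑ σ, ν(σ | A) ν(B | σ)`. -/
noncomputable def swMatrix (G : Graph α β) (p : ℝ) (q : ℕ) : Matrix (Set E(G)) (Set E(G)) ℝ :=
  fun A B => ∑ᶠ σ : V(G) → Fin q, colorGivenEdges G q A σ * edgesGivenColor G p σ B

open scoped Classical in
/-- Transition matrix of the single-bond dynamics: choose an edge `e` uniformly at random and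
include it with probability `p` if its endvertices are connected in `(V, A)`, and with
probability `p / q` otherwise. -/
noncomputable def sbMatrix (G : Graph α β) (p : ℝ) (q : ℕ) : Matrix (Set E(G)) (Set E(G)) ℝ :=
  fun A B => 1 / (Nat.card E(G) : ℝ) * ∑ᶠ e : E(G),
    if EndsConnected G A e then
      (if B = insert e A then p else if B = A \ {e} then 1 - p else 0)
    else
      (if B = insert e A then p / q else if B = A \ {e} then 1 - p / q else 0)

end Graphs

/-! ## Representations in the plane and dual graphs -/

/-- The Euclidean plane. -/
abbrev Plane : Type := EuclideanSpace ℝ (Fin 2)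

/-- A representation of the graph `G` in the plane (a plane drawing without crossings): the
vertices are distinct points, the edges are simple curves (closed ones for loops) between their
endvertices, and the interior of each curve is disjoint from all other curves. -/
structure PlaneRep {α β : Type*} (G : Graph α β) where
  /-- the point `κ(v)` representing the vertex `v` -/
  point : α → Plane
  /-- the curve representing the edge `e` -/
  curve : β → C(unitInterval, Plane)
  point_injOn : Set.InjOn point V(G)
  simple : ∀ e ∈ E(G), ∀ s t : unitInterval, s ≠ t → curve e s = curve e t →
    (s = 0 ∨ s = 1) ∧ (t = 0 ∨ t = 1)
  ends_mem : ∀ e ∈ E(G), curve e 0 ∈ point '' V(G) ∧ curve e 1 ∈ point '' V(G)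
  ends_iff : ∀ e ∈ E(G), ∀ u ∈ V(G), ∀ v ∈ V(G),
    ({curve e 0, curve e 1} : Set Plane) = {point u, point v} ↔ G.IsLink e u v
  disjoint : ∀ e ∈ E(G), ∀ f ∈ E(G), e ≠ f →
    Disjoint (curve e '' Set.Ioo 0 1) (Set.range (curve f))

namespace PlaneRep

variable {α β : Type*} {G : Graph α β}

/-- The union of all curves of the representation. -/
def skeleton (R : PlaneRep G) : Set Plane :=
  ⋃ e ∈ E(G), Set.range (R.curve e)

/-- The faces of the representation: the connected components of the complement of the union of
all curves. -/
def faces (R : PlaneRep G) : Set (Set Plane) :=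
  {F | ∃ x ∈ R.skeletonᶜ, F = connectedComponentIn R.skeletonᶜ x}

/-- The faces on the two sides of the edge `e`, i.e. those whose boundary meets the interior of the
curve of `e` (and hence contains the whole curve). There are two of them, or one if both sides of
`e` belong to the same face. -/
def facesAt (R : PlaneRep G) (e : β) : Set (Set Plane) :=
  {F ∈ R.faces | (frontier F ∩ R.curve e '' Set.Ioo 0 1).Nonempty}

/-- The dual graph: one vertex for each face, and for each edge `e` of `G` one dual edge (with the
same label `e`) which joins the faces on the two sides of `e`, and is a loop if both sides of `e`
belong to the same face. -/
def dual (R : PlaneRep G) : Graph (Set Plane) β where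
  vertexSet := R.faces
  IsLink e F F' := e ∈ E(G) ∧ R.facesAt e = {F, F'}
  isLink_symm := by
    intro e _
    exact ⟨fun F F' h => ⟨h.1, by rw [h.2, Set.pair_comm]⟩⟩
  eq_or_eq_of_isLink_of_isLink := by
    rintro e x y v w ⟨_, h⟩ ⟨_, h'⟩
    have hx : x ∈ R.facesAt e := by rw [h]; simp
    rw [h'] at hx
    simpa using hx
  left_mem_of_isLink := by
    rintro e x y ⟨_, h⟩
    have hx : x ∈ R.facesAt e := by rw [h]; simp
    exact hx.1

end PlaneRep

/-- The dual parameter `p* = q(1-p) / (p + q(1-p))`. -/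
noncomputable def dualParam (p : ℝ) (q : ℕ) : ℝ :=
  q * (1 - p) / (p + q * (1 - p))

end RandomCluster

namespace RandomCluster

open Set Topology Filter Metric

/-! ## Continuous logarithms on plane sets -/

/-- The plane as the complex numbers. -/
noncomputable def toC : Plane ≃ₗᵢ[ℝ] ℂ := Complex.orthonormalBasisOneI.repr.symm

theorem toC_ne_zero {a z : Plane} (h : z ≠ a) : toC (z - a) ≠ 0 := by
  simpa [sub_eq_zero] using h

theorem continuous_toC_sub (a : Plane) : Continuous fun z => toC (z - a) := by fun_prop

/-- `f` has a continuous logarithm on `K`. -/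
def HasLog (K : Set Plane) (f : Plane → ℂ) : Prop :=
  ∃ g : Plane → ℂ, ContinuousOn g K ∧ ∀ z ∈ K, Complex.exp (g z) = f z

theorem HasLog.mono {K L : Set Plane} {f : Plane → ℂ} (h : HasLog L f) (hKL : K ⊆ L) :
    HasLog K f :=
  let ⟨g, hg, he⟩ := h
  ⟨g, hg.mono hKL, fun z hz => he z (hKL hz)⟩

theorem HasLog.congr {K : Set Plane} {f f' : Plane → ℂ} (h : HasLog K f)
    (hf : ∀ z ∈ K, f z = f' z) : HasLog K f' :=
  let ⟨g, hg, he⟩ := h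
  ⟨g, hg, fun z hz => (he z hz).trans (hf z hz)⟩

theorem HasLog.mul {K : Set Plane} {f f' : Plane → ℂ} (h : HasLog K f) (h' : HasLog K f') :
    HasLog K (fun z => f z * f' z) :=
  let ⟨g, hg, he⟩ := h
  let ⟨g', hg', he'⟩ := h'
  ⟨fun z => g z + g' z, hg.add hg', fun z hz => by
    rw [Complex.exp_add, he z hz, he' z hz]⟩

theorem HasLog.zpow {K : Set Plane} {f : Plane → ℂ} (h : HasLog K f) (n : ℤ) :
    HasLog K (fun z => f z ^ n) :=
  let ⟨g, hg, he⟩ := h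
  ⟨fun z => n * g z, continuousOn_const.mul hg, fun z hz => by
    rw [Complex.exp_int_mul, he z hz]⟩

theorem exists_continuous_log {X : Type*} [TopologicalSpace X] [SimplyConnectedSpace X]
    [LocallyPathConnectedSpace X] {f : X → ℂ} (hf : Continuous f) (h0 : ∀ x, f x ≠ 0) :
    ∃ g : X → ℂ, Continuous g ∧ ∀ x, Complex.exp (g x) = f x := by
  obtain ⟨x₀⟩ : Nonempty X := inferInstance
  obtain ⟨F, ⟨-, hF⟩, -⟩ := Complex.isCoveringMapOn_exp.existsUnique_continuousMap_lifts
    (⟨f, hf⟩ : C(X, ℂ)) (a₀ := x₀) (e₀ := Complex.log (f x₀)) (Complex.exp_log (h0 x₀))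
    (fun x => h0 x)
  exact ⟨F, F.continuous, fun x => congrFun hF x⟩

theorem eq_zero_of_exp_eq_one {w : ℂ} (h : Complex.exp w = 1) (hw : ‖w‖ < 1) : w = 0 := by
  obtain ⟨n, rfl⟩ := Complex.exp_eq_one_iff.1 h
  by_cases hn : n = 0
  · simp [hn]
  · exfalso
    have h1 : (1 : ℝ) ≤ |(n : ℝ)| := by exact_mod_cast Int.one_le_abs hn
    simp only [norm_mul, Complex.norm_intCast, Complex.norm_I, Complex.norm_real, mul_one,
      Complex.norm_ofNat, Real.norm_eq_abs, abs_of_pos Real.pi_pos] at hw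
    nlinarith [Real.pi_gt_three]

/-- Two continuous logarithms of a function on a preconnected set differ by a constant. -/
theorem log_sub_eq_of_isPreconnected {X : Type*} [TopologicalSpace X] {K : Set X}
    (hK : IsPreconnected K) {g g' : X → ℂ} (hg : ContinuousOn g K) (hg' : ContinuousOn g' K)
    (h : ∀ z ∈ K, Complex.exp (g z) = Complex.exp (g' z)) {x y : X} (hx : x ∈ K) (hy : y ∈ K) :
    g x - g' x = g y - g' y := by
  refine hK.induction₂ (fun x y => g x - g' x = g y - g' y) (fun x hx => ?_)
    (fun _ _ _ _ _ _ h h' => h.trans h') (fun _ _ _ _ h => h.symm) hx hy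
  have hc : ContinuousWithinAt (fun y => g y - g' y) K x := (hg.sub hg') x hx
  have := hc.eventually (Metric.ball_mem_nhds (g x - g' x) one_pos)
  filter_upwards [this, self_mem_nhdsWithin] with y hy hyK
  rw [dist_eq_norm] at hy
  have h0 := eq_zero_of_exp_eq_one (w := g y - g' y - (g x - g' x)) (by
    rw [Complex.exp_sub, Complex.exp_sub, Complex.exp_sub, h y hyK, h x hx,
      div_self (Complex.exp_ne_zero _), div_self (Complex.exp_ne_zero _), div_one]) hy
  exact (sub_eq_zero.1 h0).symm

theorem zpow_eq_zero_of_hasLog_sphere {a : Plane} {r : ℝ} (hr : 0 < r) {n : ℤ}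
    (h : HasLog (sphere a r) (fun z => toC (z - a) ^ n)) : n = 0 := by
  obtain ⟨g, hg, he⟩ := h
  set c : ℝ → Plane := fun θ => a + toC.symm (Complex.exp (Real.log r + θ * Complex.I)) with hc
  have hcc : Continuous c := by
    have : Continuous fun θ : ℝ => Complex.exp (Real.log r + θ * Complex.I) := by fun_prop
    exact continuous_const.add (toC.symm.continuous.comp this)
  have hcs : ∀ θ, c θ ∈ sphere a r := fun θ => by
    simp [hc, Complex.norm_exp, Real.exp_log hr]
  have h1 := log_sub_eq_of_isPreconnected (K := univ) isPreconnected_univ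
    (g := fun θ => g (c θ)) (g' := fun θ : ℝ => n * (Real.log r + θ * Complex.I))
    (hg.comp hcc.continuousOn fun θ _ => hcs θ) (by fun_prop) (fun θ _ => by
      rw [he _ (hcs θ), Complex.exp_int_mul]; simp [hc]) (mem_univ 0) (mem_univ (2 * Real.pi))
  have h2 : c 0 = c (2 * Real.pi) := by
    simp [hc, Complex.exp_add]
  simp only [h2] at h1
  have h3 : (n : ℂ) * (2 * Real.pi * Complex.I) = 0 := by
    have := sub_right_inj.1 h1
    push_cast at this
    linear_combination -this
  simpa [Real.pi_ne_zero] using h3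

/-- `(z - a) / (z - b)`. -/
noncomputable def ratio (a b z : Plane) : ℂ := toC (z - a) / toC (z - b)

theorem ratio_mul_ratio {a b c z : Plane} (hb : z ≠ b) : ratio a b z * ratio b c z = ratio a c z := by
  have := toC_ne_zero hb
  unfold ratio
  field_simp

theorem ratio_ne_zero {a b z : Plane} (ha : z ≠ a) (hb : z ≠ b) : ratio a b z ≠ 0 :=
  div_ne_zero (toC_ne_zero ha) (toC_ne_zero hb)

theorem ratio_symm (a b z : Plane) : (ratio a b z)⁻¹ = ratio b a z := inv_div _ _

theorem continuousOn_ratio {a b : Plane} {K : Set Plane} (hb : b ∉ K) :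
    ContinuousOn (ratio a b) K :=
  (continuous_toC_sub a).continuousOn.div (continuous_toC_sub b).continuousOn
    fun _ hz => toC_ne_zero fun h => hb (h ▸ hz)

/-- For `a` much closer to `b` than to `z`, the ratio lies in the slit plane. -/
theorem ratio_mem_slitPlane {a b z : Plane} (h : dist a b < dist z b) :
    ratio a b z ∈ Complex.slitPlane := by
  have hz : z ≠ b := by
    rintro rfl
    simp only [dist_self] at h
    exact absurd h (not_lt.2 dist_nonneg)
  have h1 : ratio a b z = 1 + toC (b - a) / toC (z - b) := by
    have := toC_ne_zero hz
    have h2 : toC (z - a) = toC (z - b) + toC (b - a) := by rw [← map_add]; congr 1; abel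
    rw [ratio, h2, add_div, div_self this]
  rw [h1]
  refine Complex.mem_slitPlane_of_norm_lt_one ?_
  rw [norm_div, LinearIsometryEquiv.norm_map, LinearIsometryEquiv.norm_map, ← dist_eq_norm,
    ← dist_eq_norm, dist_comm b a, div_lt_one (dist_pos.2 hz)]
  exact h

theorem hasLog_ratio_of_dist_lt {K : Set Plane} {a b : Plane}
    (h : ∀ z ∈ K, dist a b < dist z b) : HasLog K (ratio a b) := by
  have hb : b ∉ K := fun hb => by simpa using (h b hb).trans_le' dist_nonneg
  refine ⟨fun z => Complex.log (ratio a b z), fun z hz => ?_, fun z hz => ?_⟩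
  · exact ((continuousOn_ratio hb) z hz).clog (ratio_mem_slitPlane (h z hz))
  · exact Complex.exp_log (Complex.slitPlane_ne_zero (ratio_mem_slitPlane (h z hz)))

/-- If `a` and `b` lie in the same component of the complement of `K`, then `(z - a) / (z - b)` has
a continuous logarithm on `K`. -/
theorem hasLog_ratio_of_isPreconnected {K s : Set Plane} (hK : IsClosed K) (hs : IsPreconnected s)
    (hsK : Disjoint s K) {a b : Plane} (ha : a ∈ s) (hb : b ∈ s) : HasLog K (ratio a b) := by
  have hne : ∀ x ∈ s, ∀ z ∈ K, z ≠ x := fun x hx z hz h =>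
    Set.disjoint_left.1 hsK hx (h ▸ hz)
  refine hs.induction₂ (fun a b => HasLog K (ratio a b)) (fun x hx => ?_)
    (fun x y z hx hy hz h h' => (h.mul h').congr fun w hw => ratio_mul_ratio (hne y hy w hw))
    (fun x y hx hy h => (h.zpow (-1)).congr fun w hw => by simp [ratio_symm]) ha hb
  have hx' : Kᶜ ∈ 𝓝 x := hK.isOpen_compl.mem_nhds (Set.disjoint_left.1 hsK hx)
  obtain ⟨r, hr, hrK⟩ := Metric.mem_nhds_iff.1 hx'
  filter_upwards [mem_nhdsWithin_of_mem_nhds (Metric.ball_mem_nhds x (half_pos hr))] with y hy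
  refine hasLog_ratio_of_dist_lt fun z hz => ?_
  have h1 : r ≤ dist z x := not_lt.1 fun h => hrK (Metric.mem_ball.2 h) hz
  rw [Metric.mem_ball, dist_comm] at hy
  have h2 := dist_triangle z y x
  rw [dist_comm y x] at h2
  linarith

end RandomCluster

namespace RandomCluster

open Set Topology Filter Metric

/-! ## Separation of the plane by compact sets -/

theorem eq_zero_of_hasLog_frontier {U : Set Plane} (hU : IsOpen U) (hb : Bornology.IsBounded U)
    {a : Plane} (ha : a ∈ U) {F : Plane → ℂ} (hF : ContinuousOn F (closure U))
    (hF0 : ∀ z ∈ closure U, F z ≠ 0) {n : ℤ}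
    (h : HasLog (frontier U) (fun z => toC (z - a) ^ n * F z)) : n = 0 := by
  classical
  obtain ⟨g, hg, he⟩ := h
  obtain ⟨G, hG⟩ := ContinuousMap.exists_restrict_eq (isClosed_frontier (s := U))
    (⟨_, hg.domRestrict⟩ : C(frontier U, ℂ))
  have hG' : ∀ z ∈ frontier U, G z = g z := fun z hz => by
    simpa using DFunLike.congr_fun hG ⟨z, hz⟩
  set H : Plane → ℂ := fun z =>
    if z ∈ closure U then Complex.exp (G z) / F z else toC (z - a) ^ n with hH
  have hne : ∀ z ∈ Uᶜ, toC (z - a) ≠ 0 := fun z hz => toC_ne_zero fun h => hz (h ▸ ha)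
  have hH1 : ∀ z ∈ closure U, H z = Complex.exp (G z) / F z := fun z hz => if_pos hz
  have hH2 : ∀ z ∈ Uᶜ, H z = toC (z - a) ^ n := fun z hz => by
    by_cases hzc : z ∈ closure U
    · have hzf : z ∈ frontier U := by rw [hU.frontier_eq]; exact ⟨hzc, hz⟩
      rw [hH1 z hzc, hG' z hzf, he z hzf, mul_div_assoc, div_self (hF0 z hzc), mul_one]
    · exact if_neg hzc
  have hHc : Continuous H := by
    rw [← continuousOn_univ, show (univ : Set Plane) = closure U ∪ Uᶜ from ?_]
    · refine ContinuousOn.union_of_isClosed ?_ ?_ isClosed_closure hU.isClosed_compl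
      · exact ((Complex.continuous_exp.comp G.continuous).continuousOn.div hF hF0).congr hH1
      · refine ContinuousOn.congr (fun z hz => ?_) hH2
        exact ((continuous_toC_sub a).continuousWithinAt).zpow₀ n (Or.inl (hne z hz))
    · exact (eq_univ_of_subset (union_subset_union_left _ subset_closure) (union_compl_self U)).symm
  have hH0 : ∀ z, H z ≠ 0 := fun z => by
    by_cases hz : z ∈ closure U
    · rw [hH1 z hz]; exact div_ne_zero (Complex.exp_ne_zero _) (hF0 z hz)
    · have hz' : z ∈ Uᶜ := fun h => hz (subset_closure h)
      rw [hH2 z hz']; exact zpow_ne_zero _ (hne z hz')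
  obtain ⟨L, hL, hLe⟩ := exists_continuous_log hHc hH0
  obtain ⟨r, hr, hUr⟩ := hb.subset_ball_lt 0 a
  refine zpow_eq_zero_of_hasLog_sphere hr (a := a) ⟨L, hL.continuousOn, fun z hz => ?_⟩
  rw [hLe, hH2]
  exact fun h => by
    have h1 := hUr h
    rw [mem_ball] at h1
    rw [mem_sphere] at hz
    exact absurd hz h1.ne

theorem isOpen_component {K : Set Plane} (hK : IsClosed K) (a : Plane) :
    IsOpen (connectedComponentIn Kᶜ a) := hK.isOpen_compl.connectedComponentIn

theorem mem_component_symm {K : Set Plane} {a b : Plane} (h : b ∈ connectedComponentIn K a) :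
    a ∈ connectedComponentIn K b := by
  rw [← connectedComponentIn_eq h]
  exact mem_connectedComponentIn (connectedComponentIn_nonempty_iff.1 ⟨b, h⟩)

theorem mem_component_trans {K : Set Plane} {a b c : Plane} (h : b ∈ connectedComponentIn K a)
    (h' : c ∈ connectedComponentIn K b) : c ∈ connectedComponentIn K a := by
  rwa [connectedComponentIn_eq h]

theorem mem_component_of_mem_closure {K : Set Plane} (hK : IsClosed K) {a z : Plane}
    (hz : z ∈ closure (connectedComponentIn Kᶜ a)) (hzK : z ∉ K) :
    z ∈ connectedComponentIn Kᶜ a := by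
  obtain ⟨w, hw, hw'⟩ := mem_closure_iff.1 hz _ (isOpen_component hK z)
    (mem_connectedComponentIn hzK)
  exact mem_component_trans hw' (mem_component_symm hw)

theorem frontier_component_subset {K : Set Plane} (hK : IsClosed K) (a : Plane) :
    frontier (connectedComponentIn Kᶜ a) ⊆ K := by
  intro z hz
  rw [(isOpen_component hK a).frontier_eq] at hz
  by_contra hzK
  exact hz.2 (mem_component_of_mem_closure hK hz.1 hzK)

theorem isPreconnected_norm_gt {r : ℝ} (hr : 0 < r) : IsPreconnected {z : Plane | r < ‖z‖} := by
  have h1 : IsPreconnected (Complex.exp '' {w : ℂ | Real.log r < w.re}) :=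
    (convex_halfSpace_re_gt (Real.log r)).isPreconnected.image _ Complex.continuous_exp.continuousOn
  have h2 : {z : Plane | r < ‖z‖} = toC.symm '' (Complex.exp '' {w : ℂ | Real.log r < w.re}) := by
    ext z
    constructor
    · intro hz
      have h0 : toC z ≠ 0 := by
        have : z ≠ 0 := by
          rintro rfl
          simp at hz
          linarith
        simpa using this
      refine ⟨toC z, ⟨Complex.log (toC z), ?_, Complex.exp_log h0⟩, by simp⟩
      simp only [mem_ofPred_eq, Complex.log_re, LinearIsometryEquiv.norm_map]
      exact Real.log_lt_log hr hz
    · rintro ⟨_, ⟨w, hw, rfl⟩, rfl⟩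
      simp only [mem_ofPred_eq, LinearIsometryEquiv.norm_map, Complex.norm_exp]
      exact (Real.log_lt_iff_lt_exp hr).1 hw
  rw [h2]
  exact h1.image _ toC.symm.continuous.continuousOn

theorem isBounded_component_or {K : Set Plane} (hK : IsCompact K) {a b : Plane}
    (hab : b ∉ connectedComponentIn Kᶜ a) :
    Bornology.IsBounded (connectedComponentIn Kᶜ a) ∨
      Bornology.IsBounded (connectedComponentIn Kᶜ b) := by
  by_contra! h
  obtain ⟨r, hr, hKr⟩ := hK.isBounded.subset_closedBall_lt 0 0
  have h0 : {z : Plane | r < ‖z‖} ⊆ Kᶜ := fun z hz hzK => by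
    have := hKr hzK
    rw [mem_closedBall_zero_iff] at this
    exact absurd hz (not_lt.2 this)
  have key : ∀ c, ¬ Bornology.IsBounded (connectedComponentIn Kᶜ c) →
      ∃ z ∈ connectedComponentIn Kᶜ c, r < ‖z‖ := fun c hc => by
    by_contra! h'
    exact hc (isBounded_closedBall.subset fun z hz => mem_closedBall_zero_iff.2 (h' z hz))
  obtain ⟨x, hx, hxr⟩ := key a h.1
  obtain ⟨y, hy, hyr⟩ := key b h.2
  have := (isPreconnected_norm_gt hr).subset_connectedComponentIn (x := x) hxr h0 hyr
  exact hab (mem_component_trans (mem_component_trans hx this) (mem_component_symm hy))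

theorem ne_of_mem_closure_component {K : Set Plane} (hK : IsClosed K) {a b z : Plane} (hb : b ∉ K)
    (hab : b ∉ connectedComponentIn Kᶜ a) (hz : z ∈ closure (connectedComponentIn Kᶜ a)) :
    z ≠ b := by
  rintro rfl
  exact hab (mem_component_of_mem_closure hK hz hb)

/-- If `(z - a) / (z - b)` has a continuous logarithm on the compact set `K`, then `K` does not
separate `a` and `b`. -/
theorem mem_component_of_hasLog {K : Set Plane} (hK : IsCompact K) {a b : Plane} (ha : a ∉ K)
    (hb : b ∉ K) (h : HasLog K (ratio a b)) : b ∈ connectedComponentIn Kᶜ a := by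
  have key : ∀ {a b : Plane}, a ∉ K → b ∉ K → HasLog K (ratio a b) →
      Bornology.IsBounded (connectedComponentIn Kᶜ a) → b ∈ connectedComponentIn Kᶜ a := by
    intro a b ha hb h hbd
    by_contra hab
    have hne := fun z => ne_of_mem_closure_component hK.isClosed (z := z) hb hab
    have := eq_zero_of_hasLog_frontier (isOpen_component hK.isClosed a) hbd
      (mem_connectedComponentIn ha) (F := fun z => (toC (z - b))⁻¹) (n := 1)
      ((continuous_toC_sub b).continuousOn.inv₀ fun z hz => toC_ne_zero (hne z hz))
      (fun z hz => inv_ne_zero (toC_ne_zero (hne z hz)))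
      ((h.mono (frontier_component_subset hK.isClosed a)).congr fun z _ => by
        rw [zpow_one, ratio, div_eq_mul_inv])
    exact one_ne_zero this
  by_contra hab
  rcases isBounded_component_or hK hab with h' | h'
  · exact hab (key ha hb h h')
  · exact hab (mem_component_symm (key hb ha
      ((h.zpow (-1)).congr fun z _ => by simp [ratio_symm]) h'))

theorem eq_zero_or_eq_zero_of_hasLog {K : Set Plane} (hK : IsCompact K) {a b c : Plane}
    (ha : a ∉ K) (hb : b ∉ K) (hc : c ∉ K) (hab : b ∉ connectedComponentIn Kᶜ a)
    (hac : c ∉ connectedComponentIn Kᶜ a) (hcb : b ∉ connectedComponentIn Kᶜ c) {n k : ℤ}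
    (h : HasLog K (fun z => ratio a b z ^ n * ratio c b z ^ k)) : n = 0 ∨ k = 0 := by
  have key : ∀ {a c : Plane} {n k : ℤ}, a ∉ K → c ∉ K → b ∉ connectedComponentIn Kᶜ a →
      c ∉ connectedComponentIn Kᶜ a → HasLog K (fun z => ratio a b z ^ n * ratio c b z ^ k) →
      Bornology.IsBounded (connectedComponentIn Kᶜ a) → n = 0 := by
    intro a c n k ha hc hab hac h hbd
    have hne := fun z => ne_of_mem_closure_component hK.isClosed (z := z) hb hab
    have hne' := fun z => ne_of_mem_closure_component hK.isClosed (z := z) hc hac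
    refine eq_zero_of_hasLog_frontier (isOpen_component hK.isClosed a) hbd
      (mem_connectedComponentIn ha) (F := fun z => toC (z - b) ^ (-n) * ratio c b z ^ k) ?_ ?_
      ((h.mono (frontier_component_subset hK.isClosed a)).congr fun z _ => ?_)
    · refine ContinuousOn.mul ?_ ?_
      · exact (continuous_toC_sub b).continuousOn.zpow₀ _ fun z hz =>
          Or.inl (toC_ne_zero (hne z hz))
      · exact (continuousOn_ratio fun h => hne b h rfl).zpow₀ _ fun z hz =>
          Or.inl (ratio_ne_zero (hne' z hz) (hne z hz))
    · exact fun z hz => mul_ne_zero (zpow_ne_zero _ (toC_ne_zero (hne z hz)))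
        (zpow_ne_zero _ (ratio_ne_zero (hne' z hz) (hne z hz)))
    · rw [ratio, div_zpow, zpow_neg, div_eq_mul_inv, mul_assoc]
  rcases isBounded_component_or hK hac with h' | h'
  · exact Or.inl (key ha hc hab hac h h')
  · exact Or.inr (key hc ha hcb (fun h => hac (mem_component_symm h))
      (h.congr fun z _ => mul_comm _ _) h')

theorem hasLog_const (K : Set Plane) {c : ℂ} (hc : c ≠ 0) : HasLog K fun _ => c :=
  ⟨fun _ => Complex.log c, continuousOn_const, fun _ _ => Complex.exp_log hc⟩

theorem not_hasLog_compl_pair {u v : Plane} (huv : u ≠ v) {c : ℂ} (hc : c ≠ 0) :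
    ¬ HasLog ({u, v}ᶜ) (fun z => c * ratio u v z) := by
  intro h
  have hd : 0 < dist v u := dist_pos.2 huv.symm
  set S := sphere u (dist v u / 2)
  have hSu : ∀ z ∈ S, z ≠ u := by
    rintro z hz rfl
    rw [mem_sphere, dist_self] at hz
    linarith
  have hSv : ∀ z ∈ S, z ≠ v := by
    rintro z hz rfl
    rw [mem_sphere] at hz
    linarith
  have h1 : HasLog S (fun z => toC (v - z)) := by
    have : HasLog S (fun z => ratio z u v) := by
      have hs : ∀ z ∈ S, ratio z u v ∈ Complex.slitPlane := fun z hz => by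
        refine ratio_mem_slitPlane ?_
        rw [mem_sphere] at hz
        linarith
      refine ⟨fun z => Complex.log (ratio z u v), ContinuousOn.clog ?_ hs,
        fun z hz => Complex.exp_log (Complex.slitPlane_ne_zero (hs z hz))⟩
      have : Continuous fun z => ratio z u v := by unfold ratio; fun_prop
      exact this.continuousOn
    have hvu := toC_ne_zero huv.symm
    exact (this.mul (hasLog_const S hvu)).congr fun z _ => by rw [ratio]; field_simp
  have h2 : HasLog S (fun z => toC (z - u) ^ (1 : ℤ)) := by
    refine (((h.mono ?_).mul (hasLog_const S (inv_ne_zero hc))).mul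
      (h1.mul (hasLog_const S (neg_ne_zero.2 one_ne_zero)))).congr fun z hz => ?_
    · intro z hz
      simp [hSu z hz, hSv z hz]
    · have h3 := toC_ne_zero (hSv z hz)
      have h4 : toC (v - z) = - toC (z - v) := by rw [← map_neg, neg_sub]
      rw [h4, ratio]
      field_simp
  exact one_ne_zero (zpow_eq_zero_of_hasLog_sphere (half_pos hd) h2)

/-- On a preconnected closed set `K` the increment of a logarithm of `(z - a) / (z - b)` between two
points of `K` depends continuously on `a`. -/
theorem exists_continuousOn_log_increment {K O : Set Plane} (hK : IsClosed K)
    (hKc : IsPreconnected K) {u v b : Plane} (hu : u ∈ K) (hv : v ∈ K) (hO : Disjoint O K)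
    (h : ∀ a ∈ O, HasLog K (ratio a b)) :
    ∃ Φ : Plane → ℂ, ContinuousOn Φ O ∧ ∀ a ∈ O, ∀ g : Plane → ℂ, ContinuousOn g K →
      (∀ z ∈ K, Complex.exp (g z) = ratio a b z) → Φ a = g v - g u := by
  classical
  choose! G hG hGe using h
  have key : ∀ a ∈ O, ∀ g : Plane → ℂ, ContinuousOn g K →
      (∀ z ∈ K, Complex.exp (g z) = ratio a b z) → G a v - G a u = g v - g u := by
    intro a ha g hg hge
    have := log_sub_eq_of_isPreconnected hKc (hG a ha) hg
      (fun z hz => by rw [hGe a ha z hz, hge z hz]) hu hv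
    linear_combination -this
  refine ⟨fun a => G a v - G a u, fun a ha => ?_, key⟩
  have haK : a ∉ K := Set.disjoint_left.1 hO ha
  obtain ⟨r, hr, hrK⟩ := Metric.mem_nhds_iff.1 (hK.isOpen_compl.mem_nhds haK)
  have hrK' : ∀ z ∈ K, r ≤ dist z a := fun z hz => not_lt.1 fun h => hrK (mem_ball.2 h) hz
  have hlog : ∀ z ∈ K, Tendsto (fun a' => Complex.log (ratio a' a z)) (𝓝 a) (𝓝 0) := by
    intro z hz
    have hza : z ≠ a := fun h => haK (h ▸ hz)
    have h1 : ratio a a z = 1 := div_self (toC_ne_zero hza)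
    have h2 : ContinuousAt (fun a' => ratio a' a z) a := by
      have : Continuous fun a' => ratio a' a z := by unfold ratio; fun_prop
      exact this.continuousAt
    have h3 := h2.clog (by rw [h1]; exact Complex.one_mem_slitPlane)
    simpa [ContinuousAt, h1] using h3
  have h1 : Tendsto (fun a' => G a v - G a u +
      (Complex.log (ratio a' a v) - Complex.log (ratio a' a u))) (𝓝[O] a)
      (𝓝 (G a v - G a u)) := by
    have := ((hlog v hv).sub (hlog u hu)).const_add (G a v - G a u)
    simp only [sub_zero, add_zero] at this
    exact this.mono_left nhdsWithin_le_nhds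
  refine h1.congr' ?_
  filter_upwards [self_mem_nhdsWithin, mem_nhdsWithin_of_mem_nhds (ball_mem_nhds a hr)]
    with a' ha' har
  have hd : ∀ z ∈ K, dist a' a < dist z a := fun z hz => (mem_ball.1 har).trans_le (hrK' z hz)
  rw [key a' ha' (fun z => G a z + Complex.log (ratio a' a z))]
  · ring
  · exact (hG a ha).add ((continuousOn_ratio haK).clog fun z hz => ratio_mem_slitPlane (hd z hz))
  · intro z hz
    rw [Complex.exp_add, hGe a ha z hz,
      Complex.exp_log (Complex.slitPlane_ne_zero (ratio_mem_slitPlane (hd z hz))), mul_comm,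
      ratio_mul_ratio fun h : z = a => haK (h ▸ hz)]

end RandomCluster

namespace RandomCluster

open Set Topology Filter Metric unitInterval

/-! ## Simple curves -/

/-- A curve which is injective except that its two endpoints may coincide. -/
def IsSimpleCurve (c : C(I, Plane)) : Prop :=
  ∀ s t : I, s ≠ t → c s = c t → (s = 0 ∨ s = 1) ∧ (t = 0 ∨ t = 1)

theorem IsSimpleCurve.eq_of_mem_Ioo {c : C(I, Plane)} (hc : IsSimpleCurve c) {s t : I}
    (hs : s ∈ Ioo (0 : I) 1) (h : c t = c s) : t = s := by
  by_contra hne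
  rcases (hc t s hne h).2 with h' | h'
  · exact hs.1.ne' h'
  · exact hs.2.ne h'

theorem continuousOn_range_of_comp {X : Type*} [TopologicalSpace X] [CompactSpace X]
    {κ : X → Plane} (hκ : Continuous κ) {k : Plane → ℂ} (hk : Continuous fun x => k (κ x)) :
    ContinuousOn k (range κ) := by
  rw [continuousOn_iff_continuous_domRestrict]
  have hc : Continuous (rangeFactorization κ) := hκ.subtype_mk _
  have hq : IsQuotientMap (rangeFactorization κ) :=
    hc.isClosedMap.isQuotientMap hc rangeFactorization_surjective
  exact hq.continuous_iff.2 hk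

/-- Gluing a logarithm on a closed set with a logarithm along a curve attached to it. -/
theorem hasLog_union_range {S : Set Plane} (hS : IsClosed S) {c : C(I, Plane)}
    (hc : IsSimpleCurve c) (h0 : c 0 ∈ S) (h1 : c 1 ∈ S) (hint : Disjoint (c '' Ioo 0 1) S)
    {f g : Plane → ℂ} (hg : ContinuousOn g S) (hge : ∀ z ∈ S, Complex.exp (g z) = f z)
    {h : I → ℂ} (hh : Continuous h) (hhe : ∀ t, Complex.exp (h t) = f (c t))
    (hinc : h 1 - h 0 = g (c 1) - g (c 0)) : HasLog (S ∪ range c) f := by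
  classical
  set k : Plane → ℂ := fun z => if z ∈ S then g z else
    if hz : ∃ t, c t = z then h hz.choose + (g (c 0) - h 0) else 0 with hk
  have hkS : ∀ z ∈ S, k z = g z := fun z hz => if_pos hz
  have hkc : ∀ t, k (c t) = h t + (g (c 0) - h 0) := fun t => by
    rcases eq_or_ne t 0 with rfl | ht0
    · rw [hkS _ h0]; ring
    rcases eq_or_ne t 1 with rfl | ht1
    · rw [hkS _ h1]; linear_combination -hinc
    have ht : t ∈ Ioo (0 : I) 1 := ⟨unitInterval.pos_iff_ne_zero.2 ht0,
      unitInterval.lt_one_iff_ne_one.2 ht1⟩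
    have hz : ∃ t', c t' = c t := ⟨t, rfl⟩
    simp only [hk, if_neg (Set.disjoint_left.1 hint (mem_image_of_mem c ht)), dif_pos hz]
    rw [hc.eq_of_mem_Ioo ht hz.choose_spec]
  refine ⟨k, ContinuousOn.union_of_isClosed (hg.congr hkS) ?_ hS
    (isCompact_range c.continuous).isClosed, ?_⟩
  · exact continuousOn_range_of_comp c.continuous (by simp only [hkc]; fun_prop)
  · rintro z (hz | ⟨t, rfl⟩)
    · rw [hkS z hz, hge z hz]
    · rw [hkc, Complex.exp_add, Complex.exp_sub, hhe, hge _ h0, hhe 0, div_self, mul_one]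
      rw [← hhe 0]
      exact Complex.exp_ne_zero _

theorem exists_continuous_log_unitInterval {f : I → ℂ} (hf : Continuous f) (h0 : ∀ t, f t ≠ 0) :
    ∃ h : I → ℂ, Continuous h ∧ ∀ t, Complex.exp (h t) = f t := by
  obtain ⟨h, hh, hhe⟩ := exists_continuous_log
    (hf.comp (continuous_projIcc (a := (0 : ℝ)) (b := 1) (h := zero_le_one))) fun t => h0 _
  exact ⟨fun t => h t, hh.comp continuous_subtype_val, fun t => by
    rw [hhe, Function.comp_apply, projIcc_val]⟩

theorem hasLog_arc {c : C(I, Plane)} (hc : IsSimpleCurve c) {s t : I} (hs : 0 < s) (hst : s ≤ t)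
    (ht : t < 1) {f : Plane → ℂ} (hf : ContinuousOn f (c '' Icc s t))
    (hf0 : ∀ z ∈ c '' Icc s t, f z ≠ 0) : HasLog (c '' Icc s t) f := by
  classical
  set r : I → I := fun τ => max s (min t τ) with hr
  have hrc : Continuous r := by fun_prop
  have hrm : ∀ τ, r τ ∈ Icc s t := fun τ => ⟨le_max_left _ _, max_le hst (min_le_left _ _)⟩
  have hri : ∀ τ ∈ Icc s t, r τ = τ := fun τ hτ => by
    simp only [hr, min_eq_right hτ.2, max_eq_right hτ.1]
  have hm : ∀ τ, c (r τ) ∈ c '' Icc s t := fun τ => mem_image_of_mem c (hrm τ)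
  obtain ⟨h, hh, hhe⟩ := exists_continuous_log_unitInterval (f := fun τ => f (c (r τ)))
    (hf.comp_continuous (c.continuous.comp hrc) hm) fun τ => hf0 _ (hm τ)
  set k : Plane → ℂ := fun z => if hz : ∃ τ ∈ Icc s t, c τ = z then h hz.choose else 0 with hk
  have hkc : ∀ τ ∈ Icc s t, k (c τ) = h τ := fun τ hτ => by
    have hz : ∃ τ' ∈ Icc s t, c τ' = c τ := ⟨τ, hτ, rfl⟩
    simp only [hk, dif_pos hz]
    rw [hc.eq_of_mem_Ioo ⟨hs.trans_le hτ.1, hτ.2.trans_lt ht⟩ hz.choose_spec.2]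
  have himg : c '' Icc s t = range fun τ => c (r τ) := by
    ext z
    constructor
    · rintro ⟨τ, hτ, rfl⟩
      exact ⟨τ, by simp only [hri τ hτ]⟩
    · rintro ⟨τ, rfl⟩
      exact hm τ
  refine ⟨k, ?_, ?_⟩
  · rw [himg]
    refine continuousOn_range_of_comp (c.continuous.comp hrc) ?_
    exact (hh.comp hrc).congr fun τ => (hkc (r τ) (hrm τ)).symm
  · rintro z ⟨τ, hτ, rfl⟩
    rw [hkc τ hτ, hhe, hri τ hτ]

theorem one_lt_rank_plane : 1 < Module.rank ℝ Plane := by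
  rw [← Module.finrank_eq_rank, finrank_euclideanSpace_fin]
  norm_num

/-- The interior of a simple curve contains no nonempty open set. -/
theorem eq_empty_of_isOpen_of_subset_curve {c : C(I, Plane)} (hc : IsSimpleCurve c) {U : Set Plane}
    (hU : IsOpen U) (hUc : U ⊆ c '' Ioo 0 1) : U = ∅ := by
  by_contra hne
  obtain ⟨x, hx⟩ := nonempty_iff_ne_empty.2 hne
  obtain ⟨τ, hτ, rfl⟩ := hUc hx
  have hnh : (c ⁻¹' U) ∩ Ioo 0 1 ∈ 𝓝 τ :=
    inter_mem ((hU.preimage c.continuous).mem_nhds hx) (Ioo_mem_nhds hτ.1 hτ.2)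
  obtain ⟨a, b, hab, hab'⟩ := (mem_nhds_iff_exists_Ioo_subset' ⟨0, hτ.1⟩ ⟨1, hτ.2⟩).1 hnh
  obtain ⟨s, has, hsτ⟩ := exists_between hab.1
  obtain ⟨t, hτt, htb⟩ := exists_between hab.2
  have hIcc : Icc s t ⊆ c ⁻¹' U ∩ Ioo 0 1 := fun r hr =>
    hab' ⟨has.trans_le hr.1, hr.2.trans_lt htb⟩
  have hst : s < t := hsτ.trans hτt
  have hs := (hIcc (left_mem_Icc.2 hst.le)).2
  have ht := (hIcc (right_mem_Icc.2 hst.le)).2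
  have hV : c '' Ioo s t = U ∩ (c '' (Icc 0 s ∪ Icc t 1))ᶜ := by
    ext z
    constructor
    · rintro ⟨r, hr, rfl⟩
      have hr' := hIcc (Ioo_subset_Icc_self hr)
      refine ⟨hr'.1, ?_⟩
      rintro ⟨r', hr1, hr2⟩
      rw [hc.eq_of_mem_Ioo hr'.2 hr2] at hr1
      rcases hr1 with h | h
      · exact absurd hr.1 (not_lt.2 h.2)
      · exact absurd hr.2 (not_lt.2 h.1)
    · rintro ⟨hzU, hz⟩
      obtain ⟨r, hr, rfl⟩ := hUc hzU
      refine ⟨r, ⟨?_, ?_⟩, rfl⟩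
      · by_contra h
        exact hz ⟨r, Or.inl ⟨hr.1.le, not_lt.1 h⟩, rfl⟩
      · by_contra h
        exact hz ⟨r, Or.inr ⟨not_lt.1 h, hr.2.le⟩, rfl⟩
  have hVo : IsOpen (c '' Ioo s t) := by
    rw [hV]
    exact hU.inter ((isCompact_Icc.union isCompact_Icc).image c.continuous).isClosed.isOpen_compl
  have hK : IsClosed (c '' Icc s t) := (isCompact_Icc.image c.continuous).isClosed
  have hconn := (Set.Countable.isConnected_compl_of_one_lt_rank one_lt_rank_plane
    (Set.toFinite {c s, c t}).countable).isPreconnected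
  have h0 : ∀ r ∈ Ioo (0 : I) 1, c 0 ≠ c r := fun r hr h => hr.1.ne (hc.eq_of_mem_Ioo hr h)
  have hτm : c τ ∈ ({c s, c t}ᶜ : Set Plane) := by
    simp only [mem_compl_iff, mem_insert_iff, mem_singleton_iff, not_or]
    exact ⟨fun h => hsτ.ne' (hc.eq_of_mem_Ioo hs h), fun h => hτt.ne (hc.eq_of_mem_Ioo ht h)⟩
  have h0m : c 0 ∈ ({c s, c t}ᶜ : Set Plane) := by
    simp only [mem_compl_iff, mem_insert_iff, mem_singleton_iff, not_or]
    exact ⟨h0 s hs, h0 t ht⟩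
  have h0K : c 0 ∉ c '' Icc s t := by
    rintro ⟨r, hr, hr'⟩
    exact h0 r (hIcc hr).2 hr'.symm
  have hcover : ({c s, c t}ᶜ : Set Plane) ⊆ c '' Ioo s t ∪ (c '' Icc s t)ᶜ := by
    intro z hz
    by_cases h : z ∈ c '' Icc s t
    · left
      obtain ⟨r, hr, rfl⟩ := h
      refine ⟨r, ⟨lt_of_le_of_ne hr.1 ?_, lt_of_le_of_ne hr.2 ?_⟩, rfl⟩
      · rintro rfl; simp at hz
      · rintro rfl; simp at hz
    · exact Or.inr h
  obtain ⟨z, -, hz1, hz2⟩ := hconn _ _ hVo hK.isOpen_compl hcover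
    ⟨c τ, hτm, τ, ⟨hsτ, hτt⟩, rfl⟩ ⟨c 0, h0m, h0K⟩
  exact hz2 (image_mono Ioo_subset_Icc_self hz1)

/-- If a simple curve closes up a connected closed set, then points on different sides of the curve
are separated: not all points near the curve lie in one component of the complement. -/
theorem exists_separated_of_isPreconnected {c : C(I, Plane)} (hc : IsSimpleCurve c)
    {S T₀ W : Set Plane} (hS : IsClosed S) (hT₀S : T₀ ⊆ S) (hT₀ : IsClosed T₀)
    (hT₀c : IsPreconnected T₀) (h0 : c 0 ∈ T₀) (h1 : c 1 ∈ T₀)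
    (hW : IsOpen W) (hcW : c '' Ioo 0 1 ⊆ W) (hWS : Disjoint W S) :
    ∃ y ∈ W \ c '' Ioo 0 1, ∃ y' ∈ W \ c '' Ioo 0 1,
      y' ∉ connectedComponentIn (S ∪ range c)ᶜ y := by
  classical
  by_contra! hcon
  obtain ⟨s, hs0, hs1⟩ := exists_between (zero_lt_one (α := I))
  obtain ⟨t, hst, ht1⟩ := exists_between hs1
  have hIoo : Icc s t ⊆ Ioo 0 1 := fun r hr => ⟨hs0.trans_le hr.1, hr.2.trans_lt ht1⟩
  set A := c '' Icc s t with hA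
  set T := T₀ ∪ (c '' Icc 0 s ∪ c '' Icc t 1) with hT
  have hAcl : IsClosed A := (isCompact_Icc.image c.continuous).isClosed
  have hTcl : IsClosed T := hT₀.union ((isCompact_Icc.image c.continuous).isClosed.union
    (isCompact_Icc.image c.continuous).isClosed)
  have hTc : IsPreconnected T := by
    rw [hT, ← union_assoc]
    refine IsPreconnected.union (c 1) (Or.inl h1) ⟨1, ⟨ht1.le, le_rfl⟩, rfl⟩
      (IsPreconnected.union (c 0) h0 ⟨0, ⟨le_rfl, hs0.le⟩, rfl⟩ hT₀c ?_) ?_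
    · exact isPreconnected_Icc.image c c.continuous.continuousOn
    · exact isPreconnected_Icc.image c c.continuous.continuousOn
  set K := S ∪ range c with hK
  have hTK : T ⊆ K := by
    rintro z (hz | ⟨r, -, rfl⟩ | ⟨r, -, rfl⟩)
    · exact Or.inl (hT₀S hz)
    · exact Or.inr ⟨r, rfl⟩
    · exact Or.inr ⟨r, rfl⟩
  have hAK : A ⊆ K := by
    rintro z ⟨r, -, rfl⟩
    exact Or.inr ⟨r, rfl⟩
  have hKcl : IsClosed K := hS.union (isCompact_range c.continuous).isClosed
  have hend : ∀ r : I, c r ∈ W → r ∈ Ioo 0 1 := fun r hr => by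
    refine ⟨unitInterval.pos_iff_ne_zero.2 ?_, unitInterval.lt_one_iff_ne_one.2 ?_⟩
    · rintro rfl; exact Set.disjoint_left.1 hWS hr (hT₀S h0)
    · rintro rfl; exact Set.disjoint_left.1 hWS hr (hT₀S h1)
  have hYK : ∀ y ∈ W \ c '' Ioo 0 1, y ∉ K := by
    rintro y ⟨hyW, hy⟩ (hyS | ⟨r, rfl⟩)
    · exact Set.disjoint_left.1 hWS hyW hyS
    · exact hy ⟨r, hend r hyW, rfl⟩
  have hdense : ∀ U : Set Plane, IsOpen U → U.Nonempty → ∃ y ∈ U, y ∉ c '' Ioo 0 1 := by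
    intro U hU hne
    by_contra! h
    exact hne.ne_empty (eq_empty_of_isOpen_of_subset_curve hc hU h)
  obtain ⟨y₀, hy₀⟩ : (W \ c '' Ioo 0 1).Nonempty := by
    obtain ⟨y, hy, hy'⟩ := hdense W hW ⟨c s, hcW ⟨s, ⟨hs0, hs1⟩, rfl⟩⟩
    exact ⟨y, hy, hy'⟩
  have hy₀K := hYK y₀ hy₀
  have hlogY : ∀ a ∈ W \ c '' Ioo 0 1, HasLog K (ratio a y₀) := fun a ha =>
    hasLog_ratio_of_isPreconnected hKcl isPreconnected_connectedComponentIn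
      (Set.disjoint_left.2 fun z hz => connectedComponentIn_subset _ _ hz)
      (mem_connectedComponentIn (hYK a ha)) (hcon a ha y₀ hy₀)
  have hlogA : ∀ a ∈ Aᶜ, HasLog A (ratio a y₀) := fun a ha =>
    hasLog_arc hc hs0 hst.le ht1 (continuousOn_ratio fun h => hy₀K (hAK h)) fun z hz =>
      ratio_ne_zero (fun h => ha (h ▸ hz)) fun h => hy₀K (hAK (h ▸ hz))
  have hlogT : ∀ a ∈ W \ T, HasLog T (ratio a y₀) := by
    intro a ha
    obtain ⟨r, hr, hrW⟩ := Metric.mem_nhds_iff.1 ((hW.sdiff hTcl).mem_nhds ha)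
    obtain ⟨y, hy, hyc⟩ := hdense (ball a r) isOpen_ball ⟨a, mem_ball_self hr⟩
    have h1 : HasLog T (ratio a y) := hasLog_ratio_of_isPreconnected hTcl isPreconnected_ball
      (Set.disjoint_left.2 fun z hz => (hrW hz).2) (mem_ball_self hr) hy
    exact (h1.mul ((hlogY y ⟨(hrW hy).1, hyc⟩).mono hTK)).congr fun z hz =>
      ratio_mul_ratio fun h => (hrW hy).2 (h ▸ hz)
  have hsA : c s ∈ A := ⟨s, left_mem_Icc.2 hst.le, rfl⟩
  have htA : c t ∈ A := ⟨t, right_mem_Icc.2 hst.le, rfl⟩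
  have hsT : c s ∈ T := Or.inr (Or.inl ⟨s, ⟨hs0.le, le_rfl⟩, rfl⟩)
  have htT : c t ∈ T := Or.inr (Or.inr ⟨t, ⟨le_rfl, ht1.le⟩, rfl⟩)
  obtain ⟨Φ, hΦ, hΦg⟩ := exists_continuousOn_log_increment hAcl
    (isPreconnected_Icc.image c c.continuous.continuousOn) hsA htA disjoint_compl_left hlogA
  obtain ⟨Ψ, hΨ, hΨg⟩ := exists_continuousOn_log_increment hTcl hTc hsT htT
    disjoint_sdiff_left hlogT
  have hagree : ∀ a ∈ W \ T, a ∉ A → Φ a = Ψ a := by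
    intro a ha haA
    have haY : a ∈ W \ c '' Ioo 0 1 := by
      refine ⟨ha.1, ?_⟩
      rintro ⟨r, hr, rfl⟩
      by_cases hrs : r < s
      · exact ha.2 (Or.inr (Or.inl ⟨r, ⟨hr.1.le, hrs.le⟩, rfl⟩))
      by_cases hrt : t < r
      · exact ha.2 (Or.inr (Or.inr ⟨r, ⟨hrt.le, hr.2.le⟩, rfl⟩))
      · exact haA ⟨r, ⟨not_lt.1 hrs, not_lt.1 hrt⟩, rfl⟩
    obtain ⟨g, hg, hge⟩ := hlogY a haY
    rw [hΦg a haA g (hg.mono hAK) fun z hz => hge z (hAK hz),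
      hΨg a ha g (hg.mono hTK) fun z hz => hge z (hTK hz)]
  set F : Plane → ℂ := fun a => if a ∈ A then Ψ a else Φ a with hF
  have hF1 : ∀ a ∈ Aᶜ, F a = Φ a := fun a ha => if_neg ha
  have hF2 : ∀ a ∈ W \ T, F a = Ψ a := fun a ha => by
    by_cases h : a ∈ A
    · exact if_pos h
    · rw [hF1 a h, hagree a ha h]
  have hcover : ({c t, c s}ᶜ : Set Plane) ⊆ Aᶜ ∪ W \ T := by
    intro z hz
    by_cases h : z ∈ A
    · right
      obtain ⟨r, hr, rfl⟩ := h
      have hrW := hcW (mem_image_of_mem c (hIoo hr))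
      refine ⟨hrW, ?_⟩
      simp only [mem_compl_iff, mem_insert_iff, mem_singleton_iff, not_or] at hz
      rintro (h | ⟨r', hr', h⟩ | ⟨r', hr', h⟩)
      · exact Set.disjoint_left.1 hWS hrW (hT₀S h)
      · have := hc.eq_of_mem_Ioo (hIoo hr) h
        subst this
        exact hz.2 (congrArg c (le_antisymm hr'.2 hr.1))
      · have := hc.eq_of_mem_Ioo (hIoo hr) h
        subst this
        exact hz.1 (congrArg c (le_antisymm hr.2 hr'.1))
    · exact Or.inl h
  have hts : c t ≠ c s := fun h => hst.ne' (hc.eq_of_mem_Ioo ⟨hs0, hs1⟩ h)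
  have hd1 : toC (c s - y₀) ≠ 0 := toC_ne_zero fun h => hy₀K (h ▸ hAK hsA)
  have hd2 : toC (c t - y₀) ≠ 0 := toC_ne_zero fun h => hy₀K (h ▸ hAK htA)
  refine not_hasLog_compl_pair hts (c := toC (c s - y₀) / toC (c t - y₀)) (div_ne_zero hd1 hd2)
    ⟨F, ContinuousOn.mono ?_ hcover, fun a ha => ?_⟩
  · exact ContinuousOn.union_of_isOpen (hΦ.congr hF1) (hΨ.congr hF2) hAcl.isOpen_compl
      (hW.sdiff hTcl)
  · simp only [mem_compl_iff, mem_insert_iff, mem_singleton_iff, not_or] at ha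
    have hgoal : ratio a y₀ (c t) / ratio a y₀ (c s) =
        toC (c s - y₀) / toC (c t - y₀) * ratio (c t) (c s) a := by
      have h3 := toC_ne_zero ha.2
      have h4 : toC (c s - a) = - toC (a - c s) := by rw [← map_neg, neg_sub]
      have h5 : toC (c t - a) = - toC (a - c t) := by rw [← map_neg, neg_sub]
      rw [ratio, ratio, ratio, h4, h5]
      field_simp
    change Complex.exp (F a) = _ * ratio (c t) (c s) a
    rw [← hgoal]
    by_cases h : a ∈ A
    · have haT : a ∈ W \ T := (hcover (by simp [ha])).resolve_left fun h' => h' h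
      obtain ⟨g, hg, hge⟩ := hlogT a haT
      rw [hF2 a haT, hΨg a haT g hg hge, Complex.exp_sub, hge _ hsT, hge _ htT]
    · obtain ⟨g, hg, hge⟩ := hlogA a h
      rw [hF1 a h, hΦg a h g hg hge, Complex.exp_sub, hge _ hsA, hge _ htA]

end RandomCluster

namespace RandomCluster

open Set Topology Filter Metric unitInterval

/-! ## Plane representations -/

theorem IsConnectedGraph.exists_inc {α β : Type*} {G : Graph α β} (hG : IsConnectedGraph G)
    (e : E(G)) (v : V(G)) : ∃ f : E(G), G.Inc f v := by
  obtain ⟨x, y, hxy⟩ := G.exists_isLink_of_mem_edgeSet e.2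
  rcases Relation.ReflTransGen.cases_tail (hG.2 ⟨x, hxy.left_mem⟩ v) with h | ⟨w, -, f, -, hf⟩
  · exact ⟨e, y, h ▸ hxy⟩
  · exact ⟨f, w, hf.symm⟩

namespace PlaneRep

variable {α β : Type*} {G : Graph α β} (R : PlaneRep G)

/-- The interior of the curve of an edge. -/
def edgeInterior (e : E(G)) : Set Plane := R.curve e '' Ioo 0 1

/-- The drawing of the spanning subgraph `(V, A)`. -/
def partialSkeleton (A : Set E(G)) : Set Plane :=
  R.point '' V(G) ∪ ⋃ e ∈ A, range (R.curve e)

theorem isSimpleCurve (e : E(G)) : IsSimpleCurve (R.curve e) := R.simple e e.2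

theorem exists_ends (e : E(G)) : ∃ u v : V(G), G.IsLink e u v ∧
    R.curve e 0 = R.point u ∧ R.curve e 1 = R.point v := by
  obtain ⟨⟨u, hu, hu'⟩, v, hv, hv'⟩ := R.ends_mem e e.2
  refine ⟨⟨u, hu⟩, ⟨v, hv⟩, (R.ends_iff e e.2 u hu v hv).1 ?_, hu'.symm, hv'.symm⟩
  rw [hu', hv']

theorem mem_range_curve {e : E(G)} {z : Plane} (hz : z ∈ range (R.curve e)) :
    z ∈ R.edgeInterior e ∨ ∃ w : V(G), G.Inc e w ∧ z = R.point w := by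
  obtain ⟨t, rfl⟩ := hz
  obtain ⟨u, v, huv, hu, hv⟩ := R.exists_ends e
  by_cases h0 : t = 0
  · exact Or.inr ⟨u, huv.inc_left, h0 ▸ hu⟩
  by_cases h1 : t = 1
  · exact Or.inr ⟨v, huv.inc_right, h1 ▸ hv⟩
  exact Or.inl ⟨t, ⟨unitInterval.pos_iff_ne_zero.2 h0, unitInterval.lt_one_iff_ne_one.2 h1⟩, rfl⟩

theorem point_eq_of_inc {e : E(G)} {w : α} (h : G.Inc e w) :
    R.point w = R.curve e 0 ∨ R.point w = R.curve e 1 := by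
  obtain ⟨y, hy⟩ := h
  have := (R.ends_iff e e.2 w hy.left_mem y hy.right_mem).2 hy
  have h1 : R.point w ∈ ({R.curve e 0, R.curve e 1} : Set Plane) := by rw [this]; simp
  simpa using h1

theorem point_mem_range_of_inc {e : E(G)} {w : α} (h : G.Inc e w) :
    R.point w ∈ range (R.curve e) := by
  rcases R.point_eq_of_inc h with h | h <;> exact h ▸ mem_range_self _

theorem disjoint_edgeInterior_points (hG : IsConnectedGraph G) (e : E(G)) :
    Disjoint (R.edgeInterior e) (R.point '' V(G)) := by
  rw [Set.disjoint_left]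
  rintro z hz ⟨v, hv, rfl⟩
  obtain ⟨f, hf⟩ := hG.exists_inc e ⟨v, hv⟩
  by_cases hfe : f = e
  · subst hfe
    obtain ⟨t, ht, htv⟩ := hz
    rcases R.point_eq_of_inc hf with h | h
    · exact ht.1.ne ((R.isSimpleCurve f).eq_of_mem_Ioo ht (h.symm.trans htv.symm))
    · exact ht.2.ne' ((R.isSimpleCurve f).eq_of_mem_Ioo ht (h.symm.trans htv.symm))
  · exact Set.disjoint_left.1 (R.disjoint e e.2 f f.2 fun h => hfe (Subtype.ext h.symm)) hz
      (R.point_mem_range_of_inc hf)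

theorem disjoint_edgeInterior_partialSkeleton (hG : IsConnectedGraph G) {e : E(G)} {A : Set E(G)}
    (he : e ∉ A) : Disjoint (R.edgeInterior e) (R.partialSkeleton A) := by
  refine disjoint_union_right.2 ⟨R.disjoint_edgeInterior_points hG e, ?_⟩
  simp only [disjoint_iUnion_right]
  exact fun f hf => R.disjoint e e.2 f f.2 fun h => he (Subtype.ext h ▸ hf)

theorem isCompact_partialSkeleton [Finite β] (hV : V(G).Finite) (A : Set E(G)) :
    IsCompact (R.partialSkeleton A) :=
  (hV.image _).isCompact.union
    (A.toFinite.isCompact_biUnion fun e _ => isCompact_range (R.curve e).continuous)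

theorem partialSkeleton_mono {A B : Set E(G)} (h : A ⊆ B) :
    R.partialSkeleton A ⊆ R.partialSkeleton B :=
  union_subset_union_right _ (biUnion_subset_biUnion_left h)

theorem partialSkeleton_insert (e : E(G)) (A : Set E(G)) :
    R.partialSkeleton (insert e A) = R.partialSkeleton A ∪ range (R.curve e) := by
  rw [partialSkeleton, biUnion_insert, partialSkeleton, union_assoc, union_comm (range _)]

theorem curve_zero_mem (e : E(G)) (A : Set E(G)) : R.curve e 0 ∈ R.partialSkeleton A := by
  obtain ⟨u, hu, hu'⟩ := (R.ends_mem e e.2).1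
  exact Or.inl ⟨u, hu, hu'⟩

theorem curve_one_mem (e : E(G)) (A : Set E(G)) : R.curve e 1 ∈ R.partialSkeleton A := by
  obtain ⟨u, hu, hu'⟩ := (R.ends_mem e e.2).2
  exact Or.inl ⟨u, hu, hu'⟩

theorem partialSkeleton_union_edgeInterior (e : E(G)) (A : Set E(G)) :
    R.partialSkeleton (insert e A) = R.partialSkeleton A ∪ R.edgeInterior e := by
  rw [partialSkeleton_insert]
  refine Subset.antisymm (union_subset subset_union_left fun z hz => ?_)
    (union_subset_union_right _ (image_subset_range _ _))
  rcases R.mem_range_curve hz with h | ⟨w, -, rfl⟩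
  · exact Or.inr h
  · exact Or.inl (Or.inl ⟨w, w.2, rfl⟩)

theorem skeleton_eq (hG : IsConnectedGraph G) (e : E(G)) :
    R.skeleton = R.partialSkeleton univ := by
  have h : R.skeleton = ⋃ e ∈ (univ : Set E(G)), range (R.curve e) := by
    simp only [skeleton, mem_univ, iUnion_true]
    exact biUnion_eq_iUnion _ fun e _ => range (R.curve e)
  rw [partialSkeleton, h, eq_comm, union_eq_right]
  rintro _ ⟨v, hv, rfl⟩
  obtain ⟨f, hf⟩ := hG.exists_inc e ⟨v, hv⟩
  exact mem_biUnion (mem_univ f) (R.point_mem_range_of_inc hf)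

/-! ### The part of the drawing reachable from a vertex -/

/-- `f` has an end which is reachable from `u` in `(V, A)`. -/
def Touches (G : Graph α β) (A : Set E(G)) (u : V(G)) (f : E(G)) : Prop :=
  ∃ w : V(G), Reach G A u w ∧ G.Inc f w

theorem reach_of_touches {A : Set E(G)} {u : V(G)} {f : E(G)} (hf : f ∈ A)
    (h : Touches G A u f) {w : V(G)} (hw : G.Inc f w) : Reach G A u w := by
  obtain ⟨x, hx, y, hxy⟩ := h
  rcases hw.eq_or_eq_of_isLink hxy with h | h
  · rwa [Subtype.ext h]
  · exact hx.tail ⟨f, hf, h ▸ hxy⟩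

/-- The drawing of the component of `u` in `(V, A)`. -/
def reachPart (A : Set E(G)) (u : V(G)) : Set Plane :=
  (fun w : V(G) => R.point w) '' {w | Reach G A u w} ∪
    ⋃ f ∈ {f | f ∈ A ∧ Touches G A u f}, range (R.curve f)

/-- The drawing of the other components of `(V, A)`. -/
def unreachPart (A : Set E(G)) (u : V(G)) : Set Plane :=
  (fun w : V(G) => R.point w) '' {w | ¬ Reach G A u w} ∪
    ⋃ f ∈ {f | f ∈ A ∧ ¬ Touches G A u f}, range (R.curve f)

theorem reachPart_union_unreachPart (A : Set E(G)) (u : V(G)) :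
    R.reachPart A u ∪ R.unreachPart A u = R.partialSkeleton A := by
  have hA : {f | f ∈ A ∧ Touches G A u f} ∪ {f | f ∈ A ∧ ¬ Touches G A u f} = A := by
    ext f
    simp only [mem_union, mem_ofPred_eq, ← and_or_left, em, and_true]
  rw [reachPart, unreachPart, union_union_union_comm, ← image_union, ← biUnion_union, hA,
    partialSkeleton]
  congr 1
  · ext z
    constructor
    · rintro ⟨w, -, rfl⟩
      exact ⟨w, w.2, rfl⟩
    · rintro ⟨w, hw, rfl⟩
      exact ⟨⟨w, hw⟩, em _, rfl⟩

theorem isClosed_reachPart [Finite β] (hV : V(G).Finite) (A : Set E(G)) (u : V(G)) :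
    IsClosed (R.reachPart A u) :=
  have := hV.to_subtype
  ((toFinite _).image _).isClosed.union
    ((toFinite _).isClosed_biUnion fun f _ => (isCompact_range (R.curve f).continuous).isClosed)

theorem isClosed_unreachPart [Finite β] (hV : V(G).Finite) (A : Set E(G)) (u : V(G)) :
    IsClosed (R.unreachPart A u) :=
  have := hV.to_subtype
  ((toFinite _).image _).isClosed.union
    ((toFinite _).isClosed_biUnion fun f _ => (isCompact_range (R.curve f).continuous).isClosed)

theorem disjoint_reachPart_unreachPart (hG : IsConnectedGraph G) (A : Set E(G)) (u : V(G)) :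
    Disjoint (R.reachPart A u) (R.unreachPart A u) := by
  have hinj : ∀ {w w' : V(G)}, R.point w = R.point w' → w = w' := fun {w w'} h =>
    Subtype.ext (R.point_injOn w.2 w'.2 h)
  have hpt : ∀ {w : V(G)} {f : E(G)}, R.point w ∈ range (R.curve f) → G.Inc f w := by
    intro w f h
    rcases R.mem_range_curve h with h | ⟨w', hw', h⟩
    · exact absurd ⟨w, w.2, rfl⟩ (Set.disjoint_left.1 (R.disjoint_edgeInterior_points hG f) h)
    · rwa [hinj h]
  rw [Set.disjoint_left]
  rintro z (⟨w, hw, rfl⟩ | hz) (⟨w', hw', h⟩ | hz')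
  · exact hw' (hinj h ▸ hw)
  · obtain ⟨f, hf, hz'⟩ := mem_iUnion₂.1 hz'
    exact hf.2 ⟨w, hw, hpt hz'⟩
  · obtain ⟨f, hf, hz⟩ := mem_iUnion₂.1 hz
    subst h
    exact hw' (reach_of_touches hf.1 hf.2 (hpt hz))
  · obtain ⟨f, hf, hz⟩ := mem_iUnion₂.1 hz
    obtain ⟨f', hf', hz'⟩ := mem_iUnion₂.1 hz'
    have hne : (f : β) ≠ f' := fun h => hf'.2 (Subtype.ext h ▸ hf.2)
    rcases R.mem_range_curve hz with h | ⟨w, hw, rfl⟩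
    · exact Set.disjoint_left.1 (R.disjoint f f.2 f' f'.2 hne) h hz'
    · exact hf'.2 ⟨w, reach_of_touches hf.1 hf.2 hw, hpt hz'⟩

theorem isPreconnected_reachPart (A : Set E(G)) (u : V(G)) :
    IsPreconnected (R.reachPart A u) := by
  have hrange : ∀ f : E(G), IsPreconnected (range (R.curve f)) := fun f =>
    isPreconnected_range (R.curve f).continuous
  have hsub : ∀ f ∈ A, Touches G A u f → range (R.curve f) ⊆ R.reachPart A u :=
    fun f hf hf' z hz => Or.inr (mem_biUnion (show f ∈ {f | f ∈ A ∧ Touches G A u f} from ⟨hf, hf'⟩) hz)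
  have key : ∀ w : V(G), Reach G A u w → ∃ t ⊆ R.reachPart A u, R.point u ∈ t ∧ R.point w ∈ t ∧
      IsPreconnected t := by
    intro w hw
    induction hw with
    | refl =>
      have hu : R.point u ∈ R.reachPart A u := Or.inl ⟨u, .refl, rfl⟩
      exact ⟨{R.point u}, singleton_subset_iff.2 hu, rfl, rfl, isPreconnected_singleton⟩
    | @tail x y hx hxy ih =>
      obtain ⟨t, ht, hut, hxt, htc⟩ := ih
      obtain ⟨f, hf, hl⟩ := hxy
      exact ⟨t ∪ range (R.curve f), union_subset ht (hsub f hf ⟨x, hx, hl.inc_left⟩), Or.inl hut,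
        Or.inr (R.point_mem_range_of_inc hl.inc_right),
        htc.union _ hxt (R.point_mem_range_of_inc hl.inc_left) (hrange f)⟩
  refine isPreconnected_of_forall (R.point u) ?_
  rintro z (⟨w, hw, rfl⟩ | hz)
  · exact key w hw
  · obtain ⟨f, ⟨hf, w, hw, hfw⟩, hz⟩ := mem_iUnion₂.1 hz
    obtain ⟨t, ht, hut, hwt, htc⟩ := key w hw
    exact ⟨t ∪ range (R.curve f), union_subset ht (hsub f hf ⟨w, hw, hfw⟩), Or.inl hut,
      Or.inr hz, htc.union _ hwt (R.point_mem_range_of_inc hfw) (hrange f)⟩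

/-! ### The two sides of an edge -/

/-- A neighbourhood of the interior of the curve of `e` that avoids the rest of the drawing. -/
def tube (e : E(G)) : Set Plane :=
  ⋃ x ∈ R.edgeInterior e, ball x (infDist x (R.partialSkeleton {e}ᶜ))

/-- The points close to the curve of `e` but not on it. -/
def sides (e : E(G)) : Set Plane := R.tube e \ R.edgeInterior e

theorem isOpen_tube (e : E(G)) : IsOpen (R.tube e) :=
  isOpen_biUnion fun _ _ => isOpen_ball

variable {R}

theorem disjoint_tube {e : E(G)} {A : Set E(G)} (he : e ∉ A) :
    Disjoint (R.tube e) (R.partialSkeleton A) := by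
  refine Disjoint.mono_right (R.partialSkeleton_mono (B := {e}ᶜ) fun f hf h => he (h ▸ hf)) ?_
  simp only [tube, disjoint_iUnion_left]
  refine fun x _ => Set.disjoint_left.2 fun z hz hz' => ?_
  rw [mem_ball, dist_comm] at hz
  exact absurd hz (not_lt.2 (infDist_le_dist_of_mem hz'))

theorem edgeInterior_nonempty (e : E(G)) : (R.edgeInterior e).Nonempty :=
  (nonempty_Ioo.2 zero_lt_one).image _

theorem isPreconnected_edgeInterior (e : E(G)) : IsPreconnected (R.edgeInterior e) :=
  isPreconnected_Ioo.image _ (R.curve e).continuous.continuousOn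

theorem notMem_of_mem_sides {e : E(G)} {y : Plane} (hy : y ∈ R.sides e) (A : Set E(G)) :
    y ∉ R.partialSkeleton A := by
  intro h
  have h1 : A ⊆ insert e {e}ᶜ := fun f _ => em (f = e)
  have h2 := R.partialSkeleton_mono h1 h
  rw [partialSkeleton_union_edgeInterior] at h2
  rcases h2 with h2 | h2
  · exact Set.disjoint_left.1 (disjoint_tube (A := {e}ᶜ) (by simp)) hy.1 h2
  · exact hy.2 h2

end PlaneRep
end RandomCluster

namespace RandomCluster

open Set Topology Filter Metric unitInterval

namespace PlaneRep

variable {α β : Type*} [Finite β] {G : Graph α β} {R : PlaneRep G}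

theorem edgeInterior_subset_tube (hV : V(G).Finite) (hG : IsConnectedGraph G) (e : E(G)) :
    R.edgeInterior e ⊆ R.tube e := by
  intro x hx
  refine mem_biUnion hx (mem_ball_self ?_)
  refine ((R.isCompact_partialSkeleton hV _).isClosed.notMem_iff_infDist_pos
    ⟨_, R.curve_zero_mem e _⟩).1 ?_
  exact Set.disjoint_left.1 (R.disjoint_edgeInterior_partialSkeleton hG (by simp)) hx

theorem isPreconnected_tube (hV : V(G).Finite) (hG : IsConnectedGraph G) (e : E(G)) :
    IsPreconnected (R.tube e) := by
  obtain ⟨x₀, hx₀⟩ := R.edgeInterior_nonempty e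
  refine isPreconnected_of_forall x₀ fun y hy => ?_
  obtain ⟨x, hx, hy⟩ := mem_iUnion₂.1 hy
  have hr := dist_nonneg.trans_lt (mem_ball.1 hy)
  refine ⟨R.edgeInterior e ∪ ball x (infDist x (R.partialSkeleton {e}ᶜ)), ?_, Or.inl hx₀,
    Or.inr hy, (isPreconnected_edgeInterior e).union x hx (mem_ball_self hr)
      isPreconnected_ball⟩
  exact union_subset (edgeInterior_subset_tube hV hG e) fun z hz => mem_biUnion hx hz

/-- If the ends of `e` are not connected in `(V, A)`, then both sides of `e` lie in the same
component of the complement of the drawing of `(V, A ∪ {e})`. -/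
theorem mem_component_of_not_endsConnected (hV : V(G).Finite) (hG : IsConnectedGraph G)
    {A : Set E(G)} {e : E(G)} (he : e ∉ A) (h : ¬ EndsConnected G A e) {y y' : Plane}
    (hy : y ∈ R.sides e) (hy' : y' ∈ R.sides e) :
    y' ∈ connectedComponentIn (R.partialSkeleton (insert e A))ᶜ y := by
  classical
  obtain ⟨u, v, huv, hu, hv⟩ := R.exists_ends e
  have hnr : ¬ Reach G A u v := by
    intro hr
    refine h fun a b hab => ?_
    rcases hab.eq_and_eq_or_eq_and_eq huv with ⟨h1, h2⟩ | ⟨h1, h2⟩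
    · rwa [Subtype.ext h1, Subtype.ext h2]
    · rw [Subtype.ext h1, Subtype.ext h2]
      exact (reach_equivalence G A).symm hr
  refine mem_component_of_hasLog (R.isCompact_partialSkeleton hV _) (notMem_of_mem_sides hy _)
    (notMem_of_mem_sides hy' _) ?_
  have hcl := (R.isCompact_partialSkeleton hV A).isClosed
  obtain ⟨g, hg, hge⟩ := hasLog_ratio_of_isPreconnected hcl (isPreconnected_tube hV hG e)
    (disjoint_tube he) hy.1 hy'.1
  have hne : ∀ y ∈ R.sides e, ∀ t, R.curve e t ≠ y := fun y hy t ht =>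
    notMem_of_mem_sides hy (insert e A) (by
      rw [partialSkeleton_insert]
      exact Or.inr ⟨t, ht⟩)
  obtain ⟨l, hl, hle⟩ := exists_continuous_log_unitInterval
    (f := fun t => ratio y y' (R.curve e t))
    ((continuousOn_ratio (K := range (R.curve e)) fun ⟨t, ht⟩ => hne y' hy' t ht).comp_continuous
      (R.curve e).continuous fun t => ⟨t, rfl⟩)
    fun t => ratio_ne_zero (hne y hy t) (hne y' hy' t)
  set δ := l 1 - l 0 - (g (R.curve e 1) - g (R.curve e 0)) with hδ
  have hexp : Complex.exp δ = 1 := by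
    have hr : ∀ t, ratio y y' (R.curve e t) ≠ 0 := fun t =>
      ratio_ne_zero (hne y hy t) (hne y' hy' t)
    rw [hδ, Complex.exp_sub, Complex.exp_sub, Complex.exp_sub, hle, hle,
      hge _ (R.curve_one_mem e A), hge _ (R.curve_zero_mem e A), div_self]
    exact div_ne_zero (hr 1) (hr 0)
  have h0 : R.curve e 0 ∈ R.reachPart A u := Or.inl ⟨u, .refl, hu.symm⟩
  have h1 : R.curve e 1 ∈ R.unreachPart A u := Or.inl ⟨v, hnr, hv.symm⟩
  have hdisj := R.disjoint_reachPart_unreachPart hG A u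
  set g' : Plane → ℂ := fun z => if z ∈ R.reachPart A u then g z else g z + δ with hg'
  have hg1 : ∀ z ∈ R.reachPart A u, g' z = g z := fun z hz => if_pos hz
  have hg2 : ∀ z ∈ R.unreachPart A u, g' z = g z + δ := fun z hz =>
    if_neg (Set.disjoint_right.1 hdisj hz)
  have hU := R.reachPart_union_unreachPart A u
  rw [partialSkeleton_insert]
  refine hasLog_union_range hcl (R.isSimpleCurve e) (R.curve_zero_mem e A) (R.curve_one_mem e A)
    (R.disjoint_edgeInterior_partialSkeleton hG he) (g := g') ?_ ?_ hl hle ?_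
  · rw [← hU]
    refine ContinuousOn.union_of_isClosed ((hg.mono ?_).congr hg1)
      (((hg.mono ?_).add continuousOn_const).congr hg2) (R.isClosed_reachPart hV A u)
      (R.isClosed_unreachPart hV A u)
    · exact hU ▸ subset_union_left
    · exact hU ▸ subset_union_right
  · intro z hz
    rw [← hge z hz]
    by_cases h : z ∈ R.reachPart A u
    · rw [hg1 z h]
    · rw [show g' z = g z + δ from if_neg h, Complex.exp_add, hexp, mul_one]
  · rw [hg1 _ h0, hg2 _ h1, hδ]
    ring

/-- If the ends of `e` are connected in `(V, A)`, then the two sides of `e` lie in different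
components of the complement of the drawing of `(V, A ∪ {e})`. -/
theorem exists_notMem_component_of_endsConnected (hV : V(G).Finite) (hG : IsConnectedGraph G)
    {A : Set E(G)} {e : E(G)} (he : e ∉ A) (h : EndsConnected G A e) :
    ∃ y ∈ R.sides e, ∃ y' ∈ R.sides e,
      y' ∉ connectedComponentIn (R.partialSkeleton (insert e A))ᶜ y := by
  obtain ⟨u, v, huv, hu, hv⟩ := R.exists_ends e
  have h0 : R.curve e 0 ∈ R.reachPart A u := Or.inl ⟨u, .refl, hu.symm⟩
  have h1 : R.curve e 1 ∈ R.reachPart A u := Or.inl ⟨v, h u v huv, hv.symm⟩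
  rw [partialSkeleton_insert]
  exact exists_separated_of_isPreconnected (R.isSimpleCurve e)
    (R.isCompact_partialSkeleton hV A).isClosed
    (R.reachPart_union_unreachPart A u ▸ subset_union_left) (R.isClosed_reachPart hV A u)
    (R.isPreconnected_reachPart A u) h0 h1 (R.isOpen_tube e) (edgeInterior_subset_tube hV hG e)
    (disjoint_tube he)

theorem sides_nonempty (hV : V(G).Finite) (hG : IsConnectedGraph G) (e : E(G)) :
    (R.sides e).Nonempty := by
  by_contra hne
  have hsub : R.tube e ⊆ R.edgeInterior e := fun z hz => by
    by_contra h
    exact hne ⟨z, hz, h⟩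
  have := eq_empty_of_isOpen_of_subset_curve (R.isSimpleCurve e) (R.isOpen_tube e) hsub
  obtain ⟨x, hx⟩ := R.edgeInterior_nonempty e
  have := edgeInterior_subset_tube hV hG e hx
  simp_all

/-- Among three points close to an edge two lie in the same face. -/
theorem mem_component_of_three_sides (hV : V(G).Finite) (hG : IsConnectedGraph G) {e : E(G)}
    {a b c : Plane} (ha : a ∈ R.sides e) (hb : b ∈ R.sides e) (hc : c ∈ R.sides e)
    (hab : b ∉ connectedComponentIn (R.partialSkeleton univ)ᶜ a)
    (hcb : b ∉ connectedComponentIn (R.partialSkeleton univ)ᶜ c) :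
    c ∈ connectedComponentIn (R.partialSkeleton univ)ᶜ a := by
  by_contra hac
  set S := R.partialSkeleton {e}ᶜ with hS
  have hins : insert e ({e}ᶜ : Set E(G)) = univ := eq_univ_of_forall fun f => em (f = e)
  have hSK : R.partialSkeleton univ = S ∪ range (R.curve e) := by
    rw [← partialSkeleton_insert, hins]
  have he : e ∉ ({e}ᶜ : Set E(G)) := by simp
  have hcl := (R.isCompact_partialSkeleton hV {e}ᶜ).isClosed
  have hne : ∀ y ∈ R.sides e, ∀ t, R.curve e t ≠ y := fun y hy t ht =>
    notMem_of_mem_sides hy univ (hSK ▸ Or.inr ⟨t, ht⟩)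
  have key : ∀ y ∈ R.sides e, ∃ g : Plane → ℂ, ContinuousOn g S ∧
      (∀ z ∈ S, Complex.exp (g z) = ratio y b z) ∧ ∃ l : I → ℂ, Continuous l ∧
      (∀ t, Complex.exp (l t) = ratio y b (R.curve e t)) ∧
      ∃ n : ℤ, l 1 - l 0 = g (R.curve e 1) - g (R.curve e 0) + n * (2 * Real.pi * Complex.I) := by
    intro y hy
    obtain ⟨g, hg, hge⟩ := hasLog_ratio_of_isPreconnected hcl (isPreconnected_tube hV hG e)
      (disjoint_tube he) hy.1 hb.1
    obtain ⟨l, hl, hle⟩ := exists_continuous_log_unitInterval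
      (f := fun t => ratio y b (R.curve e t))
      ((continuousOn_ratio (K := range (R.curve e)) fun ⟨t, ht⟩ => hne b hb t ht).comp_continuous
        (R.curve e).continuous fun t => ⟨t, rfl⟩)
      fun t => ratio_ne_zero (hne y hy t) (hne b hb t)
    refine ⟨g, hg, hge, l, hl, hle, Complex.exp_eq_exp_iff_exists_int.1 ?_⟩
    rw [Complex.exp_sub, Complex.exp_sub, hle, hle, hge _ (R.curve_one_mem e _),
      hge _ (R.curve_zero_mem e _)]
  have hglue : ∀ (f g : Plane → ℂ) (l : I → ℂ), ContinuousOn g S →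
      (∀ z ∈ S, Complex.exp (g z) = f z) → Continuous l →
      (∀ t, Complex.exp (l t) = f (R.curve e t)) →
      l 1 - l 0 = g (R.curve e 1) - g (R.curve e 0) → HasLog (R.partialSkeleton univ) f := by
    intro f g l hg hge hl hle hinc
    rw [hSK]
    exact hasLog_union_range hcl (R.isSimpleCurve e) (R.curve_zero_mem e _) (R.curve_one_mem e _)
      (R.disjoint_edgeInterior_partialSkeleton hG he) hg hge hl hle hinc
  obtain ⟨g, hg, hge, l, hl, hle, n, hn⟩ := key a ha
  obtain ⟨g', hg', hge', l', hl', hle', k, hk⟩ := key c hc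
  have hK := R.isCompact_partialSkeleton hV univ
  have haK := notMem_of_mem_sides ha univ
  have hbK := notMem_of_mem_sides hb univ
  have hcK := notMem_of_mem_sides hc univ
  have hn0 : n ≠ 0 := by
    rintro rfl
    exact hab (mem_component_of_hasLog hK haK hbK
      (hglue _ g l hg hge hl hle (by simpa using hn)))
  have hk0 : k ≠ 0 := by
    rintro rfl
    exact hcb (mem_component_of_hasLog hK hcK hbK
      (hglue _ g' l' hg' hge' hl' hle' (by simpa using hk)))
  have hlog : HasLog (R.partialSkeleton univ) (fun z => ratio a b z ^ k * ratio c b z ^ (-n)) := by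
    refine hglue _ (fun z => k * g z + (-n : ℤ) * g' z) (fun t => k * l t + (-n : ℤ) * l' t)
      ((continuousOn_const.mul hg).add (continuousOn_const.mul hg')) (fun z hz => ?_)
      (by fun_prop) (fun t => ?_) ?_
    · rw [Complex.exp_add, Complex.exp_int_mul, Complex.exp_int_mul, hge z hz, hge' z hz]
    · rw [Complex.exp_add, Complex.exp_int_mul, Complex.exp_int_mul, hle, hle']
    · push_cast
      linear_combination (k : ℂ) * hn - n * hk
  rcases eq_zero_or_eq_zero_of_hasLog hK haK hbK hcK hab hac hcb hlog with h | h
  · exact hk0 h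
  · exact hn0 (neg_eq_zero.1 h)

end PlaneRep
end RandomCluster

namespace RandomCluster

open Set Topology Filter Metric unitInterval

theorem subset_of_disjoint_frontier {s U : Set Plane} (hs : IsPreconnected s) (hU : IsOpen U)
    (hne : (s ∩ U).Nonempty) (h : Disjoint s (frontier U)) : s ⊆ U := by
  refine hs.subset_left_of_subset_union hU isClosed_closure.isOpen_compl
    (disjoint_compl_right.mono_left subset_closure) (fun z hz => ?_) hne
  by_cases hzU : z ∈ U
  · exact Or.inl hzU
  · refine Or.inr fun hzc => Set.disjoint_left.1 h hz ?_
    rw [hU.frontier_eq]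
    exact ⟨hzc, hzU⟩

theorem eq_pair_of_mem {ι : Type*} {s : Set ι} {x y a b : ι} (hs : s = {x, y}) (ha : a ∈ s)
    (hb : b ∈ s) (hab : a ≠ b) : s = {a, b} := by
  subst hs
  rcases ha with h1 | h1 <;> rcases hb with h2 | h2
  · exact absurd (h1.trans h2.symm) hab
  · rw [h1, mem_singleton_iff.1 h2]
  · rw [mem_singleton_iff.1 h1, h2, pair_comm]
  · exact absurd (h1.trans h2.symm) hab

namespace PlaneRep

variable {α β : Type*} {G : Graph α β} {R : PlaneRep G}

/-! ### Faces -/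

theorem edgeInterior_subset_skeleton (e : E(G)) : R.edgeInterior e ⊆ R.skeleton :=
  (image_subset_range _ _).trans
    (subset_biUnion_of_mem (u := fun e => range (R.curve e)) e.2)

theorem notMem_skeleton_of_mem_face {F : Set Plane} (hF : F ∈ R.faces) {z : Plane} (hz : z ∈ F) :
    z ∉ R.skeleton := by
  obtain ⟨x, -, rfl⟩ := hF
  exact connectedComponentIn_subset _ _ hz

theorem face_eq_of_mem {F : Set Plane} (hF : F ∈ R.faces) {z : Plane} (hz : z ∈ F) :
    F = connectedComponentIn R.skeletonᶜ z := by
  obtain ⟨x, -, rfl⟩ := hF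
  exact connectedComponentIn_eq hz

theorem isPreconnected_face {F : Set Plane} (hF : F ∈ R.faces) : IsPreconnected F := by
  obtain ⟨x, -, rfl⟩ := hF
  exact isPreconnected_connectedComponentIn

theorem notMem_skeleton_of_mem_sides (hG : IsConnectedGraph G) {e : E(G)} {y : Plane}
    (hy : y ∈ R.sides e) : y ∉ R.skeleton := by
  rw [R.skeleton_eq hG e]
  exact notMem_of_mem_sides hy _

theorem eq_of_mem_tube {e f : E(G)} {z : Plane} (hz : z ∈ R.tube e)
    (hz' : z ∈ R.edgeInterior f) : f = e := by
  by_contra h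
  exact Set.disjoint_left.1 (disjoint_tube (A := {e}ᶜ) (by simp)) hz
    (Or.inr (mem_biUnion (show f ∈ ({e}ᶜ : Set E(G)) from h) (image_subset_range _ _ hz')))

theorem mem_edgeInterior_of_mem_tube (hG : IsConnectedGraph G) {e : E(G)} {z : Plane}
    (hz : z ∈ R.tube e) (hz' : z ∈ R.skeleton) : z ∈ R.edgeInterior e := by
  by_contra h
  exact notMem_skeleton_of_mem_sides hG ⟨hz, h⟩ hz'

theorem reach_dual_of_facesAt {B : Set E(R.dual)} {f : E(R.dual)} (hf : f ∈ B) {F F' : V(R.dual)}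
    (hF : F.1 ∈ R.facesAt f) (hF' : F'.1 ∈ R.facesAt f) : Reach R.dual B F F' := by
  obtain ⟨X, Y, hfG, hXY⟩ := R.dual.exists_isLink_of_mem_edgeSet f.2
  by_cases hne : F = F'
  · exact hne ▸ .refl
  · exact .single ⟨f, hf, hfG, eq_pair_of_mem hXY hF hF' fun h => hne (Subtype.ext h)⟩

variable [Finite β]

theorem isClosed_skeleton : IsClosed R.skeleton :=
  (toFinite _).isClosed_biUnion fun e _ => (isCompact_range (R.curve e).continuous).isClosed

theorem mem_facesAt_iff (hV : V(G).Finite) (hG : IsConnectedGraph G) (e : E(G)) {F : Set Plane} :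
    F ∈ R.facesAt e ↔ ∃ y ∈ R.sides e, F = connectedComponentIn R.skeletonᶜ y := by
  constructor
  · rintro ⟨hF, z, hz, hze⟩
    obtain ⟨y, hy, hyF⟩ := mem_closure_iff.1 (frontier_subset_closure hz) _ (R.isOpen_tube e)
      (edgeInterior_subset_tube hV hG e hze)
    exact ⟨y, ⟨hy, fun h => notMem_skeleton_of_mem_face hF hyF
      (edgeInterior_subset_skeleton e h)⟩, face_eq_of_mem hF hyF⟩
  · rintro ⟨y, hy, rfl⟩
    have hys := notMem_skeleton_of_mem_sides hG hy
    refine ⟨⟨y, hys, rfl⟩, ?_⟩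
    obtain ⟨x, hx, hyx⟩ := mem_iUnion₂.1 hy.1
    by_contra hne
    have hr := dist_nonneg.trans_lt (mem_ball.1 hyx)
    have := subset_of_disjoint_frontier (isPreconnected_ball (x := x))
      (isOpen_component isClosed_skeleton y) ⟨y, hyx, mem_connectedComponentIn hys⟩
      (Set.disjoint_left.2 fun z hz hzf => hne ⟨z, hzf, mem_edgeInterior_of_mem_tube hG
        (mem_biUnion hx hz) (frontier_component_subset isClosed_skeleton y hzf)⟩)
    exact connectedComponentIn_subset _ _ (this (mem_ball_self hr))
      (edgeInterior_subset_skeleton e hx)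

theorem exists_facesAt_eq (hV : V(G).Finite) (hG : IsConnectedGraph G) (e : E(G)) :
    ∃ F F', R.facesAt e = {F, F'} := by
  obtain ⟨b, hb⟩ := sides_nonempty (R := R) hV hG e
  have hsk := R.skeleton_eq hG e
  by_cases h : ∀ y ∈ R.sides e, connectedComponentIn R.skeletonᶜ y =
      connectedComponentIn R.skeletonᶜ b
  · refine ⟨connectedComponentIn R.skeletonᶜ b, connectedComponentIn R.skeletonᶜ b,
      Set.ext fun F => ?_⟩
    rw [mem_facesAt_iff hV hG, pair_eq_singleton, mem_singleton_iff]
    constructor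
    · rintro ⟨y, hy, rfl⟩
      exact h y hy
    · rintro rfl
      exact ⟨b, hb, rfl⟩
  · push Not at h
    obtain ⟨a, ha, hab⟩ := h
    refine ⟨connectedComponentIn R.skeletonᶜ a, connectedComponentIn R.skeletonᶜ b,
      Set.ext fun F => ?_⟩
    rw [mem_facesAt_iff hV hG, mem_insert_iff, mem_singleton_iff]
    constructor
    · rintro ⟨c, hc, rfl⟩
      by_contra! hc'
      refine hc'.1 (connectedComponentIn_eq ?_).symm
      rw [hsk] at *
      exact mem_component_of_three_sides hV hG ha hb hc
        (fun h => hab (connectedComponentIn_eq h))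
        (fun h => hc'.2 (connectedComponentIn_eq h))
    · rintro (rfl | rfl)
      · exact ⟨a, ha, rfl⟩
      · exact ⟨b, hb, rfl⟩

theorem finite_faces (hV : V(G).Finite) (hG : IsConnectedGraph G) : R.faces.Finite := by
  rcases isEmpty_or_nonempty E(G) with hE | ⟨⟨e⟩⟩
  · have h0 : R.skeleton = ∅ := by
      simp only [skeleton, iUnion_eq_empty]
      exact fun e he => (hE.false ⟨e, he⟩).elim
    refine (finite_singleton univ).subset ?_
    rintro _ ⟨x, -, rfl⟩
    rw [h0, compl_empty, connectedComponentIn_univ, PreconnectedSpace.connectedComponent_eq_univ]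
    exact rfl
  · have hfin : (⋃ e : E(G), R.facesAt e).Finite := finite_iUnion fun e => by
      obtain ⟨F, F', h⟩ := exists_facesAt_eq (R := R) hV hG e
      rw [h]
      exact toFinite _
    refine hfin.subset fun F hF => ?_
    obtain ⟨x, hx, rfl⟩ := id hF
    by_contra hne
    have hne' : ∀ e : E(G), connectedComponentIn R.skeletonᶜ x ∉ R.facesAt e := fun e he =>
      hne (mem_iUnion.2 ⟨e, he⟩)
    set F := connectedComponentIn R.skeletonᶜ x
    have hfr : frontier F ⊆ R.point '' V(G) := by
      intro z hz
      have hzs := frontier_component_subset isClosed_skeleton x hz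
      rw [R.skeleton_eq hG e] at hzs
      rcases hzs with h | h
      · exact h
      · obtain ⟨f, -, hf⟩ := mem_iUnion₂.1 h
        rcases R.mem_range_curve hf with h | ⟨w, -, rfl⟩
        · exact absurd ⟨hF, z, hz, h⟩ (hne' f)
        · exact ⟨w, w.2, rfl⟩
    have hsub : R.point '' V(G) ⊆ R.skeleton := by
      rw [R.skeleton_eq hG e]
      exact subset_union_left
    have hconn := (Set.Countable.isConnected_compl_of_one_lt_rank one_lt_rank_plane
      (hV.image R.point).countable).isPreconnected
    have := subset_of_disjoint_frontier hconn (isOpen_component isClosed_skeleton x)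
      ⟨x, fun h => hx (hsub h), mem_connectedComponentIn hx⟩
      (disjoint_compl_left.mono_right hfr)
    obtain ⟨z, hz⟩ := R.edgeInterior_nonempty e
    have hzF := this (Set.disjoint_left.1 (R.disjoint_edgeInterior_points hG e) hz)
    exact connectedComponentIn_subset _ _ hzF (edgeInterior_subset_skeleton e hz)

/-! ### Connectivity in the dual graph -/

theorem edgeSet_dual (hV : V(G).Finite) (hG : IsConnectedGraph G) : E(R.dual) = E(G) := by
  ext e
  constructor
  · intro he
    obtain ⟨F, F', h⟩ := R.dual.exists_isLink_of_mem_edgeSet he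
    exact h.1
  · intro he
    obtain ⟨F, F', h⟩ := exists_facesAt_eq (R := R) hV hG ⟨e, he⟩
    exact Graph.IsLink.edge_mem (G := R.dual) (show R.dual.IsLink e F F' from ⟨he, h⟩)

/-- If two faces are joined in the dual graph without using edges dual to `A`, then they lie in the
same component of the complement of the drawing of `(V, A)`. -/
theorem mem_component_of_reach_dual (hV : V(G).Finite) (hG : IsConnectedGraph G) (e₀ : E(G))
    {A : Set E(G)} {B : Set E(R.dual)} (hB : ∀ f ∈ B, ∀ g ∈ A, (f : β) ≠ g) {F F' : V(R.dual)}
    (h : Reach R.dual B F F') {y y' : Plane} (hy : y ∈ F.1) (hy' : y' ∈ F'.1) :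
    y' ∈ connectedComponentIn (R.partialSkeleton A)ᶜ y := by
  have hsub : R.skeletonᶜ ⊆ (R.partialSkeleton A)ᶜ := compl_subset_compl.2
    (R.skeleton_eq hG e₀ ▸ R.partialSkeleton_mono (subset_univ _))
  have hface : ∀ F ∈ R.faces, F ⊆ (R.partialSkeleton A)ᶜ := fun F hF z hz =>
    hsub (notMem_skeleton_of_mem_face hF hz)
  induction h generalizing y' with
  | refl => exact (isPreconnected_face F.2).subset_connectedComponentIn hy (hface F F.2) hy'
  | @tail F₁ F₂ _ hl ih =>
    obtain ⟨f, hf, hfG, hfF⟩ := hl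
    have h1 : F₁.1 ∈ R.facesAt f := by rw [hfF]; simp
    have h2 : F₂.1 ∈ R.facesAt f := by rw [hfF]; simp
    obtain ⟨z₁, hz₁, hF₁⟩ := (mem_facesAt_iff hV hG ⟨f, hfG⟩).1 h1
    obtain ⟨z₂, hz₂, hF₂⟩ := (mem_facesAt_iff hV hG ⟨f, hfG⟩).1 h2
    have hm : ∀ z ∈ R.sides ⟨f, hfG⟩, z ∈ connectedComponentIn R.skeletonᶜ z := fun z hz =>
      mem_connectedComponentIn (notMem_skeleton_of_mem_sides hG hz)
    have hfA : (⟨f, hfG⟩ : E(G)) ∉ A := fun h => hB f hf _ h rfl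
    have h3 := ih (y' := z₁) (by rw [hF₁]; exact hm _ hz₁)
    have h4 : z₂ ∈ connectedComponentIn (R.partialSkeleton A)ᶜ z₁ :=
      (isPreconnected_tube hV hG ⟨f, hfG⟩).subset_connectedComponentIn hz₁.1
        (disjoint_tube hfA).subset_compl_right hz₂.1
    have h5 : y' ∈ connectedComponentIn (R.partialSkeleton A)ᶜ z₂ :=
      (isPreconnected_face F₂.2).subset_connectedComponentIn
        (by rw [hF₂]; exact hm _ hz₂) (hface _ F₂.2) hy'
    exact mem_component_trans (mem_component_trans h3 h4) h5

/-- If two faces lie in the same component of the complement of the drawing of `(V, A)`, then they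
are joined in the dual graph without using edges dual to `A`. -/
theorem reach_dual_of_mem_component (hV : V(G).Finite) (hG : IsConnectedGraph G) (e₀ : E(G))
    {A : Set E(G)} {B : Set E(R.dual)} (hB : ∀ f : E(R.dual), (∀ g ∈ A, (f : β) ≠ g) → f ∈ B)
    {F F' : V(R.dual)} {y y' : Plane} (hy : y ∈ F.1) (hy' : y' ∈ F'.1)
    (h : y' ∈ connectedComponentIn (R.partialSkeleton A)ᶜ y) : Reach R.dual B F F' := by
  have hsk := R.skeleton_eq hG e₀
  let Q : Plane → V(R.dual) → Prop := fun z F => z ∈ F.1 ∨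
    ∃ e : E(G), e ∉ A ∧ z ∈ R.edgeInterior e ∧ F.1 ∈ R.facesAt e
  have hQtube : ∀ (e : E(G)) (z : Plane) (F : V(R.dual)), z ∈ R.tube e → Q z F →
      F.1 ∈ R.facesAt e := by
    rintro e z F hz (hzF | ⟨f, -, hzf, hFf⟩)
    · refine (mem_facesAt_iff hV hG e).2 ⟨z, ⟨hz, fun h => ?_⟩, face_eq_of_mem F.2 hzF⟩
      exact notMem_skeleton_of_mem_face F.2 hzF (edgeInterior_subset_skeleton e h)
    · rwa [← eq_of_mem_tube hz hzf]
  have hQface : ∀ (z : Plane) (F : V(R.dual)), z ∉ R.skeleton → Q z F →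
      F.1 = connectedComponentIn R.skeletonᶜ z := by
    rintro z F hz (hzF | ⟨f, -, hzf, hFf⟩)
    · exact face_eq_of_mem F.2 hzF
    · exact absurd (edgeInterior_subset_skeleton f hzf) hz
  have hcases : ∀ z ∉ R.partialSkeleton A, z ∉ R.skeleton ∨ ∃ e ∉ A, z ∈ R.edgeInterior e := by
    intro z hz
    by_contra! h
    have hz1 := h.1
    rw [hsk] at hz1
    rcases hz1 with h1 | h1
    · exact hz (Or.inl h1)
    · obtain ⟨f, -, hf⟩ := mem_iUnion₂.1 h1
      have hfA : f ∉ A := fun hfA => hz (Or.inr (mem_biUnion hfA hf))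
      rcases R.mem_range_curve hf with h2 | ⟨w, -, rfl⟩
      · exact h.2 f hfA h2
      · exact hz (Or.inl ⟨w, w.2, rfl⟩)
  have hQex : ∀ z ∉ R.partialSkeleton A, ∃ F, Q z F := by
    intro z hz
    rcases hcases z hz with h | ⟨e, he, hze⟩
    · exact ⟨⟨_, z, h, rfl⟩, Or.inl (mem_connectedComponentIn h)⟩
    · obtain ⟨y, hy⟩ := sides_nonempty (R := R) hV hG e
      exact ⟨⟨_, y, notMem_skeleton_of_mem_sides hG hy, rfl⟩,
        Or.inr ⟨e, he, hze, (mem_facesAt_iff hV hG e).2 ⟨y, hy, rfl⟩⟩⟩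
  have hUsub : connectedComponentIn (R.partialSkeleton A)ᶜ y ⊆ (R.partialSkeleton A)ᶜ :=
    connectedComponentIn_subset _ _
  have hyU : y ∈ connectedComponentIn (R.partialSkeleton A)ᶜ y :=
    mem_connectedComponentIn (connectedComponentIn_nonempty_iff.1 ⟨y', h⟩)
  refine isPreconnected_connectedComponentIn.induction₂
    (fun z z' => ∀ F F', Q z F → Q z' F' → Reach R.dual B F F') (fun z hz => ?_)
    (fun x z w _ hz _ h1 h2 F F' hF hF' => ?_)
    (fun _ _ _ _ h F F' hF hF' => (reach_equivalence _ _).symm (h F' F hF' hF)) hyU h F F'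
    (Or.inl hy) (Or.inl hy')
  · rcases hcases z (hUsub hz) with h | ⟨e, he, hze⟩
    · filter_upwards [mem_nhdsWithin_of_mem_nhds
        ((isOpen_component isClosed_skeleton z).mem_nhds (mem_connectedComponentIn h))]
        with w hw F F' hF hF'
      have hFF : F = F' := Subtype.ext (by
        rw [hQface z F h hF, hQface w F' (connectedComponentIn_subset _ _ hw) hF']
        exact connectedComponentIn_eq hw)
      exact hFF ▸ .refl
    · have hzt := edgeInterior_subset_tube hV hG e hze
      filter_upwards [mem_nhdsWithin_of_mem_nhds ((R.isOpen_tube e).mem_nhds hzt)]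
        with w hw F F' hF hF'
      have hed : (e : β) ∈ E(R.dual) := by rw [edgeSet_dual hV hG]; exact e.2
      have heB : (⟨e, hed⟩ : E(R.dual)) ∈ B := hB _ fun g hg h => by
        have heg : e = g := Subtype.ext h
        exact he (heg ▸ hg)
      exact reach_dual_of_facesAt heB (hQtube e z F hzt hF) (hQtube e w F' hw hF')
  · obtain ⟨X, hX⟩ := hQex z (hUsub hz)
    exact (reach_equivalence _ _).trans (h1 F X hF hX) (h2 X F' hX hF')

/-- Planar duality for connectivity. -/
theorem endsConnected_dual_iff (hV : V(G).Finite) (hG : IsConnectedGraph G) {A : Set E(G)}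
    {e : E(G)} (he : e ∉ A) {B : Set E(R.dual)}
    (hB : ∀ f : E(R.dual), f ∈ B ↔ (f : β) ≠ e ∧ ∀ g ∈ A, (f : β) ≠ g)
    (e' : E(R.dual)) (hee : (e' : β) = e) :
    EndsConnected R.dual B e' ↔ ¬ EndsConnected G A e := by
  have hB' : ∀ f : E(R.dual), f ∈ B ↔ ∀ g ∈ insert e A, (f : β) ≠ g := fun f => by
    rw [hB, forall_mem_insert]
  constructor
  · intro h hA
    obtain ⟨y, hy, y', hy', hne⟩ := exists_notMem_component_of_endsConnected (R := R) hV hG he hA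
    have hys := notMem_skeleton_of_mem_sides hG hy
    have hys' := notMem_skeleton_of_mem_sides hG hy'
    let F : V(R.dual) := ⟨_, y, hys, rfl⟩
    let F' : V(R.dual) := ⟨_, y', hys', rfl⟩
    have hyF : y ∈ F.1 := mem_connectedComponentIn hys
    have hyF' : y' ∈ F'.1 := mem_connectedComponentIn hys'
    refine hne (mem_component_of_reach_dual hV hG e (fun f hf => (hB' f).1 hf)
      (F := F) (F' := F') ?_ hyF hyF')
    have hF : F.1 ∈ R.facesAt e := (mem_facesAt_iff hV hG e).2 ⟨y, hy, rfl⟩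
    have hF' : F'.1 ∈ R.facesAt e := (mem_facesAt_iff hV hG e).2 ⟨y', hy', rfl⟩
    by_cases hFF : F = F'
    · exact hFF ▸ .refl
    · refine h F F' ⟨hee ▸ e.2, ?_⟩
      rw [hee]
      obtain ⟨X, Y, hXY⟩ := exists_facesAt_eq (R := R) hV hG e
      exact eq_pair_of_mem hXY hF hF' fun h => hFF (Subtype.ext h)
  · rintro hA F F' ⟨-, hFF⟩
    rw [hee] at hFF
    have h1 : F.1 ∈ R.facesAt e := by rw [hFF]; simp
    have h2 : F'.1 ∈ R.facesAt e := by rw [hFF]; simp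
    obtain ⟨y, hy, hF⟩ := (mem_facesAt_iff hV hG e).1 h1
    obtain ⟨y', hy', hF'⟩ := (mem_facesAt_iff hV hG e).1 h2
    have hm : ∀ z ∈ R.sides e, z ∈ connectedComponentIn R.skeletonᶜ z := fun z hz =>
      mem_connectedComponentIn (notMem_skeleton_of_mem_sides hG hz)
    exact reach_dual_of_mem_component hV hG e (fun f hf => (hB' f).2 hf)
      (by rw [hF]; exact hm y hy) (by rw [hF']; exact hm y' hy')
      (mem_component_of_not_endsConnected hV hG he hA hy hy')

end PlaneRep
end RandomCluster

namespace RandomCluster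

open Module.End Matrix

/-! ## Comparison of spectral gaps -/

section Comparison

variable {Ω : Type*} [Fintype Ω]

/-- `P` is self-adjoint with respect to the weights `μ`. -/
def IsReversible (μ : Ω → ℝ) (P : Matrix Ω Ω ℝ) : Prop :=
  ∀ f g : Ω → ℝ, ∑ x, μ x * (f x * (P *ᵥ g) x) = ∑ x, μ x * ((P *ᵥ f) x * g x)

/-- The Dirichlet form of `P`. -/
def dirichlet (μ : Ω → ℝ) (P : Matrix Ω Ω ℝ) (f : Ω → ℝ) : ℝ :=
  ∑ x, μ x * (f x * (f x - (P *ᵥ f) x))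

theorem spectralGap_eq (P : Matrix Ω Ω ℝ) :
    spectralGap P = 1 - sSup {r : ℝ | ∃ ξ : ℝ, HasEigenvalue P.mulVecLin ξ ∧ ξ ≠ 1 ∧ r = |ξ|} := by
  unfold spectralGap
  congr!

theorem bddAbove_abs_eigenvalues (P : Matrix Ω Ω ℝ) :
    BddAbove {r : ℝ | ∃ ξ : ℝ, HasEigenvalue P.mulVecLin ξ ∧ ξ ≠ 1 ∧ r = |ξ|} := by
  refine (((finite_hasEigenvalue P.mulVecLin).image abs).subset ?_).bddAbove
  rintro _ ⟨ξ, hξ, -, rfl⟩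
  exact ⟨ξ, hξ, rfl⟩

theorem spectralGap_le_one (P : Matrix Ω Ω ℝ) : spectralGap P ≤ 1 := by
  rw [spectralGap_eq, sub_le_self_iff]
  refine Real.sSup_nonneg ?_
  rintro _ ⟨ξ, -, -, rfl⟩
  exact abs_nonneg ξ

theorem spectralGap_le_one_sub_abs {P : Matrix Ω Ω ℝ} {ξ : ℝ} (h : HasEigenvalue P.mulVecLin ξ)
    (h1 : ξ ≠ 1) : spectralGap P ≤ 1 - |ξ| := by
  rw [spectralGap_eq]
  exact sub_le_sub_left (le_csSup (bddAbove_abs_eigenvalues P) ⟨ξ, h, h1, rfl⟩) 1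

theorem exists_eigenvalue_of_spectralGap_ne_one {P : Matrix Ω Ω ℝ} (h : spectralGap P ≠ 1) :
    ∃ ξ : ℝ, HasEigenvalue P.mulVecLin ξ ∧ ξ ≠ 1 ∧ spectralGap P = 1 - |ξ| := by
  set S := {r : ℝ | ∃ ξ : ℝ, HasEigenvalue P.mulVecLin ξ ∧ ξ ≠ 1 ∧ r = |ξ|} with hS
  have hne : S.Nonempty := by
    by_contra hne
    rw [Set.not_nonempty_iff_eq_empty] at hne
    rw [spectralGap_eq, ← hS, hne, Real.sSup_empty, sub_zero] at h
    exact h rfl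
  have hfin : S.Finite := by
    refine ((finite_hasEigenvalue P.mulVecLin).image abs).subset ?_
    rintro _ ⟨ξ, hξ, -, rfl⟩
    exact ⟨ξ, hξ, rfl⟩
  obtain ⟨ξ, hξ, h1, hξS⟩ := hne.csSup_mem hfin
  exact ⟨ξ, hξ, h1, by rw [spectralGap_eq, ← hS, hξS]⟩

/-- Rayleigh bound for a symmetric operator off its fixed space. -/
theorem inner_apply_le_of_forall_eigenvalue {E : Type*} [NormedAddCommGroup E]
    [InnerProductSpace ℝ E] [FiniteDimensional ℝ E] {T : E →ₗ[ℝ] E} (hT : T.IsSymmetric) {s : ℝ}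
    (hs : ∀ ξ, HasEigenvalue T ξ → ξ ≠ 1 → ξ ≤ s) {g : E}
    (hg : ∀ h, T h = h → inner ℝ h g = 0) : inner ℝ g (T g) ≤ s * inner ℝ g g := by
  set b := hT.eigenvectorBasis rfl
  rw [← b.sum_inner_mul_inner g (T g), ← b.sum_inner_mul_inner g g, Finset.mul_sum]
  refine Finset.sum_le_sum fun i _ => ?_
  have h1 : T (b i) = hT.eigenvalues rfl i • b i := hT.apply_eigenvectorBasis rfl i
  have h2 : inner ℝ (b i) (T g) = hT.eigenvalues rfl i * inner ℝ (b i) g := by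
    rw [← hT, h1, real_inner_smul_left]
  rw [h2, real_inner_comm]
  by_cases h : hT.eigenvalues rfl i = 1
  · rw [hg (b i) (by rw [h1, h, one_smul])]
    simp
  · have : hT.eigenvalues rfl i ≤ s := hs _ (hT.hasEigenvalue_eigenvalues rfl i) h
    nlinarith [mul_self_nonneg (inner ℝ (b i) g : ℝ)]

theorem sum_mul_mulVec_le {μ : Ω → ℝ} (hμ : ∀ x, 0 < μ x) {P : Matrix Ω Ω ℝ}
    (hP : IsReversible μ P) {f : Ω → ℝ}
    (hf : ∀ g, P *ᵥ g = g → ∑ x, μ x * (g x * f x) = 0) :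
    spectralGap P * ∑ x, μ x * (f x * f x) ≤ dirichlet μ P f := by
  set d : Ω → ℝ := fun x => √(μ x) with hd
  have hd0 : ∀ x, d x ≠ 0 := fun x => (Real.sqrt_pos.2 (hμ x)).ne'
  have hdd : ∀ x, d x * d x = μ x := fun x => Real.mul_self_sqrt (hμ x).le
  let T : EuclideanSpace ℝ Ω →ₗ[ℝ] EuclideanSpace ℝ Ω :=
    { toFun := fun v => WithLp.toLp 2 fun x => d x * (P *ᵥ fun y => v y / d y) x
      map_add' := fun v w => by
        ext x
        have : (fun y => (v + w) y / d y) = (fun y => v y / d y) + fun y => w y / d y := by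
          ext y; simp [add_div]
        change d x * (P *ᵥ fun y => (v + w) y / d y) x =
          d x * (P *ᵥ fun y => v y / d y) x + d x * (P *ᵥ fun y => w y / d y) x
        rw [this, mulVec_add, Pi.add_apply, mul_add]
      map_smul' := fun c v => by
        ext x
        have : (fun y => (c • v) y / d y) = c • fun y => v y / d y := by
          ext y; simp [mul_div_assoc]
        change d x * (P *ᵥ fun y => (c • v) y / d y) x = c * (d x * (P *ᵥ fun y => v y / d y) x)
        rw [this, mulVec_smul, Pi.smul_apply, smul_eq_mul]
        ring }
  have hTx : ∀ v x, T v x = d x * (P *ᵥ fun y => v y / d y) x := fun _ _ => rfl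
  have hin : ∀ v w : EuclideanSpace ℝ Ω, inner ℝ v w = ∑ x, v x * w x := fun v w => by
    simp [PiLp.inner_apply, mul_comm]
  have hT : T.IsSymmetric := by
    intro v w
    rw [hin, hin]
    have := hP (fun y => v y / d y) (fun y => w y / d y)
    calc ∑ x, T v x * w x = ∑ x, μ x * ((P *ᵥ fun y => v y / d y) x * (w x / d x)) := by
          refine Finset.sum_congr rfl fun x _ => ?_
          rw [hTx, ← hdd]
          have := hd0 x
          field_simp
      _ = _ := this.symm
      _ = _ := by
          refine Finset.sum_congr rfl fun x _ => ?_
          rw [hTx, ← hdd]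
          have := hd0 x
          field_simp
  have hconv : ∀ (v : EuclideanSpace ℝ Ω) (ξ : ℝ), T v = ξ • v →
      P *ᵥ (fun y => v y / d y) = ξ • fun y => v y / d y := by
    intro v ξ h
    ext x
    have := congrArg (fun w : EuclideanSpace ℝ Ω => w x) h
    simp only [hTx, PiLp.smul_apply, smul_eq_mul] at this
    rw [Pi.smul_apply, smul_eq_mul, ← mul_div_assoc, ← this, mul_div_cancel_left₀ _ (hd0 x)]
  have hs : ∀ ξ, HasEigenvalue T ξ → ξ ≠ 1 → ξ ≤ 1 - spectralGap P := by
    intro ξ hξ h1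
    obtain ⟨v, hv⟩ := hξ.exists_hasEigenvector
    have hPv : HasEigenvalue P.mulVecLin ξ := by
      refine hasEigenvalue_of_hasEigenvector (x := fun y => v y / d y)
        ⟨mem_eigenspace_iff.2 (hconv v ξ hv.apply_eq_smul), fun h0 => hv.2 ?_⟩
      ext x
      have := congrFun h0 x
      simpa [hd0 x] using this
    have := spectralGap_le_one_sub_abs hPv h1
    linarith [le_abs_self ξ]
  set g : EuclideanSpace ℝ Ω := WithLp.toLp 2 fun x => d x * f x with hg
  have hgf : (fun y => g y / d y) = f := by
    ext y
    rw [hg]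
    exact mul_div_cancel_left₀ _ (hd0 y)
  have key := inner_apply_le_of_forall_eigenvalue hT hs (g := g) fun h hh => by
    rw [hin, ← hf _ (by simpa using hconv h 1 (by rw [hh, one_smul]))]
    refine Finset.sum_congr rfl fun x _ => ?_
    rw [← hdd]
    have := hd0 x
    simp only [hg]
    field_simp
  rw [hin, hin] at key
  have h1 : ∑ x, g x * T g x = ∑ x, μ x * (f x * (P *ᵥ f) x) :=
    Finset.sum_congr rfl fun x _ => by
      rw [hTx, hgf, ← hdd]
      simp only [hg]
      ring
  have h2 : ∑ x, g x * g x = ∑ x, μ x * (f x * f x) :=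
    Finset.sum_congr rfl fun x _ => by
      rw [← hdd]
      simp only [hg]
      ring
  rw [h1, h2] at key
  have h3 : dirichlet μ P f = ∑ x, μ x * (f x * f x) - ∑ x, μ x * (f x * (P *ᵥ f) x) := by
    rw [dirichlet, ← Finset.sum_sub_distrib]
    exact Finset.sum_congr rfl fun x _ => by ring
  rw [h3]
  linarith

theorem mulVec_eq_of_dirichlet_eq_zero {μ : Ω → ℝ} (hμ : ∀ x, 0 < μ x) {Q : Matrix Ω Ω ℝ}
    (hQ : IsReversible μ Q) (hQ0 : ∀ f, 0 ≤ dirichlet μ Q f) {g : Ω → ℝ}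
    (hg : dirichlet μ Q g ≤ 0) : Q *ᵥ g = g := by
  set h : Ω → ℝ := g - Q *ᵥ g with hh
  set b := ∑ x, μ x * (h x * h x) with hb
  have hexp : ∀ t : ℝ, dirichlet μ Q (g + t • h) =
      dirichlet μ Q h * (t * t) + 2 * b * t + dirichlet μ Q g := by
    intro t
    have hsym := hQ h g
    have h1 : b = ∑ x, μ x * (h x * g x) - ∑ x, μ x * (h x * (Q *ᵥ g) x) := by
      rw [hb, ← Finset.sum_sub_distrib]
      refine Finset.sum_congr rfl fun x _ => ?_
      simp only [hh, Pi.sub_apply]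
      ring
    have h2 : b = ∑ x, μ x * (h x * g x) - ∑ x, μ x * ((Q *ᵥ h) x * g x) := by rw [h1, hsym]
    have h3 : dirichlet μ Q (g + t • h) = dirichlet μ Q h * (t * t) +
        t * (∑ x, μ x * (h x * g x) - ∑ x, μ x * (h x * (Q *ᵥ g) x)) +
        t * (∑ x, μ x * (h x * g x) - ∑ x, μ x * ((Q *ᵥ h) x * g x)) + dirichlet μ Q g := by
      simp only [dirichlet, mulVec_add, mulVec_smul, Pi.add_apply, Pi.smul_apply, smul_eq_mul,
        Finset.mul_sum, Finset.sum_mul, ← Finset.sum_sub_distrib, ← Finset.sum_add_distrib]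
      exact Finset.sum_congr rfl fun x _ => by ring
    rw [h3, ← h1, ← h2]
    ring
  have hdisc := discrim_le_zero (a := dirichlet μ Q h) (b := 2 * b) (c := dirichlet μ Q g)
    fun t => by rw [← hexp]; exact hQ0 _
  rw [le_antisymm hg (hQ0 g), discrim] at hdisc
  have hb0 : b = 0 := by nlinarith
  have hzero := (Finset.sum_eq_zero_iff_of_nonneg fun x _ =>
    mul_nonneg (hμ x).le (mul_self_nonneg (h x))).1 hb0
  ext x
  have := hzero x (Finset.mem_univ x)
  have hx : h x = 0 := by simpa [(hμ x).ne'] using this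
  simp only [hh, Pi.sub_apply] at hx
  linarith

/-- Comparison of spectral gaps through Dirichlet forms. -/
theorem spectralGap_le_mul {μ : Ω → ℝ} (hμ : ∀ x, 0 < μ x) {P Q : Matrix Ω Ω ℝ}
    (hP : IsReversible μ P) (hQ : IsReversible μ Q) (hQ0 : ∀ f, 0 ≤ dirichlet μ Q f)
    (hQpos : ∀ ξ, HasEigenvalue Q.mulVecLin ξ → 0 ≤ ξ) {c c' : ℝ} (hc : 1 ≤ c)
    (h : ∀ f, dirichlet μ P f ≤ c * dirichlet μ Q f)
    (h' : ∀ f, dirichlet μ Q f ≤ c' * dirichlet μ P f) :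
    spectralGap P ≤ c * spectralGap Q := by
  by_cases hgap : spectralGap Q = 1
  · rw [hgap, mul_one]
    exact (spectralGap_le_one P).trans hc
  obtain ⟨ξ, hξ, h1, hgapξ⟩ := exists_eigenvalue_of_spectralGap_ne_one hgap
  rw [abs_of_nonneg (hQpos ξ hξ)] at hgapξ
  obtain ⟨f, hf, hf0⟩ := hξ.exists_hasEigenvector
  have hQf : Q *ᵥ f = ξ • f := mem_eigenspace_iff.1 hf
  have hperp : ∀ g, P *ᵥ g = g → ∑ x, μ x * (g x * f x) = 0 := by
    intro g hg
    have hDP : dirichlet μ P g = 0 := by simp [dirichlet, hg]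
    have hQg : Q *ᵥ g = g := mulVec_eq_of_dirichlet_eq_zero hμ hQ hQ0 (by
      have := h' g
      rwa [hDP, mul_zero] at this)
    have := hQ g f
    rw [hQg, hQf] at this
    have h2 : ξ * ∑ x, μ x * (g x * f x) = ∑ x, μ x * (g x * f x) := by
      rw [Finset.mul_sum]
      refine Eq.trans ?_ this
      refine Finset.sum_congr rfl fun x _ => ?_
      simp only [Pi.smul_apply, smul_eq_mul]
      ring
    by_contra hne
    exact h1 (mul_right_cancel₀ hne (h2.trans (one_mul _).symm))
  have h2 := sum_mul_mulVec_le hμ hP hperp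
  have h3 : dirichlet μ Q f = (1 - ξ) * ∑ x, μ x * (f x * f x) := by
    rw [dirichlet, hQf, Finset.mul_sum]
    refine Finset.sum_congr rfl fun x _ => ?_
    simp only [Pi.smul_apply, smul_eq_mul]
    ring
  have hpos : 0 < ∑ x, μ x * (f x * f x) := by
    obtain ⟨x, hx⟩ := Function.ne_iff.1 hf0
    exact Finset.sum_pos' (fun x _ => mul_nonneg (hμ x).le (mul_self_nonneg _))
      ⟨x, Finset.mem_univ x, mul_pos (hμ x) (mul_self_pos.2 hx)⟩
  refine le_of_mul_le_mul_right (h2.trans ((h f).trans_eq ?_)) hpos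
  rw [h3, hgapξ]
  ring

theorem eigenvalue_nonneg {μ : Ω → ℝ} (hμ : ∀ x, 0 < μ x) {Q : Matrix Ω Ω ℝ}
    (hQ : ∀ f : Ω → ℝ, 0 ≤ ∑ x, μ x * (f x * (Q *ᵥ f) x)) {ξ : ℝ}
    (hξ : HasEigenvalue Q.mulVecLin ξ) : 0 ≤ ξ := by
  obtain ⟨f, hf, hf0⟩ := hξ.exists_hasEigenvector
  have hQf : Q *ᵥ f = ξ • f := mem_eigenspace_iff.1 hf
  have hpos : 0 < ∑ x, μ x * (f x * f x) := by
    obtain ⟨x, hx⟩ := Function.ne_iff.1 hf0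
    exact Finset.sum_pos' (fun x _ => mul_nonneg (hμ x).le (mul_self_nonneg _))
      ⟨x, Finset.mem_univ x, mul_pos (hμ x) (mul_self_pos.2 hx)⟩
  have h := hQ f
  rw [hQf] at h
  have h2 : ∑ x, μ x * (f x * (ξ • f) x) = ξ * ∑ x, μ x * (f x * f x) := by
    rw [Finset.mul_sum]
    refine Finset.sum_congr rfl fun x _ => ?_
    simp only [Pi.smul_apply, smul_eq_mul]
    ring
  rw [h2] at h
  exact nonneg_of_mul_nonneg_left h hpos

end Comparison

end RandomCluster

namespace RandomCluster

/-! ## Heat-bath operators for Bernoulli edge sets -/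

section Projections

variable {ι M : Type*} [AddCommGroup M] [Module ℝ M]

theorem comm_foldr {T : ι → M →ₗ[ℝ] M} (hcomm : ∀ e e' f, T e (T e' f) = T e' (T e f)) (e : ι)
    (l : List ι) (f : M) : T e (l.foldr (fun e g => T e g) f) = l.foldr (fun e g => T e g) (T e f) := by
  induction l with
  | nil => rfl
  | cons a l ih => simp only [List.foldr_cons, hcomm e a, ih]

theorem foldr_idem {T : ι → M →ₗ[ℝ] M} (hcomm : ∀ e e' f, T e (T e' f) = T e' (T e f))
    (hid : ∀ e f, T e (T e f) = T e f) (l : List ι) (f : M) :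
    l.foldr (fun e g => T e g) (l.foldr (fun e g => T e g) f) = l.foldr (fun e g => T e g) f := by
  induction l generalizing f with
  | nil => rfl
  | cons a l ih => simp only [List.foldr_cons, comm_foldr hcomm, hid, ih]

theorem foldr_symm {B : LinearMap.BilinForm ℝ M} {T : ι → M →ₗ[ℝ] M}
    (hcomm : ∀ e e' f, T e (T e' f) = T e' (T e f))
    (hsymm : ∀ e f g, B (T e f) g = B f (T e g)) (l : List ι) (f g : M) :
    B (l.foldr (fun e g => T e g) f) g = B f (l.foldr (fun e g => T e g) g) := by
  induction l generalizing f g with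
  | nil => rfl
  | cons a l ih => simp only [List.foldr_cons, hsymm, ih, comm_foldr hcomm]

/-- For commuting orthogonal projections `T e` one has `1 - ∏ T e ≤ ∑ (1 - T e)`. -/
theorem sub_foldr_le_sum {B : LinearMap.BilinForm ℝ M} (hB : ∀ f, 0 ≤ B f f)
    {T : ι → M →ₗ[ℝ] M} (hcomm : ∀ e e' f, T e (T e' f) = T e' (T e f))
    (hid : ∀ e f, T e (T e f) = T e f) (hsymm : ∀ e f g, B (T e f) g = B f (T e g))
    (l : List ι) (f : M) :
    B f f - B (l.foldr (fun e g => T e g) f) f ≤ (l.map fun e => B f f - B (T e f) f).sum := by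
  induction l with
  | nil => simp
  | cons a l ih =>
    set g := l.foldr (fun e g => T e g) f with hg
    have hgg : B g g = B g f := by
      rw [hg, foldr_symm hcomm hsymm, foldr_idem hcomm hid, ← foldr_symm hcomm hsymm]
    have hfg : B f g = B g f := by rw [hg, foldr_symm hcomm hsymm]
    have hTg : B (T a g) g = B (T a g) f := by
      rw [hg, comm_foldr hcomm, foldr_symm hcomm hsymm, foldr_idem hcomm hid,
        ← foldr_symm hcomm hsymm]
    have hTf : B (T a f) g = B (T a g) f := by
      rw [hg, ← foldr_symm hcomm hsymm, comm_foldr hcomm]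
    have h1 := hB (f - g - T a (f - g))
    have hTT : B (T a (f - g)) (T a (f - g)) = B (T a (f - g)) (f - g) := by
      rw [← hsymm, hid]
    have hT' : B (f - g) (T a (f - g)) = B (T a (f - g)) (f - g) := (hsymm _ _ _).symm
    have h2 : B (f - g - T a (f - g)) (f - g - T a (f - g)) =
        B (f - g) (f - g) - B (T a (f - g)) (f - g) := by
      generalize f - g = k at hTT hT' ⊢
      simp only [map_sub, LinearMap.sub_apply, hTT, hT']
      ring
    have h3 : B (f - g) (f - g) = B f f - B g f := by
      simp only [map_sub, LinearMap.sub_apply, hgg, hfg]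
      ring
    have h4 : B (T a (f - g)) (f - g) = B (T a f) f - B (T a g) f := by
      simp only [map_sub, LinearMap.sub_apply, hTf, hTg]
      ring
    simp only [List.foldr_cons, List.map_cons, List.sum_cons, ← hg]
    linarith

end Projections

section Bernoulli

open scoped Classical

variable {ι : Type*}

/-- `A` with the status of `e` changed. -/
noncomputable def flip (e : ι) (A : Set ι) : Set ι := if e ∈ A then A \ {e} else insert e A

theorem flip_of_mem {e : ι} {A : Set ι} (h : e ∈ A) : flip e A = A \ {e} := if_pos h

theorem flip_of_notMem {e : ι} {A : Set ι} (h : e ∉ A) : flip e A = insert e A := if_neg h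

theorem mem_flip_self {e : ι} {A : Set ι} : e ∈ flip e A ↔ e ∉ A := by
  by_cases h : e ∈ A <;> simp [flip, h]

theorem mem_flip_of_ne {e e' : ι} {A : Set ι} (h : e' ≠ e) : e' ∈ flip e A ↔ e' ∈ A := by
  by_cases h' : e ∈ A <;> simp [flip, h, h']

theorem flip_flip (e : ι) (A : Set ι) : flip e (flip e A) = A := by
  ext e'
  by_cases h : e' = e
  · subst h; simp [mem_flip_self]
  · simp [mem_flip_of_ne h]

/-- The heat-bath update of the edge `e` with edge probabilities `r`. -/
noncomputable def heatBath (r : ι → ℝ) (e : ι) : (Set ι → ℝ) →ₗ[ℝ] (Set ι → ℝ) where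
  toFun f A := r e * f (insert e A) + (1 - r e) * f (A \ {e})
  map_add' f g := by ext A; simp only [Pi.add_apply]; ring
  map_smul' c f := by ext A; simp only [Pi.smul_apply, smul_eq_mul, RingHom.id_apply]; ring

theorem heatBath_apply (r : ι → ℝ) (e : ι) (f : Set ι → ℝ) (A : Set ι) :
    heatBath r e f A = r e * f (insert e A) + (1 - r e) * f (A \ {e}) := rfl

theorem heatBath_insert (r : ι → ℝ) (e : ι) (f : Set ι → ℝ) (A : Set ι) :
    heatBath r e f (insert e A) = heatBath r e f A := by
  simp [heatBath_apply]

theorem heatBath_diff (r : ι → ℝ) (e : ι) (f : Set ι → ℝ) (A : Set ι) :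
    heatBath r e f (A \ {e}) = heatBath r e f A := by
  simp [heatBath_apply]

theorem heatBath_flip (r : ι → ℝ) (e : ι) (f : Set ι → ℝ) (A : Set ι) :
    heatBath r e f (flip e A) = heatBath r e f A := by
  by_cases h : e ∈ A
  · rw [flip_of_mem h, heatBath_diff]
  · rw [flip_of_notMem h, heatBath_insert]

theorem heatBath_mul (r : ι → ℝ) (e : ι) (f g : Set ι → ℝ) (A : Set ι) :
    heatBath r e (fun A => f A * heatBath r e g A) A = heatBath r e f A * heatBath r e g A := by
  rw [heatBath_apply, heatBath_insert, heatBath_diff, heatBath_apply r e f]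
  ring

theorem heatBath_idem (r : ι → ℝ) (e : ι) (f : Set ι → ℝ) :
    heatBath r e (heatBath r e f) = heatBath r e f := by
  ext A
  rw [heatBath_apply, heatBath_insert, heatBath_diff]
  ring

theorem heatBath_comm (r : ι → ℝ) (e e' : ι) (f : Set ι → ℝ) :
    heatBath r e (heatBath r e' f) = heatBath r e' (heatBath r e f) := by
  by_cases h : e = e'
  · rw [h]
  ext A
  have h1 : insert e A \ {e'} = insert e (A \ {e'}) := by
    rw [Set.insert_sdiff_of_notMem]; exact h
  have h2 : insert e' A \ {e} = insert e' (A \ {e}) := by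
    rw [Set.insert_sdiff_of_notMem]; exact fun h' => h (Set.mem_singleton_iff.1 h').symm
  simp only [heatBath_apply, h1, h2, Set.insert_comm e e', Set.sdiff_sdiff_comm (s := A) (t := {e})]
  ring

theorem eq_empty_of_flip_invariant [Finite ι] {f : Set ι → ℝ} (h : ∀ e A, f (flip e A) = f A)
    (A : Set ι) : f A = f ∅ := by
  induction A, A.toFinite using Set.Finite.induction_on with
  | empty => rfl
  | @insert a s ha _ ih => rw [← ih, ← h a s, flip_of_notMem ha]

theorem sum_flip [Fintype ι] (e : ι) (F : Set ι → ℝ) : ∑ A, F (flip e A) = ∑ A, F A :=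
  Equiv.sum_comp (Function.Involutive.toPerm (flip e) (flip_flip e)) F

variable [Fintype ι]

/-- The law of a random set containing each `e` independently with probability `r e`. -/
noncomputable def bernoulliWeight (r : ι → ℝ) (A : Set ι) : ℝ := ∏ e, if e ∈ A then r e else 1 - r e

theorem bernoulliWeight_nonneg {r : ι → ℝ} (h0 : ∀ e, 0 ≤ r e) (h1 : ∀ e, r e ≤ 1) (A : Set ι) :
    0 ≤ bernoulliWeight r A :=
  Finset.prod_nonneg fun e _ => by
    split_ifs
    · exact h0 e
    · exact sub_nonneg.2 (h1 e)

theorem exists_bernoulliWeight_eq (r : ι → ℝ) (e : ι) (A : Set ι) :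
    ∃ w, bernoulliWeight r A = (if e ∈ A then r e else 1 - r e) * w ∧
      bernoulliWeight r (flip e A) = (if e ∈ A then 1 - r e else r e) * w := by
  refine ⟨∏ e' ∈ Finset.univ.erase e, if e' ∈ A then r e' else 1 - r e', ?_, ?_⟩
  · exact (Finset.mul_prod_erase _ _ (Finset.mem_univ e)).symm
  · rw [bernoulliWeight, ← Finset.mul_prod_erase _ _ (Finset.mem_univ e)]
    congr 1
    · by_cases h : e ∈ A <;> simp [mem_flip_self, h]
    · refine Finset.prod_congr rfl fun e' he' => ?_
      simp only [mem_flip_of_ne (Finset.ne_of_mem_erase he')]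

theorem sum_bernoulliWeight (r : ι → ℝ) : ∑ A, bernoulliWeight r A = 1 := by
  have h := Finset.prod_add (fun e => r e) (fun e => 1 - r e) (Finset.univ : Finset ι)
  simp only [add_sub_cancel, Finset.prod_const_one, Finset.powerset_univ] at h
  rw [h, ← Equiv.sum_comp Fintype.finsetEquivSet]
  refine Finset.sum_congr rfl fun t _ => ?_
  rw [bernoulliWeight, Finset.prod_ite]
  congr 1
  · refine Finset.prod_congr ?_ fun _ _ => rfl
    ext e; simp
  · refine Finset.prod_congr ?_ fun _ _ => rfl
    ext e; simp

/-- The expectation of `f`. -/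
noncomputable def bernoulliMean (r : ι → ℝ) (f : Set ι → ℝ) : ℝ := ∑ A, bernoulliWeight r A * f A

theorem bernoulliMean_heatBath (r : ι → ℝ) (e : ι) (f : Set ι → ℝ) :
    bernoulliMean r (heatBath r e f) = bernoulliMean r f := by
  have key : ∀ F : Set ι → ℝ, 2 * ∑ A, F A = ∑ A, (F A + F (flip e A)) := fun F => by
    rw [Finset.sum_add_distrib, sum_flip]
    ring
  have h2 : 2 * bernoulliMean r (heatBath r e f) = 2 * bernoulliMean r f := by
    rw [bernoulliMean, bernoulliMean, key, key]
    refine Finset.sum_congr rfl fun A _ => ?_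
    obtain ⟨w, h1, h2⟩ := exists_bernoulliWeight_eq r e A
    rw [heatBath_flip, h1, h2, heatBath_apply]
    by_cases h : e ∈ A
    · rw [flip_of_mem h, Set.insert_eq_of_mem h, if_pos h, if_pos h]
      ring
    · rw [flip_of_notMem h, Set.sdiff_singleton_eq_self h, if_neg h, if_neg h]
      ring
  linarith

/-- The `L²` inner product of the Bernoulli law. -/
noncomputable def bernoulliForm (r : ι → ℝ) : LinearMap.BilinForm ℝ (Set ι → ℝ) :=
  LinearMap.mk₂ ℝ (fun f g => bernoulliMean r fun A => f A * g A)
    (fun f f' g => by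
      simp only [bernoulliMean, ← Finset.sum_add_distrib]
      exact Finset.sum_congr rfl fun A _ => by simp only [Pi.add_apply]; ring)
    (fun c f g => by
      simp only [bernoulliMean, smul_eq_mul, Finset.mul_sum]
      exact Finset.sum_congr rfl fun A _ => by simp only [Pi.smul_apply, smul_eq_mul]; ring)
    (fun f g g' => by
      simp only [bernoulliMean, ← Finset.sum_add_distrib]
      exact Finset.sum_congr rfl fun A _ => by simp only [Pi.add_apply]; ring)
    (fun c f g => by
      simp only [bernoulliMean, smul_eq_mul, Finset.mul_sum]
      exact Finset.sum_congr rfl fun A _ => by simp only [Pi.smul_apply, smul_eq_mul]; ring)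

theorem bernoulliForm_apply (r : ι → ℝ) (f g : Set ι → ℝ) :
    bernoulliForm r f g = bernoulliMean r fun A => f A * g A := rfl

theorem bernoulliForm_comm (r : ι → ℝ) (f g : Set ι → ℝ) :
    bernoulliForm r f g = bernoulliForm r g f := by
  simp only [bernoulliForm_apply, mul_comm]

theorem bernoulliForm_heatBath (r : ι → ℝ) (e : ι) (f g : Set ι → ℝ) :
    bernoulliForm r f (heatBath r e g) = bernoulliForm r (heatBath r e f) (heatBath r e g) := by
  rw [bernoulliForm_apply, ← bernoulliMean_heatBath r e]
  exact congrArg _ (funext (heatBath_mul r e f g))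

theorem bernoulliForm_heatBath_symm (r : ι → ℝ) (e : ι) (f g : Set ι → ℝ) :
    bernoulliForm r (heatBath r e f) g = bernoulliForm r f (heatBath r e g) := by
  rw [bernoulliForm_heatBath, bernoulliForm_comm, bernoulliForm_heatBath, bernoulliForm_comm]

theorem bernoulliForm_self_nonneg {r : ι → ℝ} (h0 : ∀ e, 0 ≤ r e) (h1 : ∀ e, r e ≤ 1)
    (f : Set ι → ℝ) : 0 ≤ bernoulliForm r f f :=
  Finset.sum_nonneg fun A _ => mul_nonneg (bernoulliWeight_nonneg h0 h1 A) (mul_self_nonneg _)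

theorem sq_bernoulliMean_le {r : ι → ℝ} (h0 : ∀ e, 0 ≤ r e) (h1 : ∀ e, r e ≤ 1)
    (f : Set ι → ℝ) : bernoulliMean r f ^ 2 ≤ bernoulliForm r f f := by
  set c := bernoulliMean r f with hc
  have h := bernoulliForm_self_nonneg h0 h1 (f - fun _ => c)
  have h2 : bernoulliForm r (f - fun _ => c) (f - fun _ => c) =
      bernoulliForm r f f - 2 * c * bernoulliMean r f + c ^ 2 * ∑ A, bernoulliWeight r A := by
    simp only [bernoulliForm_apply, bernoulliMean, Finset.mul_sum, ← Finset.sum_sub_distrib,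
      ← Finset.sum_add_distrib]
    exact Finset.sum_congr rfl fun A _ => by simp only [Pi.sub_apply]; ring
  rw [h2, sum_bernoulliWeight, ← hc] at h
  linarith

theorem sq_bernoulliMean_le_heatBath {r : ι → ℝ} (h0 : ∀ e, 0 ≤ r e) (h1 : ∀ e, r e ≤ 1)
    (e : ι) (f : Set ι → ℝ) :
    bernoulliMean r f ^ 2 ≤ bernoulliForm r f (heatBath r e f) := by
  rw [bernoulliForm_heatBath, ← bernoulliMean_heatBath r e]
  exact sq_bernoulliMean_le h0 h1 _

/-- The Efron--Stein inequality. -/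
theorem efronStein {r : ι → ℝ} (h0 : ∀ e, 0 ≤ r e) (h1 : ∀ e, r e ≤ 1)
    (f : Set ι → ℝ) : bernoulliForm r f f - bernoulliMean r f ^ 2 ≤
    ∑ e, (bernoulliForm r f f - bernoulliForm r f (heatBath r e f)) := by
  have h := sub_foldr_le_sum (bernoulliForm_self_nonneg h0 h1) (heatBath_comm r)
    (heatBath_idem r) (bernoulliForm_heatBath_symm r) (Finset.univ : Finset ι).toList f
  rw [Finset.sum_map_toList] at h
  set g := (Finset.univ : Finset ι).toList.foldr (fun e g => heatBath r e g) f with hg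
  have hmean : bernoulliMean r g = bernoulliMean r f := by
    rw [hg]
    induction (Finset.univ : Finset ι).toList with
    | nil => rfl
    | cons a l ih => rw [List.foldr_cons, bernoulliMean_heatBath, ih]
  have hfix : ∀ l : List ι, ∀ e ∈ l, heatBath r e (l.foldr (fun e g => heatBath r e g) f) =
      l.foldr (fun e g => heatBath r e g) f := by
    intro l e he
    induction l with
    | nil => simp at he
    | cons a l ih =>
      rw [List.foldr_cons]
      rcases List.mem_cons.1 he with rfl | he
      · exact heatBath_idem r e _
      · rw [heatBath_comm, ih he]
  have hinv : ∀ e A, g (flip e A) = g A := fun e A => by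
    have hge : heatBath r e g = g := hfix _ e (Finset.mem_toList.2 (Finset.mem_univ e))
    rw [← hge, heatBath_flip]
  have hconst : ∀ A, g A = g ∅ := eq_empty_of_flip_invariant hinv
  have hg0 : g ∅ = bernoulliMean r f := by
    rw [← hmean, bernoulliMean, Finset.sum_congr rfl fun A _ => by rw [hconst A],
      ← Finset.sum_mul, sum_bernoulliWeight, one_mul]
  have hgf : bernoulliForm r g f = bernoulliMean r f ^ 2 := by
    rw [bernoulliForm_apply]
    simp only [hconst, hg0, bernoulliMean, sq, Finset.mul_sum]
    exact Finset.sum_congr rfl fun A _ => by ring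
  rw [hgf] at h
  simpa only [bernoulliForm_heatBath_symm] using h

end Bernoulli

end RandomCluster

namespace RandomCluster

open Matrix

/-! ## The Edwards--Sokal coupling -/

theorem dirichlet_eq_sub {Ω : Type*} [Fintype Ω] (μ : Ω → ℝ) (P : Matrix Ω Ω ℝ) (f : Ω → ℝ) :
    dirichlet μ P f = ∑ x, μ x * (f x * f x) - ∑ x, μ x * (f x * (P *ᵥ f) x) := by
  rw [dirichlet, ← Finset.sum_sub_distrib]
  exact Finset.sum_congr rfl fun x _ => by ring

theorem bernoulliForm_heatBath_le {ι : Type*} [Fintype ι] {r : ι → ℝ} (h0 : ∀ e, 0 ≤ r e)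
    (h1 : ∀ e, r e ≤ 1) (e : ι) (f : Set ι → ℝ) :
    bernoulliForm r f (heatBath r e f) ≤ bernoulliForm r f f := by
  have h := bernoulliForm_self_nonneg h0 h1 (f - heatBath r e f)
  simp only [map_sub, LinearMap.sub_apply, bernoulliForm_heatBath_symm, heatBath_idem] at h
  linarith

/-- Among the functions on `κ` the proportion of those with `f x = f y` is `1 / q`. -/
def updateEquiv {κ : Type*} [DecidableEq κ] {q : ℕ} {x y : κ} (hxy : x ≠ y) :
    {f : κ → Fin q // f x = f y} × Fin q ≃ (κ → Fin q) where
  toFun a := Function.update a.1.1 x a.2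
  invFun g := ⟨⟨Function.update g x (g y), by simp [hxy.symm]⟩, g x⟩
  left_inv := by
    rintro ⟨⟨f, hf⟩, k⟩
    simp [hxy.symm, ← hf]
  right_inv g := by simp

section

variable {α β : Type*} {G : Graph α β}

theorem endsConnected_iff {A : Set E(G)} {e : E(G)} {u v : V(G)} (h : G.IsLink e u v) :
    EndsConnected G A e ↔ Reach G A u v := by
  refine ⟨fun h' => h' u v h, fun hr a b hab => ?_⟩
  rcases hab.eq_and_eq_or_eq_and_eq h with ⟨h1, h2⟩ | ⟨h1, h2⟩
  · rwa [Subtype.ext h1, Subtype.ext h2]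
  · rw [Subtype.ext h1, Subtype.ext h2]
    exact (reach_equivalence G A).symm hr

theorem mem_monoEdges_iff {q : ℕ} {σ : V(G) → Fin q} {e : E(G)} {u v : V(G)}
    (h : G.IsLink e u v) : e ∈ monoEdges G σ ↔ σ u = σ v := by
  refine ⟨fun h' => h' u v h, fun hr a b hab => ?_⟩
  rcases hab.eq_and_eq_or_eq_and_eq h with ⟨h1, h2⟩ | ⟨h1, h2⟩
  · rwa [Subtype.ext h1, Subtype.ext h2]
  · rw [Subtype.ext h1, Subtype.ext h2, hr]

theorem exists_isLink (e : E(G)) : ∃ u v : V(G), G.IsLink e u v :=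
  let ⟨u, v, h⟩ := G.exists_isLink_of_mem_edgeSet e.2
  ⟨⟨u, h.left_mem⟩, ⟨v, h.right_mem⟩, h⟩

theorem endsConnected_of_mem {A : Set E(G)} {e : E(G)} (h : e ∈ A) : EndsConnected G A e :=
  fun _ _ hl => .single ⟨e, h, hl⟩

theorem subset_monoEdges_iff {q : ℕ} {σ : V(G) → Fin q} {A : Set E(G)} :
    A ⊆ monoEdges G σ ↔ ∀ u v, Reach G A u v → σ u = σ v := by
  constructor
  · intro h u v huv
    induction huv with
    | refl => rfl
    | tail _ hl ih =>
      obtain ⟨e, he, hl⟩ := hl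
      exact ih.trans (h he _ _ hl)
  · exact fun h e he u v hl => h u v (.single ⟨e, he, hl⟩)

/-- The connected components of `(V, A)`. -/
abbrev Component (G : Graph α β) (A : Set E(G)) : Type _ :=
  Quotient (Setoid.mk (Reach G A) (reach_equivalence G A))

/-- Colorings constant on the components of `(V, A)`. -/
def coloringEquiv (G : Graph α β) (q : ℕ) (A : Set E(G)) :
    {σ : V(G) → Fin q // A ⊆ monoEdges G σ} ≃ (Component G A → Fin q) where
  toFun σ := Quotient.lift σ.1 (subset_monoEdges_iff.1 σ.2)
  invFun f := ⟨fun v => f ⟦v⟧, subset_monoEdges_iff.2 fun _ _ h => congrArg f (Quotient.sound h)⟩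
  left_inv _ := rfl
  right_inv f := by
    ext c
    induction c using Quotient.inductionOn
    rfl

open scoped Classical

/-- The edge probabilities of the edge update given the coloring. -/
noncomputable def edgeProb (G : Graph α β) (p : ℝ) {q : ℕ} (σ : V(G) → Fin q) (e : E(G)) : ℝ :=
  if e ∈ monoEdges G σ then p else 0

/-- The (unnormalized) random-cluster weight. -/
noncomputable def rcWeight (G : Graph α β) (p : ℝ) (q : ℕ) (A : Set E(G)) : ℝ :=
  (p / (1 - p)) ^ A.ncard * (q : ℝ) ^ numComponents G A

/-- The (unnormalized) Potts weight. -/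
noncomputable def pottsWeight (G : Graph α β) (p : ℝ) {q : ℕ} (σ : V(G) → Fin q) : ℝ :=
  ((1 - p) ^ (monoEdges G σ).ncard)⁻¹

variable {p : ℝ} {q : ℕ}

theorem rcWeight_pos (hp0 : 0 < p) (hp1 : p < 1) (hq : 1 ≤ q) (A : Set E(G)) :
    0 < rcWeight G p q A := by
  have := sub_pos.2 hp1
  unfold rcWeight
  positivity

theorem pottsWeight_nonneg (hp1 : p < 1) (σ : V(G) → Fin q) : 0 ≤ pottsWeight G p σ := by
  have := sub_pos.2 hp1
  unfold pottsWeight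
  positivity

theorem edgeProb_nonneg (hp0 : 0 < p) (σ : V(G) → Fin q) (e : E(G)) : 0 ≤ edgeProb G p σ e := by
  unfold edgeProb; split_ifs <;> linarith

theorem edgeProb_le_one (hp1 : p < 1) (σ : V(G) → Fin q) (e : E(G)) : edgeProb G p σ e ≤ 1 := by
  unfold edgeProb; split_ifs <;> linarith

section Counting

variable [Fintype V(G)]

theorem card_coloring (q : ℕ) (A : Set E(G)) :
    Nat.card {σ : V(G) → Fin q // A ⊆ monoEdges G σ} = q ^ numComponents G A := by
  rw [Nat.card_congr (coloringEquiv G q A), Nat.card_fun, Nat.card_eq_fintype_card (α := Fin q),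
    Fintype.card_fin, numComponents]

theorem card_coloring_mono (q : ℕ) {A : Set E(G)} {e : E(G)} (h : ¬ EndsConnected G A e) :
    Nat.card {σ : V(G) → Fin q // A ⊆ monoEdges G σ ∧ e ∈ monoEdges G σ} * q =
      q ^ numComponents G A := by
  classical
  obtain ⟨u, v, huv⟩ := exists_isLink e
  rw [endsConnected_iff huv] at h
  let x : Component G A := ⟦u⟧
  let y : Component G A := ⟦v⟧
  have hxy : x ≠ y := fun hxy => h (Quotient.exact hxy)
  have e1 : {σ : V(G) → Fin q // A ⊆ monoEdges G σ ∧ e ∈ monoEdges G σ} ≃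
      {f : Component G A → Fin q // f x = f y} :=
    (Equiv.subtypeSubtypeEquivSubtypeInter _ _).symm.trans
      ((coloringEquiv G q A).subtypeEquiv fun σ => mem_monoEdges_iff huv)
  have h2 := Nat.card_congr (updateEquiv (q := q) hxy)
  rw [Nat.card_prod, Nat.card_eq_fintype_card (α := Fin q), Fintype.card_fin, Nat.card_fun,
    Nat.card_eq_fintype_card (α := Fin q), Fintype.card_fin] at h2
  rw [Nat.card_congr e1, h2, numComponents]

theorem sum_colorGivenEdges (hq : 1 ≤ q) (A : Set E(G)) :
    ∑ σ, colorGivenEdges G q A σ = 1 := by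
  have hq0 : (q : ℝ) ≠ 0 := by positivity
  simp only [colorGivenEdges]
  rw [← Finset.sum_filter, Finset.sum_const, ← Fintype.card_subtype, ← Nat.card_eq_fintype_card,
    card_coloring, nsmul_eq_mul]
  push_cast
  exact mul_inv_cancel₀ (pow_ne_zero _ hq0)

theorem sum_colorGivenEdges_mono (hq : 1 ≤ q) (A : Set E(G)) (e : E(G)) :
    ∑ σ, (if e ∈ monoEdges G σ then colorGivenEdges G q A σ else 0) =
      if EndsConnected G A e then 1 else 1 / (q : ℝ) := by
  have hq0 : (q : ℝ) ≠ 0 := by positivity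
  split_ifs with h
  · rw [← sum_colorGivenEdges hq A]
    refine Finset.sum_congr rfl fun σ _ => ?_
    by_cases hA : A ⊆ monoEdges G σ
    · rw [if_pos]
      obtain ⟨u, v, huv⟩ := exists_isLink e
      rw [mem_monoEdges_iff huv]
      exact subset_monoEdges_iff.1 hA u v ((endsConnected_iff huv).1 h)
    · rw [colorGivenEdges, if_neg hA, ite_self]
  · have h1 : ∀ σ : V(G) → Fin q, (if e ∈ monoEdges G σ then colorGivenEdges G q A σ else 0) =
        if A ⊆ monoEdges G σ ∧ e ∈ monoEdges G σ then ((q : ℝ) ^ numComponents G A)⁻¹ else 0 :=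
      fun σ => by
        rw [colorGivenEdges]
        by_cases h1 : A ⊆ monoEdges G σ <;> by_cases h2 : e ∈ monoEdges G σ <;> simp [h1, h2]
    simp only [h1]
    rw [← Finset.sum_filter, Finset.sum_const, ← Fintype.card_subtype,
      ← Nat.card_eq_fintype_card, nsmul_eq_mul]
    have h2 := card_coloring_mono q h
    have h3 : (Nat.card {σ : V(G) → Fin q // A ⊆ monoEdges G σ ∧ e ∈ monoEdges G σ} : ℝ) * q =
      (q : ℝ) ^ numComponents G A := by exact_mod_cast h2
    rw [← h3]
    have h4 : (Nat.card {σ : V(G) → Fin q // A ⊆ monoEdges G σ ∧ e ∈ monoEdges G σ} : ℝ) ≠ 0 := by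
      intro h0
      rw [h0, zero_mul] at h3
      exact pow_ne_zero _ hq0 h3.symm
    field_simp

end Counting

variable [Fintype E(G)]

theorem edgesGivenColor_eq (p : ℝ) (σ : V(G) → Fin q) (B : Set E(G)) :
    edgesGivenColor G p σ B = bernoulliWeight (edgeProb G p σ) B := by
  rw [edgesGivenColor, bernoulliWeight]
  split_ifs with h
  · rw [Finset.prod_ite]
    congr 1
    · rw [Finset.prod_congr rfl fun e he =>
          show edgeProb G p σ e = p from if_pos (h (Finset.mem_filter.1 he).2),
        Finset.prod_const, Set.ncard_eq_toFinset_card']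
      congr 2
      ext e; simp
    · have h1 : ∀ e, 1 - edgeProb G p σ e = if e ∈ monoEdges G σ then 1 - p else 1 := fun e => by
        rw [edgeProb]; split_ifs <;> simp
      simp only [h1]
      rw [Finset.prod_ite, Finset.prod_const, Finset.prod_const_one, mul_one,
        ← Set.ncard_sdiff h (Set.toFinite _), Set.ncard_eq_toFinset_card']
      congr 2
      ext e
      simp [and_comm]
  · obtain ⟨e, heB, he⟩ := Set.not_subset.1 h
    refine (Finset.prod_eq_zero (Finset.mem_univ e) ?_).symm
    rw [if_pos heB, edgeProb, if_neg he]

theorem rcWeight_mul_colorGivenEdges (hp1 : p < 1) (hq : 1 ≤ q)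
    (A : Set E(G)) (σ : V(G) → Fin q) : rcWeight G p q A * colorGivenEdges G q A σ =
      pottsWeight G p σ * bernoulliWeight (edgeProb G p σ) A := by
  rw [← edgesGivenColor_eq, rcWeight, colorGivenEdges, pottsWeight, edgesGivenColor]
  split_ifs with h
  · have hq0 : (q : ℝ) ≠ 0 := by positivity
    have hp : 1 - p ≠ 0 := (sub_pos.2 hp1).ne'
    have hle := Set.ncard_le_ncard h (Set.toFinite _)
    rw [mul_assoc, mul_inv_cancel₀ (pow_ne_zero _ hq0), mul_one, pow_sub₀ _ hp hle, div_pow]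
    field_simp
  · simp

theorem sbMatrix_mulVec (f : Set E(G) → ℝ) (A : Set E(G)) :
    (sbMatrix G p q *ᵥ f) A = 1 / (Nat.card E(G) : ℝ) * ∑ e, if EndsConnected G A e then
      p * f (insert e A) + (1 - p) * f (A \ {e}) else
      p / q * f (insert e A) + (1 - p / q) * f (A \ {e}) := by
  have key : ∀ (e : E(G)) (a b : ℝ), ∑ B : Set E(G),
      (if B = insert e A then a else if B = A \ {e} then b else 0) * f B =
        a * f (insert e A) + b * f (A \ {e}) := by
    intro e a b
    have hne : A \ {e} ≠ insert e A := fun h => by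
      have : e ∈ A \ {e} := h ▸ Set.mem_insert e A
      exact this.2 rfl
    have h1 : ∀ B : Set E(G), (if B = insert e A then a else if B = A \ {e} then b else 0) * f B =
        (if B = insert e A then a * f B else 0) + if B = A \ {e} then b * f B else 0 := by
      intro B
      by_cases h1 : B = insert e A
      · have h2 : B ≠ A \ {e} := fun h => hne (h.symm.trans h1)
        simp only [if_pos h1, if_neg h2, add_zero]
      · simp only [if_neg h1, zero_add, ite_mul, zero_mul]
    simp only [h1, Finset.sum_add_distrib, Finset.sum_ite_eq', Finset.mem_univ,
      if_true]
  simp only [mulVec, dotProduct, sbMatrix, finsum_eq_sum_of_fintype, mul_assoc, ← Finset.mul_sum,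
    Finset.sum_mul]
  rw [Finset.sum_comm]
  congr 1
  refine Finset.sum_congr rfl fun e _ => ?_
  split_ifs
  · exact key e _ _
  · exact key e _ _

variable [Fintype V(G)]

theorem swMatrix_mulVec (f : Set E(G) → ℝ) (A : Set E(G)) :
    (swMatrix G p q *ᵥ f) A =
      ∑ σ, colorGivenEdges G q A σ * bernoulliMean (edgeProb G p σ) f := by
  simp only [mulVec, dotProduct, swMatrix, finsum_eq_sum_of_fintype, edgesGivenColor_eq,
    bernoulliMean, Finset.sum_mul, Finset.mul_sum]
  rw [Finset.sum_comm]
  exact Finset.sum_congr rfl fun σ _ => Finset.sum_congr rfl fun B _ => mul_assoc _ _ _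

theorem sbMatrix_mulVec_eq_sum_heatBath (hq : 1 ≤ q) (f : Set E(G) → ℝ) (A : Set E(G)) :
    (sbMatrix G p q *ᵥ f) A = 1 / (Nat.card E(G) : ℝ) *
      ∑ e, ∑ σ, colorGivenEdges G q A σ * heatBath (edgeProb G p σ) e f A := by
  rw [sbMatrix_mulVec]
  congr 1
  refine Finset.sum_congr rfl fun e _ => ?_
  have h1 : ∀ σ : V(G) → Fin q, colorGivenEdges G q A σ * heatBath (edgeProb G p σ) e f A =
      (if e ∈ monoEdges G σ then colorGivenEdges G q A σ else 0) *
        (p * (f (insert e A) - f (A \ {e}))) + colorGivenEdges G q A σ * f (A \ {e}) := by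
    intro σ
    rw [heatBath_apply, edgeProb]
    split_ifs <;> ring
  simp only [h1, Finset.sum_add_distrib, ← Finset.sum_mul, sum_colorGivenEdges_mono hq,
    sum_colorGivenEdges hq]
  split_ifs <;> ring

theorem sum_rcWeight_mul (hp1 : p < 1) (hq : 1 ≤ q)
    (F : (V(G) → Fin q) → Set E(G) → ℝ) :
    ∑ A, rcWeight G p q A * ∑ σ, colorGivenEdges G q A σ * F σ A =
      ∑ σ, pottsWeight G p σ * bernoulliMean (edgeProb G p σ) (F σ) := by
  simp only [bernoulliMean, Finset.mul_sum, ← mul_assoc, rcWeight_mul_colorGivenEdges hp1 hq]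
  exact Finset.sum_comm

theorem form_id (hp1 : p < 1) (hq : 1 ≤ q) (f g : Set E(G) → ℝ) :
    ∑ A, rcWeight G p q A * (f A * g A) =
      ∑ σ : V(G) → Fin q, pottsWeight G p σ * bernoulliForm (edgeProb G p σ) f g := by
  simp only [bernoulliForm_apply]
  rw [← sum_rcWeight_mul hp1 hq]
  refine Finset.sum_congr rfl fun A _ => ?_
  rw [← Finset.sum_mul, sum_colorGivenEdges hq, one_mul]

theorem form_sw (hp1 : p < 1) (hq : 1 ≤ q) (f g : Set E(G) → ℝ) :
    ∑ A, rcWeight G p q A * (f A * (swMatrix G p q *ᵥ g) A) =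
      ∑ σ : V(G) → Fin q, pottsWeight G p σ *
        (bernoulliMean (edgeProb G p σ) f * bernoulliMean (edgeProb G p σ) g) := by
  have h1 : ∀ σ : V(G) → Fin q,
      bernoulliMean (edgeProb G p σ) f * bernoulliMean (edgeProb G p σ) g =
      bernoulliMean (edgeProb G p σ) fun A => f A * bernoulliMean (edgeProb G p σ) g :=
    fun σ => by
      rw [bernoulliMean, Finset.sum_mul]
      exact Finset.sum_congr rfl fun A _ => mul_assoc _ _ _
  simp only [h1]
  rw [← sum_rcWeight_mul hp1 hq]
  refine Finset.sum_congr rfl fun A _ => ?_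
  rw [swMatrix_mulVec, Finset.mul_sum]
  congr 1
  exact Finset.sum_congr rfl fun σ _ => by ring

theorem form_sb (hp1 : p < 1) (hq : 1 ≤ q) (f g : Set E(G) → ℝ) :
    ∑ A, rcWeight G p q A * (f A * (sbMatrix G p q *ᵥ g) A) =
      1 / (Nat.card E(G) : ℝ) * ∑ σ : V(G) → Fin q, pottsWeight G p σ *
        ∑ e, bernoulliForm (edgeProb G p σ) f (heatBath (edgeProb G p σ) e g) := by
  have h1 : ∀ e, ∑ σ : V(G) → Fin q, pottsWeight G p σ *
      bernoulliForm (edgeProb G p σ) f (heatBath (edgeProb G p σ) e g) =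
      ∑ A, rcWeight G p q A * ∑ σ : V(G) → Fin q, colorGivenEdges G q A σ *
        (f A * heatBath (edgeProb G p σ) e g A) := fun e => by
    simp only [bernoulliForm_apply]
    rw [← sum_rcWeight_mul hp1 hq]
  have h2 : ∑ σ : V(G) → Fin q, pottsWeight G p σ *
      ∑ e, bernoulliForm (edgeProb G p σ) f (heatBath (edgeProb G p σ) e g) =
      ∑ e, ∑ σ : V(G) → Fin q, pottsWeight G p σ *
        bernoulliForm (edgeProb G p σ) f (heatBath (edgeProb G p σ) e g) := by
    simp only [Finset.mul_sum]
    exact Finset.sum_comm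
  rw [h2, Finset.sum_congr rfl fun e _ => h1 e, Finset.sum_comm, Finset.mul_sum]
  refine Finset.sum_congr rfl fun A _ => ?_
  rw [sbMatrix_mulVec_eq_sum_heatBath hq]
  simp only [Finset.mul_sum]
  exact Finset.sum_congr rfl fun e _ => Finset.sum_congr rfl fun σ _ => by ring

theorem isReversible_sw (hp1 : p < 1) (hq : 1 ≤ q) :
    IsReversible (rcWeight G p q) (swMatrix G p q) := by
  intro f g
  have := form_sw (G := G) hp1 hq g f
  rw [form_sw hp1 hq]
  simp only [mul_comm _ (g _)]
  rw [this]
  exact Finset.sum_congr rfl fun σ _ => by ring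

theorem isReversible_sb (hp1 : p < 1) (hq : 1 ≤ q) :
    IsReversible (rcWeight G p q) (sbMatrix G p q) := by
  intro f g
  have := form_sb (G := G) hp1 hq g f
  rw [form_sb hp1 hq]
  simp only [mul_comm _ (g _)]
  rw [this]
  congr 1
  refine Finset.sum_congr rfl fun σ _ => ?_
  congr 1
  refine Finset.sum_congr rfl fun e _ => ?_
  rw [← bernoulliForm_heatBath_symm, bernoulliForm_comm]

theorem dirichlet_sw (hp1 : p < 1) (hq : 1 ≤ q) (f : Set E(G) → ℝ) :
    dirichlet (rcWeight G p q) (swMatrix G p q) f = ∑ σ : V(G) → Fin q, pottsWeight G p σ *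
      (bernoulliForm (edgeProb G p σ) f f - bernoulliMean (edgeProb G p σ) f ^ 2) := by
  rw [dirichlet_eq_sub, form_id hp1 hq, form_sw hp1 hq, ← Finset.sum_sub_distrib]
  exact Finset.sum_congr rfl fun σ _ => by ring

theorem dirichlet_sb [Nonempty E(G)] (hp1 : p < 1) (hq : 1 ≤ q) (f : Set E(G) → ℝ) :
    dirichlet (rcWeight G p q) (sbMatrix G p q) f =
      1 / (Nat.card E(G) : ℝ) * ∑ σ : V(G) → Fin q, pottsWeight G p σ *
        ∑ e, (bernoulliForm (edgeProb G p σ) f f -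
          bernoulliForm (edgeProb G p σ) f (heatBath (edgeProb G p σ) e f)) := by
  have hm : (Nat.card E(G) : ℝ) ≠ 0 := by exact_mod_cast Nat.card_pos.ne'
  rw [dirichlet_eq_sub, form_id hp1 hq, form_sb hp1 hq, Finset.mul_sum, ← Finset.sum_sub_distrib,
    Finset.mul_sum]
  refine Finset.sum_congr rfl fun σ _ => ?_
  rw [Finset.sum_sub_distrib, Finset.sum_const, Finset.card_univ, ← Nat.card_eq_fintype_card,
    nsmul_eq_mul]
  field_simp

theorem dirichlet_sw_le [Nonempty E(G)] (hp0 : 0 < p) (hp1 : p < 1) (hq : 1 ≤ q)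
    (f : Set E(G) → ℝ) : dirichlet (rcWeight G p q) (swMatrix G p q) f ≤
      Nat.card E(G) * dirichlet (rcWeight G p q) (sbMatrix G p q) f := by
  have hm : (Nat.card E(G) : ℝ) ≠ 0 := by exact_mod_cast Nat.card_pos.ne'
  rw [dirichlet_sw hp1 hq, dirichlet_sb hp1 hq, ← mul_assoc, mul_one_div_cancel hm, one_mul]
  exact Finset.sum_le_sum fun σ _ => mul_le_mul_of_nonneg_left
    (efronStein (edgeProb_nonneg hp0 σ) (edgeProb_le_one hp1 σ) f) (pottsWeight_nonneg hp1 σ)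

theorem dirichlet_sb_le [Nonempty E(G)] (hp0 : 0 < p) (hp1 : p < 1) (hq : 1 ≤ q)
    (f : Set E(G) → ℝ) : dirichlet (rcWeight G p q) (sbMatrix G p q) f ≤
      dirichlet (rcWeight G p q) (swMatrix G p q) f := by
  have hm : (0 : ℝ) < Nat.card E(G) := by exact_mod_cast Nat.card_pos
  rw [dirichlet_sw hp1 hq, dirichlet_sb hp1 hq, one_div, inv_mul_le_iff₀ hm, Finset.mul_sum]
  refine Finset.sum_le_sum fun σ _ => ?_
  rw [mul_left_comm]
  refine mul_le_mul_of_nonneg_left ?_ (pottsWeight_nonneg hp1 σ)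
  refine (Finset.sum_le_card_nsmul _ _ _ fun e _ => sub_le_sub_left
    (sq_bernoulliMean_le_heatBath (edgeProb_nonneg hp0 σ) (edgeProb_le_one hp1 σ) e f) _).trans_eq ?_
  rw [Finset.card_univ, ← Nat.card_eq_fintype_card, nsmul_eq_mul]

theorem dirichlet_sb_nonneg [Nonempty E(G)] (hp0 : 0 < p) (hp1 : p < 1) (hq : 1 ≤ q)
    (f : Set E(G) → ℝ) : 0 ≤ dirichlet (rcWeight G p q) (sbMatrix G p q) f := by
  rw [dirichlet_sb hp1 hq]
  refine mul_nonneg (by positivity) (Finset.sum_nonneg fun σ _ =>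
    mul_nonneg (pottsWeight_nonneg hp1 σ) (Finset.sum_nonneg fun e _ => sub_nonneg.2 ?_))
  exact bernoulliForm_heatBath_le (edgeProb_nonneg hp0 σ) (edgeProb_le_one hp1 σ) e f

theorem eigenvalue_sb_nonneg (hp0 : 0 < p) (hp1 : p < 1) (hq : 1 ≤ q) {ξ : ℝ}
    (h : Module.End.HasEigenvalue (sbMatrix G p q).mulVecLin ξ) : 0 ≤ ξ := by
  refine eigenvalue_nonneg (rcWeight_pos hp0 hp1 hq) (fun f => ?_) h
  rw [form_sb hp1 hq]
  refine mul_nonneg (by positivity) (Finset.sum_nonneg fun σ _ =>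
    mul_nonneg (pottsWeight_nonneg hp1 σ) (Finset.sum_nonneg fun e _ => ?_))
  rw [bernoulliForm_heatBath]
  exact bernoulliForm_self_nonneg (edgeProb_nonneg hp0 σ) (edgeProb_le_one hp1 σ) _

theorem eigenvalue_sw_nonneg (hp0 : 0 < p) (hp1 : p < 1) (hq : 1 ≤ q) {ξ : ℝ}
    (h : Module.End.HasEigenvalue (swMatrix G p q).mulVecLin ξ) : 0 ≤ ξ := by
  refine eigenvalue_nonneg (rcWeight_pos hp0 hp1 hq) (fun f => ?_) h
  rw [form_sw hp1 hq]
  exact Finset.sum_nonneg fun σ _ => mul_nonneg (pottsWeight_nonneg hp1 σ) (mul_self_nonneg _)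

/-- Swendsen--Wang is at most `m` times faster than the single-bond dynamics. -/
theorem spectralGap_sw_le [Nonempty E(G)] (hp0 : 0 < p) (hp1 : p < 1) (hq : 1 ≤ q) :
    spectralGap (swMatrix G p q) ≤ Nat.card E(G) * spectralGap (sbMatrix G p q) :=
  spectralGap_le_mul (rcWeight_pos hp0 hp1 hq) (isReversible_sw hp1 hq) (isReversible_sb hp1 hq)
    (dirichlet_sb_nonneg hp0 hp1 hq) (fun _ => eigenvalue_sb_nonneg hp0 hp1 hq)
    (by exact_mod_cast Nat.card_pos) (dirichlet_sw_le hp0 hp1 hq) (c' := 1)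
    (fun f => by rw [one_mul]; exact dirichlet_sb_le hp0 hp1 hq f)

/-- Swendsen--Wang is at least as fast as the single-bond dynamics. -/
theorem spectralGap_sb_le [Nonempty E(G)] (hp0 : 0 < p) (hp1 : p < 1) (hq : 1 ≤ q) :
    spectralGap (sbMatrix G p q) ≤ spectralGap (swMatrix G p q) := by
  have h := spectralGap_le_mul (c := 1) (rcWeight_pos (G := G) hp0 hp1 hq)
    (isReversible_sb hp1 hq) (isReversible_sw hp1 hq)
    (fun f => (dirichlet_sb_nonneg hp0 hp1 hq f).trans (dirichlet_sb_le hp0 hp1 hq f))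
    (fun _ => eigenvalue_sw_nonneg hp0 hp1 hq) le_rfl
    (fun f => by rw [one_mul]; exact dirichlet_sb_le hp0 hp1 hq f)
    (dirichlet_sw_le hp0 hp1 hq)
  rwa [one_mul] at h

end

end RandomCluster

namespace RandomCluster

open Matrix Module.End

/-! ## Single-bond dynamics on a graph and its dual -/

section FlipChains

variable {ι : Type*} [Fintype ι]

open scoped Classical

/-- Summation by parts for chains that change one edge at a time. -/
theorem sum_mul_sub_flip {μ : Set ι → ℝ} {ρ : Set ι → ι → ℝ}
    (hρ : ∀ A e, μ A * ρ A e = μ (flip e A) * ρ (flip e A) e) (e : ι) (f g : Set ι → ℝ) :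
    2 * ∑ A, μ A * (f A * (ρ A e * (g A - g (flip e A)))) =
      ∑ A, μ A * ρ A e * ((f A - f (flip e A)) * (g A - g (flip e A))) := by
  have h := sum_flip e fun A => μ A * (f A * (ρ A e * (g A - g (flip e A))))
  rw [two_mul]
  nth_rewrite 2 [← h]
  rw [← Finset.sum_add_distrib]
  refine Finset.sum_congr rfl fun A _ => ?_
  rw [flip_flip]
  linear_combination (f (flip e A) * (g A - g (flip e A))) * hρ A e

theorem form_flip {μ : Set ι → ℝ} {ρ : Set ι → ι → ℝ}
    (hρ : ∀ A e, μ A * ρ A e = μ (flip e A) * ρ (flip e A) e) {c : ℝ}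
    {P : Matrix (Set ι) (Set ι) ℝ}
    (hP : ∀ f A, (P *ᵥ f) A = f A + c * ∑ e, ρ A e * (f (flip e A) - f A)) (f g : Set ι → ℝ) :
    2 * ∑ A, μ A * (f A * (g A - (P *ᵥ g) A)) =
      c * ∑ e, ∑ A, μ A * ρ A e * ((f A - f (flip e A)) * (g A - g (flip e A))) := by
  simp only [← sum_mul_sub_flip hρ, ← Finset.mul_sum]
  rw [mul_left_comm]
  congr 1
  rw [Finset.sum_comm, Finset.mul_sum]
  refine Finset.sum_congr rfl fun A _ => ?_
  rw [hP]
  simp only [← Finset.mul_sum]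
  rw [mul_left_comm c, mul_left_comm c, sub_add_cancel_left, ← mul_neg, ← Finset.sum_neg_distrib]
  congr 3
  exact Finset.sum_congr rfl fun e _ => by ring

theorem isReversible_flip {μ : Set ι → ℝ} {ρ : Set ι → ι → ℝ}
    (hρ : ∀ A e, μ A * ρ A e = μ (flip e A) * ρ (flip e A) e) {c : ℝ}
    {P : Matrix (Set ι) (Set ι) ℝ}
    (hP : ∀ f A, (P *ᵥ f) A = f A + c * ∑ e, ρ A e * (f (flip e A) - f A)) :
    IsReversible μ P := by
  intro f g
  have h1 := form_flip hρ hP f g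
  have h2 := form_flip hρ hP g f
  simp only [mul_comm (g _ - g (flip _ _))] at h2
  rw [← h1] at h2
  have h3 : ∀ f g : Set ι → ℝ, ∑ A, μ A * (f A * (g A - (P *ᵥ g) A)) =
      ∑ A, μ A * (f A * g A) - ∑ A, μ A * (f A * (P *ᵥ g) A) := fun f g => by
    rw [← Finset.sum_sub_distrib]
    exact Finset.sum_congr rfl fun A _ => by ring
  rw [h3, h3] at h2
  simp only [mul_comm (g _)] at h2
  linarith

end FlipChains

theorem hasEigenvalue_submatrix {Ω Ω' : Type*} [Fintype Ω] [Fintype Ω'] (M : Matrix Ω' Ω' ℝ)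
    (Φ : Ω ≃ Ω') {ξ : ℝ} (h : HasEigenvalue (M.submatrix Φ Φ).mulVecLin ξ) :
    HasEigenvalue M.mulVecLin ξ := by
  obtain ⟨f, hf, hf0⟩ := h.exists_hasEigenvector
  have hf : M.submatrix Φ Φ *ᵥ f = ξ • f := mem_eigenspace_iff.1 hf
  rw [submatrix_mulVec_equiv] at hf
  refine hasEigenvalue_of_hasEigenvector (x := f ∘ Φ.symm) ⟨mem_eigenspace_iff.2 ?_, fun h0 => ?_⟩
  · ext x
    have := congrFun hf (Φ.symm x)
    simpa using this
  · refine hf0 (funext fun x => ?_)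
    have := congrFun h0 (Φ x)
    simpa using this

theorem spectralGap_submatrix {Ω Ω' : Type*} [Fintype Ω] [Fintype Ω'] (M : Matrix Ω' Ω' ℝ)
    (Φ : Ω ≃ Ω') : spectralGap (M.submatrix Φ Φ) = spectralGap M := by
  have h : ∀ ξ, HasEigenvalue (M.submatrix Φ Φ).mulVecLin ξ ↔ HasEigenvalue M.mulVecLin ξ :=
    fun ξ => by
      refine ⟨hasEigenvalue_submatrix M Φ, fun h => hasEigenvalue_submatrix _ Φ.symm ?_⟩
      simpa using h
  simp only [spectralGap_eq, h]

section

variable {α β : Type*} {G : Graph α β} {p : ℝ} {q : ℕ}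

open scoped Classical

/-- The rate at which the status of `e` is changed when `e` is chosen. -/
noncomputable def flipRate (G : Graph α β) (p : ℝ) (q : ℕ) (A : Set E(G)) (e : E(G)) : ℝ :=
  if e ∈ A then 1 - p else if EndsConnected G A e then p else p / q

theorem sbMatrix_mulVec_flip [Fintype E(G)] [Nonempty E(G)] (f : Set E(G) → ℝ) (A : Set E(G)) :
    (sbMatrix G p q *ᵥ f) A =
      f A + 1 / (Nat.card E(G) : ℝ) * ∑ e, flipRate G p q A e * (f (flip e A) - f A) := by
  have hm : (Nat.card E(G) : ℝ) ≠ 0 := by exact_mod_cast Nat.card_pos.ne'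
  have h1 : f A = 1 / (Nat.card E(G) : ℝ) * ∑ _e : E(G), f A := by
    rw [Finset.sum_const, Finset.card_univ, ← Nat.card_eq_fintype_card, nsmul_eq_mul]
    field_simp
  rw [sbMatrix_mulVec]
  nth_rewrite 1 [h1]
  rw [← mul_add, ← Finset.sum_add_distrib]
  congr 1
  refine Finset.sum_congr rfl fun e _ => ?_
  rw [flipRate]
  by_cases he : e ∈ A
  · rw [if_pos (endsConnected_of_mem he), if_pos he, flip_of_mem he, Set.insert_eq_of_mem he]
    ring
  · rw [if_neg he, flip_of_notMem he, Set.sdiff_singleton_eq_self he]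
    split_ifs <;> ring

theorem rcWeight_mul_flipRate_of_notMem [Finite β] [Fintype V(G)] (hp1 : p < 1) (hq : 1 ≤ q)
    {A : Set E(G)} {e : E(G)} (he : e ∉ A) : rcWeight G p q A * flipRate G p q A e =
      rcWeight G p q (insert e A) * flipRate G p q (insert e A) e := by
  have hq0 : (q : ℝ) ≠ 0 := by positivity
  have hp : 1 - p ≠ 0 := (sub_pos.2 hp1).ne'
  rw [flipRate, flipRate, if_neg he, if_pos (Set.mem_insert e A), rcWeight, rcWeight,
    Set.ncard_insert_of_notMem he (Set.toFinite _), pow_succ]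
  split_ifs with h
  · have hc : (q : ℝ) ^ numComponents G (insert e A) = (q : ℝ) ^ numComponents G A := by
      have : ∀ σ : V(G) → Fin q, insert e A ⊆ monoEdges G σ ↔ A ⊆ monoEdges G σ := fun σ => by
        rw [Set.insert_subset_iff, and_iff_right_iff_imp]
        intro hA
        obtain ⟨u, v, huv⟩ := exists_isLink e
        rw [mem_monoEdges_iff huv]
        exact subset_monoEdges_iff.1 hA u v ((endsConnected_iff huv).1 h)
      have h2 := card_coloring (G := G) q (insert e A)
      simp only [this, card_coloring] at h2
      exact_mod_cast h2.symm
    rw [hc]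
    field_simp
  · have hc : (q : ℝ) ^ numComponents G (insert e A) * q = (q : ℝ) ^ numComponents G A := by
      have h2 := card_coloring (G := G) q (insert e A)
      have h3 := card_coloring_mono q h
      simp only [Set.insert_subset_iff, and_comm (a := e ∈ _)] at h2
      rw [h2] at h3
      exact_mod_cast h3
    rw [← hc]
    field_simp

theorem rcWeight_mul_flipRate [Finite β] [Fintype V(G)] (hp1 : p < 1) (hq : 1 ≤ q)
    (A : Set E(G)) (e : E(G)) : rcWeight G p q A * flipRate G p q A e =
      rcWeight G p q (flip e A) * flipRate G p q (flip e A) e := by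
  by_cases he : e ∈ A
  · have h := rcWeight_mul_flipRate_of_notMem (G := G) hp1 hq (A := A \ {e}) (e := e) (by simp)
    rw [Set.insert_sdiff_singleton, Set.insert_eq_of_mem he] at h
    rw [flip_of_mem he, h]
  · rw [flip_of_notMem he, rcWeight_mul_flipRate_of_notMem hp1 hq he]

/-- The complementary set of dual edges. -/
def dualConfig {ι κ : Type*} (φ : ι ≃ κ) : Set ι ≃ Set κ where
  toFun A := {f | φ.symm f ∉ A}
  invFun B := {e | φ e ∉ B}
  left_inv A := by ext e; simp
  right_inv B := by ext f; simp

theorem mem_dualConfig {ι κ : Type*} {φ : ι ≃ κ} {A : Set ι} {e : ι} :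
    φ e ∈ dualConfig φ A ↔ e ∉ A := by
  simp [dualConfig]

theorem dualConfig_flip {ι κ : Type*} (φ : ι ≃ κ) (e : ι) (A : Set ι) :
    dualConfig φ (flip e A) = flip (φ e) (dualConfig φ A) := by
  ext f
  obtain ⟨e', rfl⟩ := φ.surjective f
  rw [mem_dualConfig]
  by_cases h : e' = e
  · subst h
    rw [mem_flip_self, mem_flip_self, mem_dualConfig]
  · rw [mem_flip_of_ne h, mem_flip_of_ne (φ.injective.ne h), mem_dualConfig]

theorem dualParam_denom_pos (hp0 : 0 < p) (hp1 : p < 1) : 0 < p + q * (1 - p) := by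
  have := sub_pos.2 hp1
  positivity

theorem dualParam_pos (hp0 : 0 < p) (hp1 : p < 1) (hq : 1 ≤ q) : 0 < dualParam p q := by
  have := sub_pos.2 hp1
  have := dualParam_denom_pos (q := q) hp0 hp1
  unfold dualParam
  positivity

theorem one_sub_dualParam (hp0 : 0 < p) (hp1 : p < 1) :
    1 - dualParam p q = p / (p + q * (1 - p)) := by
  have := (dualParam_denom_pos (q := q) hp0 hp1).ne'
  unfold dualParam
  field_simp
  ring

theorem dualParam_lt_one (hp0 : 0 < p) (hp1 : p < 1) : dualParam p q < 1 := by
  have h := one_sub_dualParam (q := q) hp0 hp1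
  have := div_pos hp0 (dualParam_denom_pos (q := q) hp0 hp1)
  linarith

variable {α' : Type*} {H : Graph α' β}

/-- The ratio of the rates of the single-bond dynamics on a graph and on its dual. -/
noncomputable def rateRatio (G : Graph α β) (p : ℝ) (q : ℕ) (A : Set E(G)) (e : E(G)) : ℝ :=
  if EndsConnected G (A \ {e}) e then p + q * (1 - p) else (p + q * (1 - p)) / q

theorem flipRate_eq_rateRatio_mul (hp0 : 0 < p) (hp1 : p < 1) (hq : 1 ≤ q) {φ : E(G) ≃ E(H)}
    (hφ : ∀ (A : Set E(G)) (e : E(G)), e ∉ A →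
      (EndsConnected H (dualConfig φ (insert e A)) (φ e) ↔ ¬ EndsConnected G A e))
    (A : Set E(G)) (e : E(G)) : flipRate G p q A e =
      rateRatio G p q A e * flipRate H (dualParam p q) q (dualConfig φ A) (φ e) := by
  have hq0 : (q : ℝ) ≠ 0 := by positivity
  have hD := (dualParam_denom_pos (q := q) hp0 hp1).ne'
  rw [flipRate, flipRate, rateRatio, mem_dualConfig]
  by_cases he : e ∈ A
  · have h := hφ (A \ {e}) e (by simp)
    rw [Set.insert_sdiff_singleton, Set.insert_eq_of_mem he] at h
    rw [if_pos he, if_neg (not_not.2 he), dualParam]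
    by_cases hc : EndsConnected G (A \ {e}) e
    · rw [if_pos hc, if_neg (mt h.1 (not_not.2 hc))]
      generalize p + q * (1 - p) = D at hD ⊢
      field_simp
    · rw [if_neg hc, if_pos (h.2 hc)]
      generalize p + q * (1 - p) = D at hD ⊢
      field_simp
  · rw [if_neg he, if_pos he, Set.sdiff_singleton_eq_self he, one_sub_dualParam hp0 hp1]
    split_ifs <;> field_simp

theorem rateRatio_flip (A : Set E(G)) (e : E(G)) :
    rateRatio G p q (flip e A) e = rateRatio G p q A e := by
  have : flip e A \ {e} = A \ {e} := by
    by_cases h : e ∈ A <;> simp [flip, h]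
  rw [rateRatio, this, rateRatio]

theorem rateRatio_le (hp0 : 0 < p) (hq : 1 ≤ q) (A : Set E(G)) (e : E(G)) :
    rateRatio G p q A e ≤ q := by
  have hq' : (1 : ℝ) ≤ q := by exact_mod_cast hq
  have h1 : p + q * (1 - p) ≤ q := by nlinarith
  unfold rateRatio
  split_ifs
  · exact h1
  · exact (div_le_one_of_le₀ h1 (by positivity)).trans hq'

theorem le_rateRatio (hp0 : 0 < p) (hp1 : p < 1) (hq : 1 ≤ q) (A : Set E(G)) (e : E(G)) :
    (p + q * (1 - p)) / q ≤ rateRatio G p q A e := by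
  have hq' : (1 : ℝ) ≤ q := by exact_mod_cast hq
  unfold rateRatio
  split_ifs
  · exact div_le_self (dualParam_denom_pos hp0 hp1).le hq'
  · exact le_rfl

theorem flipRate_nonneg (hp0 : 0 < p) (hp1 : p < 1) (A : Set E(G)) (e : E(G)) :
    0 ≤ flipRate G p q A e := by
  unfold flipRate
  split_ifs
  · linarith
  · exact hp0.le
  · positivity

/-- The single-bond dynamics on a graph is at most `q` times faster than on its dual. -/
theorem spectralGap_sb_le_dual [Finite β] [Fintype V(G)] [Fintype V(H)] [Nonempty E(G)]
    (hp0 : 0 < p) (hp1 : p < 1) (hq : 1 ≤ q) (φ : E(G) ≃ E(H))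
    (hφ : ∀ (A : Set E(G)) (e : E(G)), e ∉ A →
      (EndsConnected H (dualConfig φ (insert e A)) (φ e) ↔ ¬ EndsConnected G A e)) :
    spectralGap (sbMatrix G p q) ≤ q * spectralGap (sbMatrix H (dualParam p q) q) := by
  have : Fintype E(G) := Fintype.ofFinite _
  have : Fintype E(H) := Fintype.ofFinite _
  have : Nonempty E(H) := φ.nonempty_congr.1 inferInstance
  have hq' : (1 : ℝ) ≤ q := by exact_mod_cast hq
  set μ := rcWeight G p q
  set ρ := flipRate G p q
  set κ := rateRatio G p q
  set ρ' : Set E(G) → E(G) → ℝ := fun A e =>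
    flipRate H (dualParam p q) q (dualConfig φ A) (φ e) with hρ'
  set c := 1 / (Nat.card E(G) : ℝ) with hc
  have hc0 : 0 ≤ c := by positivity
  have hμ : ∀ A, 0 < μ A := rcWeight_pos hp0 hp1 hq
  have hD : 0 < (p + q * (1 - p)) / q :=
    div_pos (dualParam_denom_pos hp0 hp1) (by positivity)
  have hρκ : ∀ A e, ρ A e = κ A e * ρ' A e := flipRate_eq_rateRatio_mul hp0 hp1 hq hφ
  have hκ : ∀ A e, 0 < κ A e := fun A e => hD.trans_le (le_rateRatio hp0 hp1 hq A e)
  have hρ0 : ∀ A e, 0 ≤ ρ' A e := fun A e =>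
    flipRate_nonneg (dualParam_pos hp0 hp1 hq) (dualParam_lt_one hp0 hp1) _ _
  have hbal : ∀ A e, μ A * ρ A e = μ (flip e A) * ρ (flip e A) e :=
    rcWeight_mul_flipRate hp1 hq
  have hbal' : ∀ A e, μ A * ρ' A e = μ (flip e A) * ρ' (flip e A) e := fun A e => by
    have h := hbal A e
    rw [hρκ, hρκ, show κ (flip e A) e = κ A e from rateRatio_flip A e] at h
    refine mul_left_cancel₀ (hκ A e).ne' ?_
    linear_combination h
  have hP : ∀ f A, (sbMatrix G p q *ᵥ f) A = f A + c * ∑ e, ρ A e * (f (flip e A) - f A) :=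
    sbMatrix_mulVec_flip
  set Φ := dualConfig φ
  set Q := (sbMatrix H (dualParam p q) q).submatrix Φ Φ with hQdef
  have hQ : ∀ f A, (Q *ᵥ f) A = f A + c * ∑ e, ρ' A e * (f (flip e A) - f A) := by
    intro f A
    rw [hQdef, submatrix_mulVec_equiv, Function.comp_apply, sbMatrix_mulVec_flip,
      ← Nat.card_congr φ, ← hc, ← Equiv.sum_comp φ]
    simp only [Function.comp_apply, ← dualConfig_flip, Φ, Equiv.symm_apply_apply, hρ']
  have hdir : ∀ {M : Matrix (Set E(G)) (Set E(G)) ℝ} {r : Set E(G) → E(G) → ℝ},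
      (∀ A e, μ A * r A e = μ (flip e A) * r (flip e A) e) →
      (∀ f A, (M *ᵥ f) A = f A + c * ∑ e, r A e * (f (flip e A) - f A)) → ∀ f,
      dirichlet μ M f = c / 2 * ∑ e, ∑ A, μ A * r A e * (f A - f (flip e A)) ^ 2 := by
    intro M r h1 h2 f
    have := form_flip h1 h2 f f
    simp only [← sq] at this
    rw [dirichlet]
    linarith
  have hterm : ∀ (f : Set E(G) → ℝ) A e, 0 ≤ μ A * ρ' A e * (f A - f (flip e A)) ^ 2 :=
    fun f A e => mul_nonneg (mul_nonneg (hμ A).le (hρ0 A e)) (sq_nonneg _)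
  rw [← spectralGap_submatrix _ Φ]
  refine spectralGap_le_mul (c' := ((p + q * (1 - p)) / q)⁻¹) hμ (isReversible_flip hbal hP)
    (isReversible_flip hbal' hQ) (fun f => ?_) (fun ξ hξ => ?_) hq' (fun f => ?_) (fun f => ?_)
  · rw [hdir hbal' hQ]
    refine mul_nonneg (by positivity) ?_
    refine Finset.sum_nonneg fun e _ => ?_
    refine Finset.sum_nonneg fun A _ => ?_
    exact hterm f A e
  · exact eigenvalue_sb_nonneg (dualParam_pos hp0 hp1 hq) (dualParam_lt_one hp0 hp1) hq
      (hasEigenvalue_submatrix _ Φ hξ)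
  · rw [hdir hbal hP, hdir hbal' hQ, mul_left_comm]
    refine mul_le_mul_of_nonneg_left ?_ (by positivity)
    simp only [Finset.mul_sum]
    refine Finset.sum_le_sum fun e _ => Finset.sum_le_sum fun A _ => ?_
    rw [hρκ, mul_left_comm (μ A), mul_assoc (κ A e)]
    exact mul_le_mul_of_nonneg_right (rateRatio_le hp0 hq A e) (hterm f A e)
  · rw [hdir hbal hP, hdir hbal' hQ, mul_left_comm]
    refine mul_le_mul_of_nonneg_left ?_ (by positivity)
    simp only [Finset.mul_sum]
    refine Finset.sum_le_sum fun e _ => Finset.sum_le_sum fun A _ => ?_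
    rw [hρκ, mul_left_comm (μ A), mul_assoc (κ A e), ← mul_assoc _⁻¹]
    refine le_mul_of_one_le_left (hterm f A e) ?_
    rw [inv_mul_eq_div, one_le_div hD]
    exact le_rateRatio hp0 hp1 hq A e

end

theorem spectralGap_nonneg {Ω : Type*} [Fintype Ω] {μ : Ω → ℝ} (hμ : ∀ x, 0 < μ x)
    {Q : Matrix Ω Ω ℝ} (hQ0 : ∀ f, 0 ≤ dirichlet μ Q f)
    (hQpos : ∀ ξ, HasEigenvalue Q.mulVecLin ξ → 0 ≤ ξ) : 0 ≤ spectralGap Q := by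
  classical
  by_cases hgap : spectralGap Q = 1
  · rw [hgap]; exact zero_le_one
  obtain ⟨ξ, hξ, h1, hgapξ⟩ := exists_eigenvalue_of_spectralGap_ne_one hgap
  rw [hgapξ, abs_of_nonneg (hQpos ξ hξ)]
  have h : HasEigenvalue (1 - Q).mulVecLin (1 - ξ) := by
    obtain ⟨f, hf, hf0⟩ := hξ.exists_hasEigenvector
    have hQf : Q *ᵥ f = ξ • f := mem_eigenspace_iff.1 hf
    refine hasEigenvalue_of_hasEigenvector (x := f) ⟨mem_eigenspace_iff.2 ?_, hf0⟩
    rw [mulVecLin_apply, sub_mulVec, one_mulVec, hQf, sub_smul, one_smul]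
  refine eigenvalue_nonneg hμ (fun f => ?_) h
  simp only [sub_mulVec, one_mulVec, Pi.sub_apply]
  exact hQ0 f

theorem spectralGap_sbMatrix_of_isEmpty {α β : Type*} [Finite β] (G : Graph α β) (p : ℝ) (q : ℕ)
    [IsEmpty E(G)] : spectralGap (sbMatrix G p q) = 1 := by
  have : Fintype E(G) := Fintype.ofFinite _
  by_contra h
  obtain ⟨ξ, hξ, -, hgap⟩ := exists_eigenvalue_of_spectralGap_ne_one h
  obtain ⟨f, hf, hf0⟩ := hξ.exists_hasEigenvector
  have h0 : sbMatrix G p q = 0 := by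
    ext A B
    simp [sbMatrix]
  have hQf : sbMatrix G p q *ᵥ f = ξ • f := mem_eigenspace_iff.1 hf
  rw [h0, zero_mulVec] at hQf
  have hξ0 : ξ = 0 := (smul_eq_zero.1 hQf.symm).resolve_right hf0
  rw [hξ0, abs_zero, sub_zero] at hgap
  exact h hgap

end RandomCluster

theorem theorem5p5 {α β : Type*} [Finite β] (G : Graph α β) (hV : V(G).Finite)
    (hG : RandomCluster.IsConnectedGraph G) (R : RandomCluster.PlaneRep G)
    (p : ℝ) (hp0 : 0 < p) (hp1 : p < 1) (q : ℕ) (hq : 1 ≤ q) (m : ℕ) (hm : m = Nat.card E(G)) :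
    spectralGap (RandomCluster.sbMatrix G p q) ≤
        q * spectralGap
          (RandomCluster.sbMatrix R.dual (RandomCluster.dualParam p q) q) ∧
      (2 ≤ m →
        spectralGap (RandomCluster.swMatrix G p q) ≤
          8 * q * m * Real.log m * spectralGap
            (RandomCluster.swMatrix R.dual (RandomCluster.dualParam p q) q)) := by
  subst hm
  have : Finite V(G) := hV.to_subtype
  have : Finite V(R.dual) := (R.finite_faces hV hG).to_subtype
  let _ : Fintype V(G) := Fintype.ofFinite _
  let _ : Fintype V(R.dual) := Fintype.ofFinite _
  let _ : Fintype E(G) := Fintype.ofFinite _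
  let _ : Fintype E(R.dual) := Fintype.ofFinite _
  have hq' : (1 : ℝ) ≤ q := by exact_mod_cast hq
  let φ : E(G) ≃ E(R.dual) := Equiv.setCongr (R.edgeSet_dual hV hG).symm
  have hφ : ∀ (A : Set E(G)) (e : E(G)), e ∉ A →
      (RandomCluster.EndsConnected R.dual (RandomCluster.dualConfig φ (insert e A)) (φ e) ↔
        ¬ RandomCluster.EndsConnected G A e) := by
    intro A e he
    refine R.endsConnected_dual_iff hV hG he (fun f => ?_) (φ e) rfl
    obtain ⟨f, rfl⟩ := φ.surjective f
    rw [RandomCluster.mem_dualConfig, Set.mem_insert_iff, not_or]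
    refine and_congr (not_congr Subtype.ext_iff) ⟨fun h g hg hfg => h ?_, fun h hf => h f hf rfl⟩
    rwa [show f = g from Subtype.ext hfg]
  have hp0' := RandomCluster.dualParam_pos hp0 hp1 hq
  have hp1' := RandomCluster.dualParam_lt_one (q := q) hp0 hp1
  rcases isEmpty_or_nonempty E(G) with hE | hE
  · have : IsEmpty E(R.dual) := φ.isEmpty_congr.1 hE
    refine ⟨?_, fun h => ?_⟩
    · rw [RandomCluster.spectralGap_sbMatrix_of_isEmpty,
        RandomCluster.spectralGap_sbMatrix_of_isEmpty, mul_one]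
      exact hq'
    · rw [Nat.card_of_isEmpty] at h
      omega
  · have : Nonempty E(R.dual) := φ.nonempty_congr.1 hE
    have h1 := RandomCluster.spectralGap_sb_le_dual (H := R.dual) hp0 hp1 hq φ hφ
    refine ⟨h1, fun hm => ?_⟩
    have h2 := RandomCluster.spectralGap_sw_le (G := G) hp0 hp1 hq
    have h3 := RandomCluster.spectralGap_sb_le (G := R.dual) hp0' hp1' hq
    have h4 : 0 ≤ spectralGap (RandomCluster.swMatrix R.dual (RandomCluster.dualParam p q) q) :=
      RandomCluster.spectralGap_nonneg (RandomCluster.rcWeight_pos hp0' hp1' hq)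
        (fun f => (RandomCluster.dirichlet_sb_nonneg hp0' hp1' hq f).trans
          (RandomCluster.dirichlet_sb_le hp0' hp1' hq f))
        (fun ξ hξ => RandomCluster.eigenvalue_sw_nonneg hp0' hp1' hq hξ)
    set m := Nat.card E(G)
    have hlog : 1 ≤ 8 * Real.log m := by
      have := Real.log_le_log zero_lt_two (show (2 : ℝ) ≤ m by exact_mod_cast hm)
      linarith [Real.log_two_gt_d9]
    set x := spectralGap (RandomCluster.swMatrix R.dual (RandomCluster.dualParam p q) q)
    calc _ ≤ (m : ℝ) * (q * x) := h2.trans (mul_le_mul_of_nonneg_left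
          (h1.trans (mul_le_mul_of_nonneg_left h3 (by positivity))) (by positivity))
      _ ≤ (m : ℝ) * (q * x) * (8 * Real.log m) := le_mul_of_one_le_right (by positivity) hlog
      _ = _ := by ring
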